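/- **Proposition 3.2 (radical).** Let $n\ge 2$ and let $\mathbb K$ be a field of characteristic $0$. Let $r,s\in\mathbb K^\times$, $r\ne s$, be roots of unity, $r$ a primitive $d$th and $s$ a primitive $d'$th root of unity ($d,d'\ge 1$), and put $\ell=\operatorname{lcm}(d,d')$. Let $\epsilon_1,\dots,\epsilon_n$ be the standard orthonormal basis of $\mathbb R^n$ and $\alpha_j=\epsilon_j-\epsilon_{j+1}$. Let $U=U_{r,s}(\mathfrak{sl}_n)$ be the unital associative $\mathbb K$-algebra generated by $e_i,f_i,\omega_i^{\pm1},(\omega_i')^{\pm1}$ $(1\le i<n)$ with relations: - the $\omega_i^{\pm1},(\omega_j')^{\pm1}$ commute with one another, and $\omega_i\omega_i^{-1}=\omega_i'(\omega_i')^{-1}=1$; - $\omega_ie_j=r^{\langle\epsilon_i,\alpha_j\rangle}s^{\langle\epsilon_{i+1},\alpha_j\rangle}e_j\omega_i$ and $\omega_if_j=r^{-\langle\epsilon_i,\alpha_j\rangle}s^{-\langle\epsilon_{i+1},\alpha_j\rangle}f_j\omega_i$; - $\omega_i'e_j=r^{\langle\epsilon_{i+1},\alpha_j\rangle}s^{\langle\epsilon_i,\alpha_j\rangle}e_j\omega_i'$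 and $\omega_i'f_j=r^{-\langle\epsilon_{i+1},\alpha_j\rangle}s^{-\langle\epsilon_i,\alpha_j\rangle}f_j\omega_i'$; - $[e_i,f_j]=\frac{\delta_{i,j}}{r-s}(\omega_i-\omega_i')$; - $[e_i,e_j]=[f_i,f_j]=0$ if $|i-j|>1$; - $e_i^2e_{i+1}-(r+s)e_ie_{i+1}e_i+rs\,e_{i+1}e_i^2=0$ and $e_ie_{i+1}^2-(r+s)e_{i+1}e_ie_{i+1}+rs\,e_{i+1}^2e_i=0$; - $f_i^2f_{i+1}-(r^{-1}+s^{-1})f_if_{i+1}f_i+r^{-1}s^{-1}f_{i+1}f_i^2=0$ and $f_if_{i+1}^2-(r^{-1}+s^{-1})f_{i+1}f_if_{i+1}+r^{-1}s^{-1}f_{i+1}^2f_i=0$. The coproduct $\Delta$ and counit $\varepsilon$ are the algebra maps for which the $\omega_i^{\pm1},(\omega_i')^{\pm1}$ are group-like, $\Delta(e_i)=e_i\otimes1+\omega_i\otimes e_i$, $\Delta(f_i)=1\otimes f_i+f_i\otimes\omega_i'$ and $\varepsilon(e_i)=\varepsilon(f_i)=0$. Let $U^{\ge0}$ be the subalgebra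 generated by the $e_i,\omega_i^{\pm1}$, and $U^{\le0}$ the subalgebra generated by the $f_i,(\omega_i')^{\pm1}$. Call a bilinear map $(\,|\,):U^{\le0}\times U^{\ge0}\to\mathbb K$ a *Hopf pairing* here if $$(f_i|e_j)=\frac{\delta_{i,j}}{s-r},\quad (\omega_i'|\omega_j)=r^{\langle\epsilon_j,\alpha_i\rangle}s^{\langle\epsilon_{j+1},\alpha_i\rangle},\quad (f_i|\omega_j)=(\omega_i'|e_j)=0$$ for $1\le i,j<n$, and, for all $b,c\in U^{\ge0}$ and $b',c'\in U^{\le0}$, $(1|b)=\varepsilon(b)$, $(b'|1)=\varepsilon(b')$, $$(b'|bc)=\sum(b'_{(2)}|b)(b'_{(1)}|c),\qquad (b'c'|b)=\sum(b'|b_{(1)})(c'|b_{(2)}),$$ where $\Delta(b')=\sum b'_{(1)}\otimes b'_{(2)}$ and $\Delta(b)=\sum b_{(1)}\otimes b_{(2)}$. Put $\mathcal E_{j,j}=e_j$, $\mathcal E_{i,j}=e_i\mathcal E_{i-1,j}-r^{-1}\mathcal E_{i-1,j}e_i$ and $\mathcal F_{j,j}=f_j$, $\mathcal F_{i,j}=f_i\mathcal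 F_{i-1,j}-s\,\mathcal F_{i-1,j}f_i$ for $i>j$. Let $I_n$ be the two-sided ideal of $U$ generated by all $\mathcal E_{i,j}^\ell$, $\mathcal F_{i,j}^\ell$, $\omega_i^\ell-1$, $(\omega_i')^\ell-1$ $(1\le j\le i<n)$, and let $\mathfrak u=\mathfrak u_{r,s}(\mathfrak{sl}_n)=U/I_n$. Then there is exactly one such Hopf pairing $(\,|\,)$, and $I_n$ is contained in its radical: $(y|x)=0$ for all $x\in I_n\cap U^{\ge0}$ and $y\in U^{\le0}$, and for all $y\in I_n\cap U^{\le0}$ and $x\in U^{\ge0}$. Consequently the pairing descends to $\mathfrak u$: there is exactly one bilinear map $q$ from the product of the images of $U^{\le0}$ and $U^{\ge0}$ in $\mathfrak u$ to $\mathbb K$ such that $q(\bar y,\bar x)=(y|x)$ for all $y\in U^{\le0}$ and $x\in U^{\ge0}$. -/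

import Mathlib

open scoped TensorProduct

noncomputable section

namespace TwoParam

/-- The integer `⟨ε_a, α_j⟩ = ⟨ε_a, ε_j - ε_{j+1}⟩`. -/
def epsAlpha (a j : ℕ) : ℤ := (if a = j then 1 else 0) - (if a = j + 1 then 1 else 0)

variable {K : Type*} [Field K]

/-- `r ^ ⟨ε_i, α_j⟩ * s ^ ⟨ε_{i+1}, α_j⟩`, the scalar in `ω_i e_j = _ e_j ω_i`. -/
def chi (r s : Kˣ) (i j : ℕ) : Kˣ := r ^ epsAlpha i j * s ^ epsAlpha (i + 1) j

/-- `r ^ ⟨ε_{i+1}, α_j⟩ * s ^ ⟨ε_i, α_j⟩`, the scalar in `ω_i' e_j = _ e_j ω_i'`. -/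
def chi' (r s : Kˣ) (i j : ℕ) : Kˣ := r ^ epsAlpha (i + 1) j * s ^ epsAlpha i j

/-- The generators of `U_{r,s}(sl_n)`. The index set `{1, …, n-1}` is `Fin (n - 1)`, shifted
by one. -/
inductive Gen (n : ℕ) : Type
  | e (i : Fin (n - 1))
  | f (i : Fin (n - 1))
  | om (i : Fin (n - 1))
  | omInv (i : Fin (n - 1))
  | om' (i : Fin (n - 1))
  | om'Inv (i : Fin (n - 1))

/-- The generators `ω_i^{±1}, (ω_i')^{±1}`. -/
def Gen.IsToral {n : ℕ} : Gen n → Prop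
  | .e _ => False
  | .f _ => False
  | _ => True

section Relations

variable {n : ℕ}

local notation "E" => fun i => FreeAlgebra.ι K (Gen.e (n := n) i)
local notation "F" => fun i => FreeAlgebra.ι K (Gen.f (n := n) i)
local notation "W" => fun i => FreeAlgebra.ι K (Gen.om (n := n) i)
local notation "W'" => fun i => FreeAlgebra.ι K (Gen.om' (n := n) i)

/-- The defining relations of `U_{r,s}(sl_n)`. -/
inductive Rel (r s : Kˣ) : FreeAlgebra K (Gen n) → FreeAlgebra K (Gen n) → Prop
  | toral_comm (g h : Gen n) (hg : g.IsToral) (hh : h.IsToral) :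
      Rel r s (FreeAlgebra.ι K g * FreeAlgebra.ι K h) (FreeAlgebra.ι K h * FreeAlgebra.ι K g)
  | om_inv (i : Fin (n - 1)) : Rel r s (W i * FreeAlgebra.ι K (Gen.omInv i)) 1
  | om'_inv (i : Fin (n - 1)) : Rel r s (W' i * FreeAlgebra.ι K (Gen.om'Inv i)) 1
  | om_e (i j : Fin (n - 1)) : Rel r s (W i * E j) ((chi r s i j : K) • (E j * W i))
  | om_f (i j : Fin (n - 1)) : Rel r s (W i * F j) (((chi r s i j)⁻¹ : Kˣ).val • (F j * W i))
  | om'_e (i j : Fin (n - 1)) : Rel r s (W' i * E j) ((chi' r s i j : K) • (E j * W' i))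
  | om'_f (i j : Fin (n - 1)) : Rel r s (W' i * F j) (((chi' r s i j)⁻¹ : Kˣ).val • (F j * W' i))
  | e_f_same (i : Fin (n - 1)) :
      Rel r s (E i * F i - F i * E i) (((r : K) - (s : K))⁻¹ • (W i - W' i))
  | e_f_ne (i j : Fin (n - 1)) (h : i ≠ j) : Rel r s (E i * F j - F j * E i) 0
  | e_comm (i j : Fin (n - 1)) (h : (i : ℕ) + 1 < j) : Rel r s (E i * E j - E j * E i) 0
  | f_comm (i j : Fin (n - 1)) (h : (i : ℕ) + 1 < j) : Rel r s (F i * F j - F j * F i) 0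
  | e_serre₁ (i j : Fin (n - 1)) (h : (j : ℕ) = i + 1) :
      Rel r s (E i ^ 2 * E j - ((r : K) + s) • (E i * E j * E i)
        + ((r : K) * s) • (E j * E i ^ 2)) 0
  | e_serre₂ (i j : Fin (n - 1)) (h : (j : ℕ) = i + 1) :
      Rel r s (E i * E j ^ 2 - ((r : K) + s) • (E j * E i * E j)
        + ((r : K) * s) • (E j ^ 2 * E i)) 0
  | f_serre₁ (i j : Fin (n - 1)) (h : (j : ℕ) = i + 1) :
      Rel r s (F i ^ 2 * F j - ((r : K)⁻¹ + (s : K)⁻¹) • (F i * F j * F i)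
        + ((r : K)⁻¹ * (s : K)⁻¹) • (F j * F i ^ 2)) 0
  | f_serre₂ (i j : Fin (n - 1)) (h : (j : ℕ) = i + 1) :
      Rel r s (F i * F j ^ 2 - ((r : K)⁻¹ + (s : K)⁻¹) • (F j * F i * F j)
        + ((r : K)⁻¹ * (s : K)⁻¹) • (F j ^ 2 * F i)) 0

end Relations

variable (n : ℕ) (r s : Kˣ)

/-- The algebra `U_{r,s}(sl_n)`, given by generators and relations. -/
abbrev U : Type _ := RingQuot (Rel (n := n) r s)

/-- The class in `U_{r,s}(sl_n)` of a generator. -/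
def gen (g : Gen n) : U n r s := RingQuot.mkAlgHom K (Rel r s) (FreeAlgebra.ι K g)

/-- `e_i` -/
abbrev e (i : Fin (n - 1)) : U n r s := gen n r s (.e i)
/-- `f_i` -/
abbrev f (i : Fin (n - 1)) : U n r s := gen n r s (.f i)
/-- `ω_i` -/
abbrev om (i : Fin (n - 1)) : U n r s := gen n r s (.om i)
/-- `ω_i⁻¹` -/
abbrev omInv (i : Fin (n - 1)) : U n r s := gen n r s (.omInv i)
/-- `ω_i'` -/
abbrev om' (i : Fin (n - 1)) : U n r s := gen n r s (.om' i)
/-- `(ω_i')⁻¹` -/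
abbrev om'Inv (i : Fin (n - 1)) : U n r s := gen n r s (.om'Inv i)

/-! The defining relations, as identities in `U`. -/

section Identities

variable {n r s}

lemma toral_comm (g h : Gen n) (hg : g.IsToral) (hh : h.IsToral) :
    gen n r s g * gen n r s h = gen n r s h * gen n r s g := by
  simpa [gen] using RingQuot.mkAlgHom_rel K (Rel.toral_comm (r := r) (s := s) g h hg hh)

lemma om_inv (i : Fin (n - 1)) : om n r s i * omInv n r s i = 1 := by
  simpa [gen] using RingQuot.mkAlgHom_rel K (Rel.om_inv (r := r) (s := s) i)

lemma om'_inv (i : Fin (n - 1)) : om' n r s i * om'Inv n r s i = 1 := by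
  simpa [gen] using RingQuot.mkAlgHom_rel K (Rel.om'_inv (r := r) (s := s) i)

lemma om_e (i j : Fin (n - 1)) :
    om n r s i * e n r s j = (chi r s i j : K) • (e n r s j * om n r s i) := by
  simpa [gen] using RingQuot.mkAlgHom_rel K (Rel.om_e (r := r) (s := s) i j)

lemma om_f (i j : Fin (n - 1)) :
    om n r s i * f n r s j = ((chi r s i j)⁻¹ : Kˣ).val • (f n r s j * om n r s i) := by
  simpa [gen] using RingQuot.mkAlgHom_rel K (Rel.om_f (r := r) (s := s) i j)

lemma om'_e (i j : Fin (n - 1)) :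
    om' n r s i * e n r s j = (chi' r s i j : K) • (e n r s j * om' n r s i) := by
  simpa [gen] using RingQuot.mkAlgHom_rel K (Rel.om'_e (r := r) (s := s) i j)

lemma om'_f (i j : Fin (n - 1)) :
    om' n r s i * f n r s j = ((chi' r s i j)⁻¹ : Kˣ).val • (f n r s j * om' n r s i) := by
  simpa [gen] using RingQuot.mkAlgHom_rel K (Rel.om'_f (r := r) (s := s) i j)

lemma e_f_same (i : Fin (n - 1)) :
    e n r s i * f n r s i - f n r s i * e n r s i =
      ((r : K) - (s : K))⁻¹ • (om n r s i - om' n r s i) := by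
  simpa [gen] using RingQuot.mkAlgHom_rel K (Rel.e_f_same (r := r) (s := s) i)

lemma e_f_ne (i j : Fin (n - 1)) (h : i ≠ j) :
    e n r s i * f n r s j - f n r s j * e n r s i = 0 := by
  simpa [gen] using RingQuot.mkAlgHom_rel K (Rel.e_f_ne (r := r) (s := s) i j h)

lemma e_comm (i j : Fin (n - 1)) (h : (i : ℕ) + 1 < j) :
    e n r s i * e n r s j - e n r s j * e n r s i = 0 := by
  simpa [gen] using RingQuot.mkAlgHom_rel K (Rel.e_comm (r := r) (s := s) i j h)

lemma f_comm (i j : Fin (n - 1)) (h : (i : ℕ) + 1 < j) :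
    f n r s i * f n r s j - f n r s j * f n r s i = 0 := by
  simpa [gen] using RingQuot.mkAlgHom_rel K (Rel.f_comm (r := r) (s := s) i j h)

lemma e_serre₁ (i j : Fin (n - 1)) (h : (j : ℕ) = i + 1) :
    e n r s i ^ 2 * e n r s j - ((r : K) + s) • (e n r s i * e n r s j * e n r s i)
      + ((r : K) * s) • (e n r s j * e n r s i ^ 2) = 0 := by
  simpa only [gen, map_add, map_sub, map_smul, map_mul, map_pow, map_zero] using
    RingQuot.mkAlgHom_rel K (Rel.e_serre₁ (r := r) (s := s) i j h)

lemma e_serre₂ (i j : Fin (n - 1)) (h : (j : ℕ) = i + 1) :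
    e n r s i * e n r s j ^ 2 - ((r : K) + s) • (e n r s j * e n r s i * e n r s j)
      + ((r : K) * s) • (e n r s j ^ 2 * e n r s i) = 0 := by
  simpa only [gen, map_add, map_sub, map_smul, map_mul, map_pow, map_zero] using
    RingQuot.mkAlgHom_rel K (Rel.e_serre₂ (r := r) (s := s) i j h)

lemma f_serre₁ (i j : Fin (n - 1)) (h : (j : ℕ) = i + 1) :
    f n r s i ^ 2 * f n r s j - ((r : K)⁻¹ + (s : K)⁻¹) • (f n r s i * f n r s j * f n r s i)
      + ((r : K)⁻¹ * (s : K)⁻¹) • (f n r s j * f n r s i ^ 2) = 0 := by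
  simpa only [gen, map_add, map_sub, map_smul, map_mul, map_pow, map_zero] using
    RingQuot.mkAlgHom_rel K (Rel.f_serre₁ (r := r) (s := s) i j h)

lemma f_serre₂ (i j : Fin (n - 1)) (h : (j : ℕ) = i + 1) :
    f n r s i * f n r s j ^ 2 - ((r : K)⁻¹ + (s : K)⁻¹) • (f n r s j * f n r s i * f n r s j)
      + ((r : K)⁻¹ * (s : K)⁻¹) • (f n r s j ^ 2 * f n r s i) = 0 := by
  simpa only [gen, map_add, map_sub, map_smul, map_mul, map_pow, map_zero] using
    RingQuot.mkAlgHom_rel K (Rel.f_serre₂ (r := r) (s := s) i j h)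

/-- The Serre relation is inherited by `a + a'`, `b + b'` if the primed and the unprimed elements
`q`-commute in the right way. -/
lemma serre_add {A : Type*} [Ring A] [Algebra K A] {a a' b b' : A} {u v q y : K}
    (h1 : a' * a = q • (a * a')) (h2 : a' * b = v • (b * a')) (h3 : b' * a = y • (a * b'))
    (hu : u = q * v) (hy : u * y = 1)
    (hS : a ^ 2 * b - (u + v) • (a * b * a) + (u * v) • (b * a ^ 2) = 0)
    (hS' : a' ^ 2 * b' - (u + v) • (a' * b' * a') + (u * v) • (b' * a' ^ 2) = 0) :
    (a + a') ^ 2 * (b + b') - (u + v) • ((a + a') * (b + b') * (a + a'))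
      + (u * v) • ((b + b') * (a + a') ^ 2) = 0 := by
  have h1' (z : A) : a' * (a * z) = q • (a * (a' * z)) := by
    rw [← mul_assoc, h1, smul_mul_assoc, mul_assoc]
  have h2' (z : A) : a' * (b * z) = v • (b * (a' * z)) := by
    rw [← mul_assoc, h2, smul_mul_assoc, mul_assoc]
  have h3' (z : A) : b' * (a * z) = y • (a * (b' * z)) := by
    rw [← mul_assoc, h3, smul_mul_assoc, mul_assoc]
  have hsum := congrArg₂ (· + ·) hS hS'
  simp only [add_zero] at hsum
  rw [← hsum]
  subst hu
  simp only [pow_two, mul_add, add_mul, mul_assoc, h1, h2, h3, h1', h2', h3', mul_smul_comm, smul_mul_assoc,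
    smul_add, smul_smul]
  clear hS hS' hsum h1 h2 h3 h1' h2' h3'
  match_scalars <;> grind

/-- The two forms of the second Serre relation. -/
lemma serre_swap {A : Type*} [Ring A] [Algebra K A] {a b : A} {u v : K} (hu : u ≠ 0) (hv : v ≠ 0) :
    a * b ^ 2 - (u + v) • (b * a * b) + (u * v) • (b ^ 2 * a) = 0 ↔
      b ^ 2 * a - (v⁻¹ + u⁻¹) • (b * a * b) + (v⁻¹ * u⁻¹) • (a * b ^ 2) = 0 := by
  have key : a * b ^ 2 - (u + v) • (b * a * b) + (u * v) • (b ^ 2 * a) =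
      (u * v) • (b ^ 2 * a - (v⁻¹ + u⁻¹) • (b * a * b) + (v⁻¹ * u⁻¹) • (a * b ^ 2)) := by
    match_scalars <;> field_simp
  rw [key, smul_eq_zero_iff_right (mul_ne_zero hu hv)]

lemma serre_tmul {A B : Type*} [Ring A] [Algebra K A] [Ring B] [Algebra K B] {g h : A} {x y : B}
    {u v : K} (hgh : g * h = h * g)
    (hS : x ^ 2 * y - (u + v) • (x * y * x) + (u * v) • (y * x ^ 2) = 0) :
    (g ⊗ₜ[K] x) ^ 2 * (h ⊗ₜ y) - (u + v) • ((g ⊗ₜ[K] x) * (h ⊗ₜ y) * (g ⊗ₜ x))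
      + (u * v) • ((h ⊗ₜ[K] y) * (g ⊗ₜ x) ^ 2) = 0 := by
  have h1 : g * h * g = g ^ 2 * h := by rw [mul_assoc, ← hgh, pow_two, mul_assoc]
  have h2 : h * g ^ 2 = g ^ 2 * h := by
    rw [pow_two, ← mul_assoc, ← hgh, mul_assoc, ← hgh, mul_assoc]
  simp only [Algebra.TensorProduct.tmul_pow, Algebra.TensorProduct.tmul_mul_tmul, h1, h2,
    ← TensorProduct.tmul_smul, ← TensorProduct.tmul_sub, ← TensorProduct.tmul_add, hS,
    TensorProduct.tmul_zero]

lemma serre_tmul' {A B : Type*} [Ring A] [Algebra K A] [Ring B] [Algebra K B] {g h : A} {x y : B}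
    {u v : K} (hgh : g * h = h * g)
    (hS : x ^ 2 * y - (u + v) • (x * y * x) + (u * v) • (y * x ^ 2) = 0) :
    (x ⊗ₜ[K] g) ^ 2 * (y ⊗ₜ h) - (u + v) • ((x ⊗ₜ[K] g) * (y ⊗ₜ h) * (x ⊗ₜ g))
      + (u * v) • ((y ⊗ₜ[K] h) * (x ⊗ₜ g) ^ 2) = 0 := by
  have h1 : g * h * g = g ^ 2 * h := by rw [mul_assoc, ← hgh, pow_two, mul_assoc]
  have h2 : h * g ^ 2 = g ^ 2 * h := by
    rw [pow_two, ← mul_assoc, ← hgh, mul_assoc, ← hgh, mul_assoc]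
  simp only [Algebra.TensorProduct.tmul_pow, Algebra.TensorProduct.tmul_mul_tmul, h1, h2,
    TensorProduct.smul_tmul', ← TensorProduct.sub_tmul, ← TensorProduct.add_tmul, hS,
    TensorProduct.zero_tmul]

lemma chi'_eq (i j : ℕ) : chi' r s i j = (chi r s j i)⁻¹ := by
  have h1 : epsAlpha (i + 1) j = -epsAlpha j i := by
    simp only [epsAlpha]; grind
  have h2 : epsAlpha i j = -epsAlpha (j + 1) i := by
    simp only [epsAlpha]; grind
  rw [chi', chi, h1, h2, zpow_neg, zpow_neg, mul_inv]

lemma chi_self (i : ℕ) : chi r s i i = r * s⁻¹ := by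
  simp [chi, epsAlpha]

lemma chi_succ (i : ℕ) : chi r s i (i + 1) = s := by
  simp [chi, epsAlpha]
  omega

lemma chi_succ' (i : ℕ) : chi r s (i + 1) i = r⁻¹ := by
  simp [chi, epsAlpha]
  omega

lemma chi_far (i j : ℕ) (h : i + 1 < j ∨ j + 1 < i) : chi r s i j = 1 := by
  have h1 : epsAlpha i j = 0 := by simp only [epsAlpha]; grind
  have h2 : epsAlpha (i + 1) j = 0 := by simp only [epsAlpha]; grind
  simp [chi, h1, h2]

/-- The value of the coproduct on generators. -/
def comulGen : Gen n → U n r s ⊗[K] U n r s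
  | .e i => e n r s i ⊗ₜ 1 + om n r s i ⊗ₜ e n r s i
  | .f i => 1 ⊗ₜ f n r s i + f n r s i ⊗ₜ om' n r s i
  | .om i => om n r s i ⊗ₜ om n r s i
  | .omInv i => omInv n r s i ⊗ₜ omInv n r s i
  | .om' i => om' n r s i ⊗ₜ om' n r s i
  | .om'Inv i => om'Inv n r s i ⊗ₜ om'Inv n r s i

lemma comulGen_toral (g : Gen n) (hg : g.IsToral) :
    comulGen (r := r) (s := s) g = gen n r s g ⊗ₜ gen n r s g := by
  cases g <;> first | rfl | exact hg.elim

/-- The value of the counit on generators. -/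
def counitGen : Gen n → K
  | .e _ => 0
  | .f _ => 0
  | _ => 1

lemma counitGen_toral (g : Gen n) (hg : g.IsToral) : counitGen (K := K) g = 1 := by
  cases g <;> first | rfl | exact hg.elim

end Identities

/-- The counit respects the defining relations. -/
lemma counit_rel ⦃x y : FreeAlgebra K (Gen n)⦄ (h : Rel r s x y) :
    FreeAlgebra.lift K (counitGen (K := K)) x = FreeAlgebra.lift K counitGen y := by
  cases h with
  | toral_comm g h hg hh => simp [mul_comm]
  | _ => simp [counitGen]

/-- The counit `ε` of `U_{r,s}(sl_n)`. -/
def counit : U n r s →ₐ[K] K :=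
  RingQuot.liftAlgHom K ⟨FreeAlgebra.lift K counitGen, counit_rel n r s⟩

/-- The coproduct respects the defining relations. -/
lemma comul_rel ⦃x y : FreeAlgebra K (Gen n)⦄ (h : Rel r s x y) :
    FreeAlgebra.lift K (comulGen (r := r) (s := s)) x = FreeAlgebra.lift K comulGen y := by
  have tc (i j) := toral_comm (r := r) (s := s) (n := n) (.om i) (.om j) trivial trivial
  have tc' (i j) := toral_comm (r := r) (s := s) (n := n) (.om' i) (.om' j) trivial trivial
  have tcc (i j) := toral_comm (r := r) (s := s) (n := n) (.om i) (.om' j) trivial trivial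
  have hr : (r : K) ≠ 0 := r.ne_zero
  have hs : (s : K) ≠ 0 := s.ne_zero
  cases h with
  | toral_comm g h hg hh =>
    simp [comulGen_toral, hg, hh, toral_comm g h hg hh]
  | om_inv i =>
    simp [comulGen, om_inv, Algebra.TensorProduct.one_def]
  | om'_inv i =>
    simp [comulGen, om'_inv, Algebra.TensorProduct.one_def]
  | om_e i j =>
    simp [comulGen, mul_add, add_mul, om_e, tc, TensorProduct.smul_tmul']
  | om_f i j =>
    simp [comulGen, mul_add, add_mul, om_f, tcc, TensorProduct.smul_tmul']
  | om'_e i j =>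
    simp [comulGen, mul_add, add_mul, om'_e, tcc, TensorProduct.smul_tmul']
  | om'_f i j =>
    simp [comulGen, mul_add, add_mul, om'_f, tc', TensorProduct.smul_tmul']
  | e_f_same i =>
    have h := e_f_same (r := r) (s := s) i
    rw [sub_eq_iff_eq_add] at h
    simp [comulGen, mul_add, add_mul, h, om_f, om'_e, chi'_eq, TensorProduct.smul_tmul',
      TensorProduct.tmul_add, TensorProduct.add_tmul, TensorProduct.tmul_sub, smul_sub]
    simp only [TensorProduct.sub_tmul]
    abel
  | e_f_ne i j hij =>
    have h := e_f_ne (r := r) (s := s) i j hij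
    rw [sub_eq_zero] at h
    simp [comulGen, mul_add, add_mul, h, om_f, om'_e, chi'_eq, TensorProduct.smul_tmul']
    abel
  | e_comm i j hij =>
    have h := e_comm (r := r) (s := s) i j hij
    rw [sub_eq_zero] at h
    simp [comulGen, mul_add, add_mul, h, om_e, tc i j, chi_far i j (.inl hij),
      chi_far j i (.inr hij)]
    abel
  | f_comm i j hij =>
    have h := f_comm (r := r) (s := s) i j hij
    rw [sub_eq_zero] at h
    simp [comulGen, mul_add, add_mul, h, om'_f, tc' i j, chi'_eq, chi_far i j (.inl hij),
      chi_far j i (.inr hij)]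
    abel
  | e_serre₁ i j hij =>
    simp only [map_add, map_sub, map_smul, map_mul, map_pow, map_zero, FreeAlgebra.lift_ι_apply,
      comulGen]
    refine serre_add (q := r * (s : K)⁻¹) (y := (r : K)⁻¹) ?_ ?_ ?_ ?_ ?_
      (serre_tmul' rfl (e_serre₁ i j hij)) (serre_tmul (tc i j) (e_serre₁ i j hij))
    · simp [om_e, chi_self, TensorProduct.smul_tmul']
    · simp [om_e, hij, chi_succ, TensorProduct.smul_tmul']
    · simp [om_e, hij, chi_succ', TensorProduct.smul_tmul']
    · field_simp
    · field_simp
  | e_serre₂ i j hij =>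
    simp only [map_add, map_sub, map_smul, map_mul, map_pow, map_zero, FreeAlgebra.lift_ι_apply,
      comulGen]
    have h := (serre_swap hr hs).1 (e_serre₂ (r := r) (s := s) i j hij)
    refine (serre_swap hr hs).2 (serre_add (q := r * (s : K)⁻¹) (y := (s : K)) ?_ ?_ ?_ ?_ ?_
      (serre_tmul' rfl h) (serre_tmul (tc j i) h))
    · simp [om_e, chi_self, TensorProduct.smul_tmul']
    · simp [om_e, hij, chi_succ', TensorProduct.smul_tmul']
    · simp [om_e, hij, chi_succ, TensorProduct.smul_tmul']
    · field_simp
    · field_simp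
  | f_serre₁ i j hij =>
    simp only [map_add, map_sub, map_smul, map_mul, map_pow, map_zero, FreeAlgebra.lift_ι_apply,
      comulGen]
    have h := f_serre₁ (r := r) (s := s) i j hij
    rw [add_comm (r : K)⁻¹, mul_comm (r : K)⁻¹] at h ⊢
    refine serre_add (q := r * (s : K)⁻¹) (y := (s : K)) ?_ ?_ ?_ ?_ ?_
      (serre_tmul rfl h) (serre_tmul' (tc' i j) h)
    · simp [om'_f, chi'_eq, chi_self, TensorProduct.smul_tmul']
    · simp [om'_f, chi'_eq, hij, chi_succ', TensorProduct.smul_tmul']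
    · simp [om'_f, chi'_eq, hij, chi_succ, TensorProduct.smul_tmul']
    · field_simp
    · field_simp
  | f_serre₂ i j hij =>
    simp only [map_add, map_sub, map_smul, map_mul, map_pow, map_zero, FreeAlgebra.lift_ι_apply,
      comulGen]
    have h := f_serre₂ (r := r) (s := s) i j hij
    rw [add_comm (r : K)⁻¹, mul_comm (r : K)⁻¹] at h ⊢
    have h' := (serre_swap (inv_ne_zero hs) (inv_ne_zero hr)).1 h
    refine (serre_swap (A := U n r s ⊗[K] U n r s) (inv_ne_zero hs) (inv_ne_zero hr)).2 ?_
    rw [inv_inv, inv_inv] at h' ⊢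
    refine serre_add (q := r * (s : K)⁻¹) (y := (r : K)⁻¹) ?_ ?_ ?_ ?_ ?_
      (serre_tmul rfl h') (serre_tmul' (tc' j i) h')
    · simp [om'_f, chi'_eq, chi_self, TensorProduct.smul_tmul']
    · simp [om'_f, chi'_eq, hij, chi_succ, TensorProduct.smul_tmul']
    · simp [om'_f, chi'_eq, hij, chi_succ', TensorProduct.smul_tmul']
    · field_simp
    · field_simp

/-- The coproduct `Δ` of `U_{r,s}(sl_n)`: the `ω_i^{±1}`, `(ω_i')^{±1}` are group-like,
`Δ(e_i) = e_i ⊗ 1 + ω_i ⊗ e_i` and `Δ(f_i) = 1 ⊗ f_i + f_i ⊗ ω_i'`. -/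
def comul : U n r s →ₐ[K] U n r s ⊗[K] U n r s :=
  RingQuot.liftAlgHom K ⟨FreeAlgebra.lift K comulGen, comul_rel n r s⟩

lemma comul_gen (g : Gen n) : comul n r s (gen n r s g) = comulGen g := by
  simp [comul, gen]

lemma counit_gen (g : Gen n) : counit n r s (gen n r s g) = counitGen g := by
  simp [counit, gen]

/-- The subalgebra `U^{≥0}`, generated by the `e_i` and `ω_i^{±1}`. -/
def Uge : Subalgebra K (U n r s) :=
  Algebra.adjoin K (Set.range (e n r s) ∪ Set.range (om n r s) ∪ Set.range (omInv n r s))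

/-- The subalgebra `U^{≤0}`, generated by the `f_i` and `(ω_i')^{±1}`. -/
def Ule : Subalgebra K (U n r s) :=
  Algebra.adjoin K (Set.range (f n r s) ∪ Set.range (om' n r s) ∪ Set.range (om'Inv n r s))

lemma e_mem (i : Fin (n - 1)) : e n r s i ∈ Uge n r s :=
  Algebra.subset_adjoin (.inl (.inl ⟨i, rfl⟩))

lemma om_mem (i : Fin (n - 1)) : om n r s i ∈ Uge n r s :=
  Algebra.subset_adjoin (.inl (.inr ⟨i, rfl⟩))

lemma omInv_mem (i : Fin (n - 1)) : omInv n r s i ∈ Uge n r s :=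
  Algebra.subset_adjoin (.inr ⟨i, rfl⟩)

lemma f_mem (i : Fin (n - 1)) : f n r s i ∈ Ule n r s :=
  Algebra.subset_adjoin (.inl (.inl ⟨i, rfl⟩))

lemma om'_mem (i : Fin (n - 1)) : om' n r s i ∈ Ule n r s :=
  Algebra.subset_adjoin (.inl (.inr ⟨i, rfl⟩))

lemma om'Inv_mem (i : Fin (n - 1)) : om'Inv n r s i ∈ Ule n r s :=
  Algebra.subset_adjoin (.inr ⟨i, rfl⟩)

section Restrict

variable {A : Type*} [Ring A] [Algebra K A]

/-- The inclusion `B ⊗ B → A ⊗ A` for a subalgebra `B` of `A`. -/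
def incl₂ (B : Subalgebra K A) : B ⊗[K] B →ₐ[K] A ⊗[K] A :=
  Algebra.TensorProduct.map B.val B.val

lemma incl₂_injective (B : Subalgebra K A) : Function.Injective (incl₂ B) :=
  TensorProduct.map_injective_of_flat_flat B.val.toLinearMap B.val.toLinearMap
    Subtype.val_injective Subtype.val_injective

lemma tmul_mem_incl₂ {B : Subalgebra K A} {x y : A} (hx : x ∈ B) (hy : y ∈ B) :
    x ⊗ₜ[K] y ∈ (incl₂ B).range :=
  ⟨(⟨x, hx⟩ : B) ⊗ₜ (⟨y, hy⟩ : B), by simp [incl₂]⟩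

/-- The restriction of a map `D : A → A ⊗ A` to a subalgebra `B` with `D(B) ⊆ B ⊗ B`. -/
def comulRestrict (D : A →ₐ[K] A ⊗[K] A) (B : Subalgebra K A)
    (h : ∀ x ∈ B, D x ∈ (incl₂ B).range) : B →ₐ[K] B ⊗[K] B :=
  ((AlgEquiv.ofInjective (incl₂ B) (incl₂_injective B)).symm : _ →ₐ[K] _).comp
    ((D.comp B.val).codRestrict (incl₂ B).range fun x => h x x.2)

lemma incl₂_comulRestrict (D : A →ₐ[K] A ⊗[K] A) (B : Subalgebra K A)
    (h : ∀ x ∈ B, D x ∈ (incl₂ B).range) (x : B) :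
    incl₂ B (comulRestrict D B h x) = D x :=
  congrArg Subtype.val ((AlgEquiv.ofInjective (incl₂ B) (incl₂_injective B)).apply_symm_apply
    ((D.comp B.val).codRestrict (incl₂ B).range (fun x => h x x.2) x))

end Restrict

lemma comul_mem_Uge (x : U n r s) (hx : x ∈ Uge n r s) :
    comul n r s x ∈ (incl₂ (Uge n r s)).range := by
  have : Uge n r s ≤ (incl₂ (Uge n r s)).range.comap (comul n r s) := by
    refine Algebra.adjoin_le ?_
    rintro _ ((⟨i, rfl⟩ | ⟨i, rfl⟩) | ⟨i, rfl⟩) <;>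
      simp only [SetLike.mem_coe, Subalgebra.mem_comap, comul_gen, comulGen]
    · exact add_mem (tmul_mem_incl₂ (e_mem n r s i) (one_mem _))
        (tmul_mem_incl₂ (om_mem n r s i) (e_mem n r s i))
    · exact tmul_mem_incl₂ (om_mem n r s i) (om_mem n r s i)
    · exact tmul_mem_incl₂ (omInv_mem n r s i) (omInv_mem n r s i)
  exact this hx

lemma comul_mem_Ule (x : U n r s) (hx : x ∈ Ule n r s) :
    comul n r s x ∈ (incl₂ (Ule n r s)).range := by
  have : Ule n r s ≤ (incl₂ (Ule n r s)).range.comap (comul n r s) := by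
    refine Algebra.adjoin_le ?_
    rintro _ ((⟨i, rfl⟩ | ⟨i, rfl⟩) | ⟨i, rfl⟩) <;>
      simp only [SetLike.mem_coe, Subalgebra.mem_comap, comul_gen, comulGen]
    · exact add_mem (tmul_mem_incl₂ (one_mem _) (f_mem n r s i))
        (tmul_mem_incl₂ (f_mem n r s i) (om'_mem n r s i))
    · exact tmul_mem_incl₂ (om'_mem n r s i) (om'_mem n r s i)
    · exact tmul_mem_incl₂ (om'Inv_mem n r s i) (om'Inv_mem n r s i)
  exact this hx

/-- The coproduct `Δ` of `U^{≥0}`. -/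
def comulGe : Uge n r s →ₐ[K] Uge n r s ⊗[K] Uge n r s :=
  comulRestrict (comul n r s) (Uge n r s) (comul_mem_Uge n r s)

/-- The coproduct `Δ` of `U^{≤0}` (not yet the opposite one). -/
def comulLe : Ule n r s →ₐ[K] Ule n r s ⊗[K] Ule n r s :=
  comulRestrict (comul n r s) (Ule n r s) (comul_mem_Ule n r s)

/-- `p` is the Hopf pairing `( | ) : U^{≤0} × U^{≥0} → K`, where `U^{≤0}` carries the opposite
coproduct: it has the prescribed values on generators and obeys the three multiplication
rules. -/
structure IsHopfPairing (p : Ule n r s →ₗ[K] Uge n r s →ₗ[K] K) : Prop where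
  /-- `(f_i | e_j) = δ_{ij} / (s - r)` -/
  f_e (i j : Fin (n - 1)) :
    p ⟨f n r s i, f_mem n r s i⟩ ⟨e n r s j, e_mem n r s j⟩ =
      if i = j then ((s : K) - r)⁻¹ else 0
  /-- `(ω_i' | ω_j) = r ^ ⟨ε_j, α_i⟩ * s ^ ⟨ε_{j+1}, α_i⟩` -/
  om'_om (i j : Fin (n - 1)) :
    p ⟨om' n r s i, om'_mem n r s i⟩ ⟨om n r s j, om_mem n r s j⟩ =
      (r : K) ^ epsAlpha j i * (s : K) ^ epsAlpha (j + 1) i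
  f_om (i j : Fin (n - 1)) :
    p ⟨f n r s i, f_mem n r s i⟩ ⟨om n r s j, om_mem n r s j⟩ = 0
  om'_e (i j : Fin (n - 1)) :
    p ⟨om' n r s i, om'_mem n r s i⟩ ⟨e n r s j, e_mem n r s j⟩ = 0
  one_left (b : Uge n r s) : p 1 b = counit n r s b
  one_right (b' : Ule n r s) : p b' 1 = counit n r s b'
  /-- `(b' | b c) = ∑ (b'_(2) | b) (b'_(1) | c)` -/
  mul_right (b' : Ule n r s) (b c : Uge n r s) :
    p b' (b * c) =
      LinearMap.mul' K K (TensorProduct.map (p.flip c) (p.flip b) (comulLe n r s b'))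
  /-- `(b' c' | b) = ∑ (b' | b_(1)) (c' | b_(2))` -/
  mul_left (b' c' : Ule n r s) (b : Uge n r s) :
    p (b' * c') b = LinearMap.mul' K K (TensorProduct.map (p b') (p c') (comulGe n r s b))

/-- The root vector `𝓔_{j+k,j}`: `𝓔_{j,j} = e_j` and
`𝓔_{i,j} = e_i 𝓔_{i-1,j} - r⁻¹ 𝓔_{i-1,j} e_i` for `i > j`. -/
def rootE (j : ℕ) : (k : ℕ) → j + k < n - 1 → U n r s
  | 0, h => e n r s ⟨j, h⟩
  | k + 1, h => e n r s ⟨j + (k + 1), h⟩ * rootE j k (by omega)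
      - (r : K)⁻¹ • (rootE j k (by omega) * e n r s ⟨j + (k + 1), h⟩)

/-- The root vector `𝓕_{j+k,j}`: `𝓕_{j,j} = f_j` and
`𝓕_{i,j} = f_i 𝓕_{i-1,j} - s 𝓕_{i-1,j} f_i` for `i > j`. -/
def rootF (j : ℕ) : (k : ℕ) → j + k < n - 1 → U n r s
  | 0, h => f n r s ⟨j, h⟩
  | k + 1, h => f n r s ⟨j + (k + 1), h⟩ * rootF j k (by omega)
      - (s : K) • (rootF j k (by omega) * f n r s ⟨j + (k + 1), h⟩)

/-- The two-sided ideal `I_n` of `U_{r,s}(sl_n)`, generated by all `𝓔_{i,j}^ℓ`, `𝓕_{i,j}^ℓ`,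
`ω_i^ℓ - 1` and `(ω_i')^ℓ - 1`. -/
def idealI (l : ℕ) : TwoSidedIdeal (U n r s) :=
  TwoSidedIdeal.span
    ({x | ∃ (j k : ℕ) (h : j + k < n - 1), x = rootE n r s j k h ^ l} ∪
      {x | ∃ (j k : ℕ) (h : j + k < n - 1), x = rootF n r s j k h ^ l} ∪
      {x | ∃ i : Fin (n - 1), x = om n r s i ^ l - 1} ∪
      {x | ∃ i : Fin (n - 1), x = om' n r s i ^ l - 1})

/-- The restricted quantum group `u_{r,s}(sl_n) = U_{r,s}(sl_n) / I_n`, as an algebra. -/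
abbrev SmallU (l : ℕ) : Type _ := (idealI n r s l).ringCon.Quotient

/-- The quotient map `U_{r,s}(sl_n) → u_{r,s}(sl_n)`. -/
def toSmall (l : ℕ) : U n r s →ₐ[K] SmallU n r s l :=
  { (idealI n r s l).ringCon.mk' with commutes' := fun _ => rfl }

/-- The image in `u_{r,s}(sl_n)` of `U^{≥0}`. -/
def smallGe (l : ℕ) : Subalgebra K (SmallU n r s l) := (Uge n r s).map (toSmall n r s l)

/-- The image in `u_{r,s}(sl_n)` of `U^{≤0}`. -/
def smallLe (l : ℕ) : Subalgebra K (SmallU n r s l) := (Ule n r s).map (toSmall n r s l)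

/-- The quotient map from `U^{≥0}` onto its image in `u_{r,s}(sl_n)`. -/
def toSmallGe (l : ℕ) : Uge n r s →ₐ[K] smallGe n r s l :=
  (toSmall n r s l).subalgebraMap (Uge n r s)

/-- The quotient map from `U^{≤0}` onto its image in `u_{r,s}(sl_n)`. -/
def toSmallLe (l : ℕ) : Ule n r s →ₐ[K] smallLe n r s l :=
  (toSmall n r s l).subalgebraMap (Ule n r s)

end TwoParam

end

/-!
Let `m` be the order of `r s⁻¹`; it is at least `2` and divides `ℓ`.

*The radical.* By the multiplication rules of a Hopf pairing, the functionals `(y | -)` on `U^{≥0}`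
are convolution products of those of the generators of `U^{≤0}`. The latter are matrix coefficients:
`(ω_i' | -)` is a character of `U` (`pairing_om'`), and `(f_i | -)` is an off-diagonal entry of a
twisted vector representation of `U` (`fFun`, `pairing_f`). Likewise on the other side. In
particular a Hopf pairing is unique. Now let `Bar` be the quotient of `U` in which the `m`-th powers
of all root vectors vanish, the `ℓ`-th powers of the `ω_i`, `ω_i'` are trivial, and
`e_{i+1}` commutes with `𝓔_{i+2,i}`, `f_{i+1}` with `𝓕_{i+2,i}`. The representations in question
factor through `Bar`, and so does the coproduct (`exists_comulBar`). Hence every functional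
`(y | -)` and `(- | x)` factors through `Bar` (`exists_pairing_left`, `exists_pairing_right`), and
`I_n` maps to zero in `Bar` because `m` divides `ℓ` (`toBar_eq_zero`).

That the coproduct descends to `Bar` rests on the formula `IsDouble.root_add` for the coproduct of
a root vector: its summands commute with each other up to the factor `r s⁻¹`, a primitive `m`-th
root of unity, so by the `q`-binomial theorem the `m`-th power of the sum is the sum of the `m`-th
powers, which vanish (`IsDouble.root_add_pow`).

*Existence.* The functionals of the generators of `U^{≤0}` define a map from a free algebra to the
convolution algebra of functionals on `U^{≥0}`. It is compatible with products on both sides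
(`freePairing_comp_mul`), so evaluation at `x ∈ U^{≥0}` is a combination of products of evaluations
at the generators of `U^{≥0}`. These are functionals on `U^{≤0}` by direct computation, the one of
`e_j` being again a matrix coefficient (`eFun`). Therefore the map factors through `U^{≤0}`
(`exists_freePairing_right`), and neither a presentation nor a PBW basis of `U^{≤0}` is needed.
-/

open scoped TensorProduct

noncomputable section

namespace TwoParam

section Commutation

variable {K : Type*} [Field K] {R : Type*} [Ring R] [Algebra K R]

/-! ### Elements commuting up to a scalar, and the `q`-binomial theorem -/

/-- `u` and `v` commute up to the scalar `c`: `u v = c v u`. -/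
def QComm (c : K) (u v : R) : Prop := u * v = c • (v * u)

namespace QComm

variable {c d : K} {u v w : R}

lemma of_commute (h : u * v = v * u) : QComm (1 : K) u v := by
  rw [QComm, one_smul, h]

lemma eq_of_one (h : QComm (1 : K) u v) : u * v = v * u := by
  rw [h, one_smul]

lemma congr (h : QComm c u v) (hcd : c = d) : QComm d u v := hcd ▸ h

lemma symm (h : QComm c u v) (hc : c ≠ 0) : QComm c⁻¹ v u := by
  rw [QComm, h, smul_smul, inv_mul_cancel₀ hc, one_smul]

lemma mul_right (h : QComm c u v) (h' : QComm d u w) : QComm (c * d) u (v * w) := by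
  rw [QComm, ← mul_assoc, h, smul_mul_assoc, mul_assoc, h', mul_smul_comm, smul_smul, mul_assoc]

lemma mul_left (h : QComm c u w) (h' : QComm d v w) : QComm (c * d) (u * v) w := by
  rw [QComm, mul_assoc, h', mul_smul_comm, ← mul_assoc, h, smul_mul_assoc, smul_smul, mul_assoc,
    mul_comm d]

lemma sub_right (h : QComm c u v) (h' : QComm c u w) : QComm c u (v - w) := by
  rw [QComm, mul_sub, h, h', sub_mul, smul_sub]

lemma sub_left (h : QComm c u w) (h' : QComm c v w) : QComm c (u - v) w := by
  rw [QComm, sub_mul, h, h', mul_sub, smul_sub]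

lemma add_right (h : QComm c u v) (h' : QComm c u w) : QComm c u (v + w) := by
  rw [QComm, mul_add, h, h', add_mul, smul_add]

lemma add_left (h : QComm c u w) (h' : QComm c v w) : QComm c (u + v) w := by
  rw [QComm, add_mul, h, h', mul_add, smul_add]

lemma smul_right (h : QComm c u v) (a : K) : QComm c u (a • v) := by
  rw [QComm, mul_smul_comm, h, smul_mul_assoc, smul_comm]

lemma smul_left (h : QComm c u v) (a : K) : QComm c (a • u) v := by
  rw [QComm, smul_mul_assoc, h, mul_smul_comm, smul_comm]

/-- A `q`-commutator of elements that commute with `u` up to scalars does so as well. -/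
lemma bracket_right (h : QComm c u v) (h' : QComm d u w) (a : K) :
    QComm (c * d) u (v * w - a • (w * v)) :=
  (h.mul_right h').sub_right (((h'.mul_right h).congr (mul_comm d c)).smul_right a)

lemma bracket_left (h : QComm c v u) (h' : QComm d w u) (a : K) :
    QComm (c * d) (v * w - a • (w * v)) u :=
  (h.mul_left h').sub_left (((h'.mul_left h).congr (mul_comm d c)).smul_left a)

/-- If `u v = c v u`, then `(u v)^k` is a multiple of `v^k u^k`. -/
lemma mul_pow (h : QComm c u v) (k : ℕ) : ∃ a : K, (u * v) ^ k = a • (v ^ k * u ^ k) := by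
  have hp (k : ℕ) : QComm (c ^ k) u (v ^ k) := by
    induction k with
    | zero => simp [QComm]
    | succ k ih => simpa [pow_succ] using ih.mul_right h
  induction k with
  | zero => exact ⟨1, by simp⟩
  | succ k ih =>
    obtain ⟨a, ha⟩ := ih
    refine ⟨c * (c ^ k * a), ?_⟩
    rw [pow_succ', ha, h, mul_smul_comm, smul_mul_assoc, ← mul_assoc, mul_assoc v, hp k,
      mul_smul_comm, smul_mul_assoc, smul_smul, smul_smul, pow_succ' v, pow_succ' u]
    simp only [mul_assoc]
    congr 1
    ring

lemma mul_pow_eq_zero (h : QComm c u v) {k : ℕ} (hv : v ^ k = 0 ∨ u ^ k = 0) :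
    (u * v) ^ k = 0 := by
  obtain ⟨a, ha⟩ := h.mul_pow k
  rcases hv with hv | hv <;> simp [ha, hv]

end QComm

/-- The Gaussian binomial coefficients, defined by the Pascal recursion. -/
def gaussBinom (q : K) : ℕ → ℕ → K
  | _, 0 => 1
  | 0, _ + 1 => 0
  | n + 1, k + 1 => gaussBinom q n k + q ^ (k + 1) * gaussBinom q n (k + 1)

lemma gaussBinom_of_lt (q : K) {n k : ℕ} (h : n < k) : gaussBinom q n k = 0 := by
  induction n generalizing k with
  | zero => obtain ⟨k, rfl⟩ := Nat.exists_eq_succ_of_ne_zero (by omega : k ≠ 0); rfl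
  | succ n ih =>
    obtain ⟨k, rfl⟩ := Nat.exists_eq_succ_of_ne_zero (by omega : k ≠ 0)
    simp [gaussBinom, ih (show n < k by omega), ih (show n < k + 1 by omega)]

lemma gaussBinom_self (q : K) (n : ℕ) : gaussBinom q n n = 1 := by
  induction n with
  | zero => rfl
  | succ n ih => simp [gaussBinom, ih, gaussBinom_of_lt]

lemma gaussBinom_absorb (q : K) (n k : ℕ) :
    (1 - q ^ (k + 1)) * gaussBinom q (n + 1) (k + 1) = (1 - q ^ (n + 1)) * gaussBinom q n k := by
  induction n generalizing k with
  | zero =>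
    cases k with
    | zero => simp [gaussBinom]
    | succ k => simp [gaussBinom]
  | succ n ih =>
    cases k with
    | zero =>
      have := ih 0
      simp only [gaussBinom] at this ⊢
      linear_combination q * this
    | succ k =>
      have h1 := ih k
      have h2 := ih (k + 1)
      rw [gaussBinom, mul_add]
      have h3 : gaussBinom q (n + 1) (k + 1) =
        gaussBinom q n k + q ^ (k + 1) * gaussBinom q n (k + 1) := rfl
      linear_combination q * h1 + q ^ (k + 2) * h2 + q * (q ^ (n + 1) - 1) * h3

lemma gaussBinom_eq_zero {q : K} {m k : ℕ} (hq : IsPrimitiveRoot q m) (hk : 0 < k) (hkm : k < m) :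
    gaussBinom q m k = 0 := by
  obtain ⟨k, rfl⟩ := Nat.exists_eq_succ_of_ne_zero hk.ne'
  obtain ⟨m, rfl⟩ := Nat.exists_eq_succ_of_ne_zero (by omega : m ≠ 0)
  have h := gaussBinom_absorb q m k
  rw [hq.pow_eq_one, sub_self, zero_mul, mul_eq_zero] at h
  exact h.resolve_left (sub_ne_zero.2 (hq.pow_ne_one_of_pos_of_lt k.succ_ne_zero hkm).symm)

namespace QComm

variable {q : K} {u v : R}

lemma pow_left (h : QComm q u v) (k : ℕ) : QComm (q ^ k) (u ^ k) v := by
  induction k with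
  | zero => simp [QComm]
  | succ k ih => rw [pow_succ, pow_succ]; exact ih.mul_left h

/-- The `q`-binomial theorem. -/
lemma add_pow (h : QComm q u v) (n : ℕ) :
    (v + u) ^ n = ∑ k ∈ Finset.range (n + 1), gaussBinom q n k • (v ^ (n - k) * u ^ k) := by
  induction n with
  | zero => simp [gaussBinom]
  | succ n ih =>
    have hu (k : ℕ) : u ^ k * v = q ^ k • (v * u ^ k) := h.pow_left k
    have h1 : (∑ k ∈ Finset.range (n + 1), gaussBinom q n k • (v ^ (n - k) * u ^ k)) * v =
        ∑ k ∈ Finset.range (n + 2), (q ^ k * gaussBinom q n k) • (v ^ (n + 1 - k) * u ^ k) := by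
      rw [Finset.sum_range_succ _ (n + 1), gaussBinom_of_lt q n.lt_succ_self, mul_zero, zero_smul,
        add_zero, Finset.sum_mul]
      refine Finset.sum_congr rfl fun k hk => ?_
      rw [Finset.mem_range] at hk
      rw [smul_mul_assoc, mul_assoc, hu, mul_smul_comm, smul_smul, ← mul_assoc, ← pow_succ,
        mul_comm (q ^ k), show n - k + 1 = n + 1 - k by omega]
    have h2 : (∑ k ∈ Finset.range (n + 1), gaussBinom q n k • (v ^ (n - k) * u ^ k)) * u =
        ∑ k ∈ Finset.range (n + 1), gaussBinom q n k • (v ^ (n - k) * u ^ (k + 1)) := by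
      simp only [Finset.sum_mul, smul_mul_assoc, mul_assoc, pow_succ]
    rw [pow_succ, ih, mul_add, h1, h2, Finset.sum_range_succ', Finset.sum_range_succ' _ (n + 1),
      add_right_comm, ← Finset.sum_add_distrib]
    congr 1
    · refine Finset.sum_congr rfl fun k _ => ?_
      rw [gaussBinom, Nat.add_sub_add_right, ← add_smul, add_comm]
    · cases n <;> simp [gaussBinom]

/-- If `q` is a primitive `m`-th root of unity, all inner `q`-binomial coefficients vanish. -/
lemma add_pow_primitive {m : ℕ} (h : QComm q u v) (hq : IsPrimitiveRoot q m) (hm : 0 < m) :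
    (v + u) ^ m = v ^ m + u ^ m := by
  obtain ⟨m, rfl⟩ := Nat.exists_eq_succ_of_ne_zero hm.ne'
  rw [h.add_pow, Finset.sum_range_succ, Finset.sum_range_succ', Finset.sum_eq_zero]
  · simp [gaussBinom, gaussBinom_self, gaussBinom_of_lt]
  · intro k hk
    rw [Finset.mem_range] at hk
    rw [gaussBinom_eq_zero hq k.succ_pos (by omega), zero_smul]

end QComm

lemma QComm.sum_right {ι : Type*} {c : K} {u : R} {S : Finset ι} {v : ι → R}
    (h : ∀ i ∈ S, QComm c u (v i)) : QComm c u (∑ i ∈ S, v i) := by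
  rw [QComm, Finset.mul_sum, Finset.sum_mul, Finset.smul_sum]
  exact Finset.sum_congr rfl h

lemma QComm.sum_left {ι : Type*} {c : K} {u : R} {S : Finset ι} {v : ι → R}
    (h : ∀ i ∈ S, QComm c (v i) u) : QComm c (∑ i ∈ S, v i) u := by
  rw [QComm, Finset.mul_sum, Finset.sum_mul, Finset.smul_sum]
  exact Finset.sum_congr rfl h

/-- If `q` is a primitive `m`-th root of unity, then a sum of `q`-commuting elements with vanishing
`m`-th powers has vanishing `m`-th power. -/
lemma sum_pow_eq_zero {q : K} {m : ℕ} (hq : IsPrimitiveRoot q m) (hm : 0 < m) {w : ℕ → R} {N : ℕ}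
    (hw : ∀ i j, i < j → j < N → QComm q (w j) (w i)) (h0 : ∀ i < N, w i ^ m = 0) :
    (∑ i ∈ Finset.range N, w i) ^ m = 0 := by
  induction N with
  | zero => simp [hm.ne']
  | succ N ih =>
    rw [Finset.sum_range_succ, QComm.add_pow_primitive (QComm.sum_right fun i hi => hw i N
      (Finset.mem_range.1 hi) N.lt_succ_self) hq hm, h0 N N.lt_succ_self, add_zero]
    exact ih (fun i j hij hj => hw i j hij (by omega)) fun i hi => h0 i (by omega)

/-! ### Root vectors -/

/-- The iterated bracket `x_{j+k} (… (x_{j+1} x_j - r⁻¹ x_j x_{j+1}) …)` of a sequence `x`. -/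
def root (r : Kˣ) (x : ℕ → R) (j : ℕ) : ℕ → R
  | 0 => x j
  | k + 1 => x (j + (k + 1)) * root r x j k - (r : K)⁻¹ • (root r x j k * x (j + (k + 1)))

/-- A sequence `x` satisfies the Serre relations of `e_1, e_2, …` in `U_{r,s}(sl_n)`, and `x_{i+1}`
commutes with the root vector of `α_i + α_{i+1} + α_{i+2}`. The last condition follows from the
others if `r + s ≠ 0`, but not in general. -/
structure IsSerre (r s : Kˣ) (x : ℕ → R) : Prop where
  far (i j : ℕ) (h : i + 1 < j) : x i * x j = x j * x i
  serre₁ (i : ℕ) : x i ^ 2 * x (i + 1) - ((r : K) + s) • (x i * x (i + 1) * x i)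
    + ((r : K) * s) • (x (i + 1) * x i ^ 2) = 0
  serre₂ (i : ℕ) : x i * x (i + 1) ^ 2 - ((r : K) + s) • (x (i + 1) * x i * x (i + 1))
    + ((r : K) * s) • (x (i + 1) ^ 2 * x i) = 0
  mid (i : ℕ) : x (i + 1) * root r x i 2 = root r x i 2 * x (i + 1)

lemma QComm.root_right {r : Kˣ} {x : ℕ → R} {u : R} {w : ℕ → K} {j k : ℕ}
    (h : ∀ i ≤ k, QComm (w i) u (x (j + i))) :
    QComm (∏ i ∈ Finset.range (k + 1), w i) u (root r x j k) := by
  induction k with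
  | zero => simpa [root] using h 0 le_rfl
  | succ k ih =>
    rw [Finset.prod_range_succ]
    exact ((h (k + 1) le_rfl).bracket_right (ih fun i hi => h i (by omega)) _).congr (mul_comm _ _)

lemma QComm.root_left {r : Kˣ} {x : ℕ → R} {u : R} {w : ℕ → K} {j k : ℕ}
    (h : ∀ i ≤ k, QComm (w i) (x (j + i)) u) :
    QComm (∏ i ∈ Finset.range (k + 1), w i) (root r x j k) u := by
  induction k with
  | zero => simpa [root] using h 0 le_rfl
  | succ k ih =>
    rw [Finset.prod_range_succ]
    exact ((h (k + 1) le_rfl).bracket_left (ih fun i hi => h i (by omega)) _).congr (mul_comm _ _)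

lemma root_commute {r : Kˣ} {x : ℕ → R} {u : R} {j k : ℕ}
    (h : ∀ i ≤ k, u * x (j + i) = x (j + i) * u) : u * root r x j k = root r x j k * u :=
  ((QComm.root_right (w := fun _ => (1 : K))
    fun i hi => QComm.of_commute (h i hi)).congr (by simp)).eq_of_one

namespace IsSerre

variable {r s : Kˣ} {x : ℕ → R} (hx : IsSerre r s x)
include hx

/-- The root vectors can also be built from the top simple root downwards. -/
lemma root_succ' (j k : ℕ) :
    root r x j (k + 1) = root r x (j + 1) k * x j - (r : K)⁻¹ • (x j * root r x (j + 1) k) := by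
  induction k with
  | zero => simp [root]
  | succ k ih =>
    have h : x (j + (k + 2)) * x j = x j * x (j + (k + 2)) := (hx.far _ _ (by omega)).symm
    have h' (z : R) : x (j + (k + 2)) * (x j * z) = x j * (x (j + (k + 2)) * z) := by
      rw [← mul_assoc, h, mul_assoc]
    rw [root, ih, root, show j + 1 + (k + 1) = j + (k + 2) by omega]
    simp only [mul_sub, sub_mul, mul_smul_comm, smul_mul_assoc, smul_sub, mul_assoc, h, h']
    abel

lemma top_two (j : ℕ) : QComm (s : K) (root r x j 1) (x (j + 1)) := by
  have h := hx.serre₂ j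
  have hr : (r : K) ≠ 0 := r.ne_zero
  rw [QComm, ← sub_eq_zero, ← neg_eq_zero, ← smul_zero ((r : K)⁻¹), ← h]
  simp only [root, mul_sub, sub_mul, mul_smul_comm, smul_mul_assoc, smul_sub, mul_assoc, pow_two]
  match_scalars <;> grind

lemma bot_two (j : ℕ) : QComm (s : K) (x j) (root r x j 1) := by
  have h := hx.serre₁ j
  have hr : (r : K) ≠ 0 := r.ne_zero
  rw [QComm, ← sub_eq_zero, ← neg_eq_zero, ← smul_zero ((r : K)⁻¹), ← h]
  simp only [root, mul_sub, sub_mul, mul_smul_comm, smul_mul_assoc, smul_sub, mul_assoc, pow_two]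
  match_scalars <;> grind

/-- The `q`-commutation of a root vector with the simple root vector at its top end. -/
lemma root_top (j k : ℕ) : QComm (s : K) (root r x j (k + 1)) (x (j + (k + 1))) := by
  induction k generalizing j with
  | zero => exact hx.top_two j
  | succ k ih =>
    rw [hx.root_succ']
    have h := ih (j + 1)
    rw [show j + 1 + (k + 1) = j + (k + 2) by omega] at h
    exact (h.bracket_left (.of_commute (hx.far _ _ (by omega))) _).congr (mul_one _)

/-- The `q`-commutation of a root vector with the simple root vector at its bottom end. -/
lemma root_bot (j k : ℕ) : QComm (s : K) (x j) (root r x j (k + 1)) := by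
  induction k with
  | zero => exact hx.bot_two j
  | succ k ih =>
    rw [root]
    exact ((QComm.of_commute (hx.far _ _ (by omega))).bracket_right ih _).congr (one_mul _)

/-- A simple root vector commutes with a root vector in whose root it is an inner summand. -/
lemma root_mid (j k i : ℕ) (hj : j < i) (hi : i < j + k) :
    x i * root r x j k = root r x j k * x i := by
  obtain ⟨t, rfl⟩ := Nat.exists_eq_add_of_lt hj
  induction t generalizing j k with
  | zero =>
    obtain ⟨k, rfl⟩ := Nat.exists_eq_add_of_le (show 2 ≤ k by omega)
    clear hj hi
    induction k with
    | zero => exact hx.mid j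
    | succ k ih =>
      rw [← add_assoc, root]
      exact (((QComm.of_commute (hx.far _ _ (by omega))).bracket_right
        (.of_commute ih) _).congr (one_mul (1 : K))).eq_of_one
  | succ t ih =>
    obtain ⟨k, rfl⟩ := Nat.exists_eq_add_of_le' (show 1 ≤ k by omega)
    rw [hx.root_succ']
    have h := ih (j + 1) k (by omega) (by omega)
    rw [show j + 1 + t + 1 = j + (t + 1) + 1 by omega] at h
    exact (((QComm.of_commute h).bracket_right (.of_commute
      (hx.far _ _ (by omega)).symm) _).congr (one_mul (1 : K))).eq_of_one

/-- Root vectors with the same top simple root. -/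
lemma root_same_top (j a b : ℕ) :
    QComm (s : K) (root r x j (a + b + 1)) (root r x (j + a + 1) b) := by
  refine (QComm.root_right (w := fun i => if i = b then (s : K) else 1) fun i hi => ?_).congr ?_
  · split_ifs with h
    · have := hx.root_top j (a + b)
      rwa [show j + (a + b + 1) = j + a + 1 + i by omega] at this
    · exact .of_commute (hx.root_mid _ _ _ (by omega) (by omega)).symm
  · simp [Finset.prod_ite_eq']

/-- Root vectors with the same bottom simple root. -/
lemma root_same_bot (j a k : ℕ) (h : a < k) :
    QComm (s : K) (root r x j a) (root r x j k) := by
  refine (QComm.root_left (w := fun i => if i = 0 then (s : K) else 1) fun i hi => ?_).congr ?_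
  · split_ifs with hi0
    · obtain ⟨k, rfl⟩ := Nat.exists_eq_add_of_le' (show 1 ≤ k by omega)
      subst hi0
      exact hx.root_bot j k
    · exact .of_commute (hx.root_mid _ _ _ (by omega) (by omega))
  · simp [Finset.prod_ite_eq']

end IsSerre

end Commutation

section RootVectors

/-! ### Powers of root vectors under the coproduct -/

variable {K : Type*} [Field K] {R : Type*} [Ring R] [Algebra K R]

/-- The product `g_j g_{j+1} ⋯ g_{j+k}`. -/
def gprod (g : ℕ → R) (j : ℕ) : ℕ → R
  | 0 => g j
  | k + 1 => gprod g j k * g (j + (k + 1))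

/-- The scalar by which `g_i` commutes with the root vector of the root
`α_j + ⋯ + α_{j+k} = ε_j - ε_{j+k+1}`. -/
def rootChi (r s : Kˣ) (i j k : ℕ) : Kˣ :=
  r ^ ((if i = j then 1 else 0) - (if i = j + k + 1 then 1 else 0) : ℤ) *
    s ^ ((if i + 1 = j then 1 else 0) - (if i + 1 = j + k + 1 then 1 else 0) : ℤ)

/-- The scalar by which `g_i ⋯ g_{i+t}` commutes with the root vector of the root
`α_j + ⋯ + α_{j+k} = ε_j - ε_{j+k+1}`. -/
def prodChi (r s : Kˣ) (i t j k : ℕ) : Kˣ :=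
  r ^ ((if i ≤ j ∧ j ≤ i + t then 1 else 0) -
      (if i ≤ j + k + 1 ∧ j + k + 1 ≤ i + t then 1 else 0) : ℤ) *
    s ^ ((if i + 1 ≤ j ∧ j ≤ i + t + 1 then 1 else 0) -
      (if i + 1 ≤ j + k + 1 ∧ j + k + 1 ≤ i + t + 1 then 1 else 0) : ℤ)

lemma rootChi_succ (r s : Kˣ) (i j k : ℕ) :
    chi r s i (j + (k + 1)) * rootChi r s i j k = rootChi r s i j (k + 1) := by
  rw [chi, rootChi, rootChi, mul_mul_mul_comm, ← zpow_add, ← zpow_add]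
  congr 2 <;> simp only [epsAlpha] <;> grind

lemma prodChi_succ (r s : Kˣ) (i t j k : ℕ) :
    prodChi r s i t j k * rootChi r s (i + (t + 1)) j k = prodChi r s i (t + 1) j k := by
  rw [prodChi, rootChi, prodChi, mul_mul_mul_comm, ← zpow_add, ← zpow_add]
  congr 2 <;> grind

section Weights

variable {r s : Kˣ} {x g : ℕ → R} (hgx : ∀ i j, QComm (chi r s i j : K) (g i) (x j))
include hgx

lemma g_root (i j k : ℕ) : QComm (rootChi r s i j k : K) (g i) (root r x j k) := by
  induction k with
  | zero =>
    have : chi r s i j = rootChi r s i j 0 := by simp [chi, rootChi, epsAlpha]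
    exact this ▸ hgx i j
  | succ k ih =>
    refine ((hgx i (j + (k + 1))).bracket_right ih _).congr ?_
    rw [← rootChi_succ, Units.val_mul]

lemma gprod_root (i t j k : ℕ) :
    QComm (prodChi r s i t j k : K) (gprod g i t) (root r x j k) := by
  induction t with
  | zero =>
    have : rootChi r s i j k = prodChi r s i 0 j k := by
      rw [rootChi, prodChi]
      congr 2 <;> grind
    exact this ▸ g_root hgx i j k
  | succ t ih =>
    refine (ih.mul_left (g_root hgx (i + (t + 1)) j k)).congr ?_
    rw [← prodChi_succ, Units.val_mul]

end Weights

lemma gprod_commute {g : ℕ → R} {u : R} (h : ∀ i, g i * u = u * g i) (j k : ℕ) :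
    gprod g j k * u = u * gprod g j k := by
  induction k with
  | zero => exact h j
  | succ k ih => rw [gprod, mul_assoc, h, ← mul_assoc, ih, mul_assoc]

/-- Two products of three factors commute up to a scalar if their factors do. -/
lemma QComm.triple {X X' G G' Y Y' : R} {a b c d : K}
    (hX : QComm a X X') (hGX : QComm b G X') (hGX' : QComm c G' X) (hY : QComm d Y Y')
    (hGG : G * G' = G' * G) (hGY : G * Y' = Y' * G) (hGY' : G' * Y = Y * G')
    (hXY : X' * Y = Y * X') (hXY' : X * Y' = Y' * X) (hc : c ≠ 0) :
    QComm (a * b * c⁻¹ * d) (X * G * Y) (X' * G' * Y') := by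
  have h1 : QComm (a * b) (X * G * Y) X' :=
    (((hX.mul_left hGX).mul_left (.of_commute hXY.symm)).congr (mul_one _))
  have h2 : QComm c⁻¹ (X * G * Y) G' :=
    (((hGX'.symm hc).mul_left (.of_commute hGG)).mul_left (.of_commute hGY'.symm)).congr (by simp)
  have h3 : QComm d (X * G * Y) Y' :=
    (((QComm.of_commute hXY').mul_left (.of_commute hGY)).mul_left hY).congr (by simp)
  exact (h1.mul_right h2).mul_right h3

/-- Two systems of Serre generators `x`, `y` commuting with each other, together with a system of
commuting elements `g` that commute with `y` and act on `x` by weights. The typical case is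
`x_i = e_i ⊗ 1`, `y_i = 1 ⊗ e_i`, `g_i = ω_i ⊗ 1` in a tensor square, where
`x_i + g_i y_i` is the coproduct of `e_i`. -/
structure IsDouble (r s : Kˣ) (x g y : ℕ → R) : Prop where
  x_serre : IsSerre r s x
  y_serre : IsSerre r s y
  gx (i j : ℕ) : QComm (chi r s i j : K) (g i) (x j)
  gg (i j : ℕ) : g i * g j = g j * g i
  gy (i j : ℕ) : g i * y j = y j * g i
  xy (i j : ℕ) : x i * y j = y j * x i

namespace IsDouble

variable {r s : Kˣ} {x g y : ℕ → R} (h : IsDouble r s x g y)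
include h

lemma xrY (i j k : ℕ) : x i * root r y j k = root r y j k * x i :=
  root_commute fun _ _ => h.xy _ _

lemma grY (i j k : ℕ) : g i * root r y j k = root r y j k * g i :=
  root_commute fun _ _ => h.gy _ _

lemma rXy (i j k : ℕ) : y i * root r x j k = root r x j k * y i :=
  root_commute fun _ _ => (h.xy _ _).symm

lemma rXrY (j k j' k' : ℕ) :
    root r x j k * root r y j' k' = root r y j' k' * root r x j k :=
  root_commute fun _ _ => (h.rXy _ _ _).symm

lemma GrY (i t j k : ℕ) : gprod g i t * root r y j k = root r y j k * gprod g i t :=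
  gprod_commute (fun i => h.grY i j k) i t

lemma Gy (i t j : ℕ) : gprod g i t * y j = y j * gprod g i t :=
  gprod_commute (fun i => h.gy i j) i t

lemma gG (i j k : ℕ) : gprod g j k * g i = g i * gprod g j k :=
  gprod_commute (fun j => h.gg j i) j k

lemma GG (i t j k : ℕ) : gprod g j k * gprod g i t = gprod g i t * gprod g j k :=
  gprod_commute (fun j => (h.gG j i t).symm) j k

/-- The coproduct of a root vector. -/
lemma root_add (j k : ℕ) :
    root r (fun i => x i + g i * y i) j k = root r x j k + gprod g j k * root r y j k +
      (1 - (s : K) * (r : K)⁻¹) • ∑ t ∈ Finset.range k,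
        root r x (j + t + 1) (k - 1 - t) * gprod g j t * root r y j t := by
  induction k with
  | zero => simp [root, gprod]
  | succ k ih =>
    have hr : (r : K) ≠ 0 := r.ne_zero
    set i := j + (k + 1) with hi
    have e1 : gprod g j k * x i = (s : K) • (x i * gprod g j k) := by
      refine ((gprod_root h.gx j k i 0).congr ?_)
      rw [prodChi, hi]
      split_ifs <;> first | omega | simp
    have e2 : g i * root r x j k = (r : K)⁻¹ • (root r x j k * g i) := by
      refine ((g_root h.gx i j k).congr ?_)
      rw [rootChi, hi]
      split_ifs <;> first | omega | simp
    -- the summands of the coproduct, bracketed with `x_i` and with `g_i y_i`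
    have e3 (t : ℕ) (ht : t < k) :
        x i * (root r x (j + t + 1) (k - 1 - t) * gprod g j t * root r y j t) -
          (r : K)⁻¹ • ((root r x (j + t + 1) (k - 1 - t) * gprod g j t * root r y j t) * x i) =
        root r x (j + t + 1) (k - t) * gprod g j t * root r y j t := by
      have e4 : gprod g j t * x i = x i * gprod g j t := by
        refine ((gprod_root h.gx j t i 0).congr ?_).eq_of_one
        rw [prodChi, hi]
        split_ifs <;> first | omega | simp
      obtain ⟨b, hb⟩ := Nat.exists_eq_add_of_lt ht
      rw [show k - 1 - t = b by omega, show k - t = b + 1 by omega, root,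
        show j + t + 1 + (b + 1) = i by omega]
      simp only [sub_mul, smul_mul_assoc, mul_assoc]
      rw [← h.xrY, ← mul_assoc (gprod g j t), e4, mul_assoc]
    have e5 (t : ℕ) (ht : t < k) :
        g i * y i * (root r x (j + t + 1) (k - 1 - t) * gprod g j t * root r y j t) -
          (r : K)⁻¹ • ((root r x (j + t + 1) (k - 1 - t) * gprod g j t * root r y j t) *
            (g i * y i)) = 0 := by
      have e6 : QComm (r : K)⁻¹ (g i) (root r x (j + t + 1) (k - 1 - t)) := by
        refine ((g_root h.gx i _ _).congr ?_)
        rw [rootChi, hi]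
        split_ifs <;> first | omega | simp
      have e7 : y i * root r y j t = root r y j t * y i :=
        root_commute fun a ha => (h.y_serre.far _ _ (by omega)).symm
      rw [sub_eq_zero]
      refine QComm.congr (c := (r : K)⁻¹ * 1 * (1 * 1) * (1 * 1)) ?_ (by simp)
      exact (((e6.mul_left (.of_commute (h.rXy _ _ _)))).mul_right
        ((QComm.of_commute (h.gG _ _ _).symm).mul_left (.of_commute (h.Gy _ _ _).symm))).mul_right
        ((QComm.of_commute (h.grY _ _ _)).mul_left (.of_commute e7))
    have e8 : x i * (gprod g j k * root r y j k) -
        (r : K)⁻¹ • (gprod g j k * root r y j k * x i) =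
        (1 - (s : K) * (r : K)⁻¹) • (root r x i 0 * gprod g j k * root r y j k) := by
      rw [mul_assoc (gprod g j k), ← h.xrY, ← mul_assoc (gprod g j k), e1, smul_mul_assoc,
        mul_assoc, mul_assoc, root]
      module
    have e9 : g i * y i * root r x j k - (r : K)⁻¹ • (root r x j k * (g i * y i)) = 0 := by
      rw [mul_assoc, h.rXy, ← mul_assoc, e2, smul_mul_assoc, mul_assoc, sub_self]
    have e10 : g i * y i * (gprod g j k * root r y j k) -
        (r : K)⁻¹ • (gprod g j k * root r y j k * (g i * y i)) =
        gprod g j (k + 1) * root r y j (k + 1) := by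
      have a1 : g i * y i * (gprod g j k * root r y j k) =
          gprod g j k * g i * (y i * root r y j k) := by
        rw [mul_assoc, ← mul_assoc (y i), ← h.Gy, h.gG, mul_assoc, mul_assoc]
      have a2 : gprod g j k * root r y j k * (g i * y i) =
          gprod g j k * g i * (root r y j k * y i) := by
        rw [mul_assoc, ← mul_assoc (root r y j k), ← h.grY, mul_assoc, mul_assoc]
      rw [a1, a2, gprod, root, mul_sub, mul_smul_comm]
    have e11 : x i * (∑ t ∈ Finset.range k,
          root r x (j + t + 1) (k - 1 - t) * gprod g j t * root r y j t) -
        (r : K)⁻¹ • ((∑ t ∈ Finset.range k,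
          root r x (j + t + 1) (k - 1 - t) * gprod g j t * root r y j t) * x i) =
        ∑ t ∈ Finset.range k, root r x (j + t + 1) (k - t) * gprod g j t * root r y j t := by
      rw [Finset.mul_sum, Finset.sum_mul, Finset.smul_sum, ← Finset.sum_sub_distrib]
      exact Finset.sum_congr rfl fun t ht => e3 t (Finset.mem_range.1 ht)
    have e12 : g i * y i * (∑ t ∈ Finset.range k,
          root r x (j + t + 1) (k - 1 - t) * gprod g j t * root r y j t) -
        (r : K)⁻¹ • ((∑ t ∈ Finset.range k,
          root r x (j + t + 1) (k - 1 - t) * gprod g j t * root r y j t) * (g i * y i)) = 0 := by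
      rw [Finset.mul_sum, Finset.sum_mul, Finset.smul_sum, ← Finset.sum_sub_distrib]
      exact Finset.sum_eq_zero fun t ht => e5 t (Finset.mem_range.1 ht)
    have e13 : root r x j (k + 1) = x i * root r x j k - (r : K)⁻¹ • (root r x j k * x i) := rfl
    rw [root, ih, Finset.sum_range_succ, show k + 1 - 1 - k = 0 by omega, Nat.add_sub_cancel,
      ← hi, show j + k + 1 = i by omega, smul_add, ← e8, ← e10, ← e11, e13]
    simp only [add_mul, mul_add, smul_mul_assoc, mul_smul_comm, smul_sub, smul_add]
    rw [sub_eq_zero] at e9 e12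
    rw [e9, e12]
    simp only [smul_comm _ (r : K)⁻¹]
    abel

/-- The `m`-th powers of root vectors vanish in the coproduct: the summands of the coproduct of a
root vector commute up to `r s⁻¹`, hence the power of the sum is the sum of the powers. -/
lemma root_add_pow {m : ℕ} (hm : 0 < m) (hq : IsPrimitiveRoot ((r : K) * (s : K)⁻¹) m)
    (hx : ∀ j k, root r x j k ^ m = 0) (hy : ∀ j k, root r y j k ^ m = 0) (j k : ℕ) :
    root r (fun i => x i + g i * y i) j k ^ m = 0 := by
  have hr : (r : K) ≠ 0 := r.ne_zero
  have hs : (s : K) ≠ 0 := s.ne_zero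
  set C : ℕ → R := fun t => root r x (j + t + 1) (k - 1 - t) * gprod g j t * root r y j t with hC
  -- the torus part `G_{j,t}` moves past the root vectors in `C a` and in `x_{j,k}`
  have wlt (t a : ℕ) (hta : t < a) (ha : a < k) :
      QComm (1 : K) (gprod g j t) (root r x (j + a + 1) (k - 1 - a)) := by
    refine ((gprod_root h.gx j t (j + a + 1) (k - 1 - a)).congr ?_)
    rw [prodChi]
    split_ifs <;> first | omega | simp
  have wgt (t a : ℕ) (hta : a < t) (ht : t < k) :
      QComm ((r : K) * s) (gprod g j t) (root r x (j + a + 1) (k - 1 - a)) := by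
    refine ((gprod_root h.gx j t (j + a + 1) (k - 1 - a)).congr ?_)
    rw [prodChi]
    split_ifs <;> first | omega | simp
  have wtop (a : ℕ) (ha : a < k) :
      QComm (r : K) (gprod g j k) (root r x (j + a + 1) (k - 1 - a)) := by
    refine ((gprod_root h.gx j k (j + a + 1) (k - 1 - a)).congr ?_)
    rw [prodChi]
    split_ifs <;> first | omega | simp
  have wbot (t : ℕ) (ht : t < k) : QComm (r : K) (gprod g j t) (root r x j k) := by
    refine ((gprod_root h.gx j t j k).congr ?_)
    rw [prodChi]
    split_ifs <;> first | omega | simp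
  have wall : QComm ((r : K) * (s : K)⁻¹) (gprod g j k) (root r x j k) := by
    refine ((gprod_root h.gx j k j k).congr ?_)
    rw [prodChi]
    split_ifs <;> first | omega | simp
  have hXA (t : ℕ) (ht : t < k) :
      QComm (s : K)⁻¹ (root r x (j + t + 1) (k - 1 - t)) (root r x j k) := by
    have := (h.x_serre.root_same_top j t (k - 1 - t)).symm hs
    rwa [show t + (k - 1 - t) + 1 = k by omega] at this
  have hXX (t t' : ℕ) (ht : t' < t) (htk : t < k) :
      QComm (s : K)⁻¹ (root r x (j + t + 1) (k - 1 - t)) (root r x (j + t' + 1) (k - 1 - t')) := by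
    have := (h.x_serre.root_same_top (j + t' + 1) (t - t' - 1) (k - 1 - t)).symm hs
    rwa [show t - t' - 1 + (k - 1 - t) + 1 = k - 1 - t' by omega,
      show j + t' + 1 + (t - t' - 1) + 1 = j + t + 1 by omega] at this
  have hCA (t : ℕ) (ht : t < k) : QComm ((r : K) * (s : K)⁻¹) (C t) (root r x j k) := by
    have := QComm.triple (G' := 1) (Y' := 1) (hXA t ht) (wbot t ht)
      (QComm.of_commute (K := K) ((one_mul _).trans (mul_one _).symm))
      (QComm.of_commute (K := K) ((mul_one (root r y j t)).trans (one_mul _).symm))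
      (by simp) (by simp) (by simp) (h.rXrY _ _ _ _) (by simp) one_ne_zero
    simpa [mul_comm] using this
  have hBC (t : ℕ) (ht : t < k) :
      QComm ((r : K) * (s : K)⁻¹) (gprod g j k * root r y j k) (C t) := by
    have := QComm.triple (X := 1)
      (QComm.of_commute (K := K) ((one_mul _).trans (mul_one _).symm))
      (wtop t ht) (QComm.of_commute (K := K) ((mul_one _).trans (one_mul (gprod g j t)).symm))
      ((h.y_serre.root_same_bot j t k ht).symm hs) (h.GG _ _ _ _) (h.GrY _ _ _ _) (h.GrY _ _ _ _)
      (h.rXrY _ _ _ _) (by simp) one_ne_zero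
    simpa using this
  have hCC (t t' : ℕ) (ht : t' < t) (htk : t < k) :
      QComm ((r : K) * (s : K)⁻¹) (C t) (C t') := by
    refine (QComm.triple (hXX t t' ht htk) (wgt t t' ht htk) (wlt t' t ht htk)
      ((h.y_serre.root_same_bot j t' t ht).symm hs) (h.GG _ _ _ _) (h.GrY _ _ _ _) (h.GrY _ _ _ _)
      (h.rXrY _ _ _ _) (h.rXrY _ _ _ _) one_ne_zero).congr ?_
    field_simp
  have hBA : QComm ((r : K) * (s : K)⁻¹) (gprod g j k * root r y j k) (root r x j k) :=
    (wall.mul_left (.of_commute (h.rXrY _ _ _ _).symm)).congr (mul_one _)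
  have hC0 (t : ℕ) (ht : t < k) : C t ^ m = 0 := by
    have h1 : QComm (1 : K) (root r x (j + t + 1) (k - 1 - t) * gprod g j t) (root r y j t) :=
      ((QComm.of_commute (h.rXrY _ _ _ _)).mul_left (.of_commute (h.GrY _ _ _ _))).congr (mul_one _)
    exact h1.mul_pow_eq_zero (.inl (hy _ _))
  rw [h.root_add, add_right_comm, QComm.add_pow_primitive (hBA.add_right
    ((QComm.sum_right fun t ht => hBC t (Finset.mem_range.1 ht)).smul_right _)) hq hm,
    QComm.add_pow_primitive ((QComm.sum_left fun t ht => hCA t (Finset.mem_range.1 ht)).smul_left _)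
      hq hm, hx, smul_pow, sum_pow_eq_zero hq hm (fun t t' ht htk => hCC t' t ht htk) hC0,
    (QComm.of_commute (K := K) (h.GrY j k j k)).mul_pow_eq_zero (.inl (hy _ _))]
  simp

/-- The commutator relation `[x_{i+1}, root i 2] = 0` is inherited by the coproduct. -/
lemma add_mid (i : ℕ) :
    (x (i + 1) + g (i + 1) * y (i + 1)) * root r (fun i => x i + g i * y i) i 2 =
      root r (fun i => x i + g i * y i) i 2 * (x (i + 1) + g (i + 1) * y (i + 1)) := by
  have hr : (r : K) ≠ 0 := r.ne_zero
  have hs : (s : K) ≠ 0 := s.ne_zero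
  set Q := root r x (i + 1) 1
  set P := root r y i 1
  have hG : gprod g i 1 = g i * g (i + 1) := rfl
  have ga : QComm (s : K) (g i) (x (i + 1)) := (h.gx i (i + 1)).congr (by rw [chi_succ])
  have gbc : QComm (s : K) (g (i + 1)) (x (i + 2)) :=
    (h.gx (i + 1) (i + 1 + 1)).congr (by rw [chi_succ])
  have gG : QComm (1 : K) (gprod g i 2) (x (i + 1)) := by
    refine ((gprod_root h.gx i 2 (i + 1) 0).congr ?_)
    rw [prodChi]
    split_ifs <;> first | omega | simp
  have gab : QComm (r : K) (gprod g i 1) (x (i + 1)) := by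
    refine ((gprod_root h.gx i 1 (i + 1) 0).congr ?_)
    rw [prodChi]
    split_ifs <;> first | omega | simp
  have gbT : QComm (1 : K) (g (i + 1)) (root r x i 2) := by
    refine ((g_root h.gx (i + 1) i 2).congr ?_)
    rw [rootChi]
    split_ifs <;> first | omega | simp
  have gbQ : QComm (r : K) (g (i + 1)) Q := by
    refine ((g_root h.gx (i + 1) (i + 1) 1).congr ?_)
    rw [rootChi]
    split_ifs <;> first | omega | simp
  have bQ : QComm (s : K) (x (i + 1)) Q := h.x_serre.bot_two (i + 1)
  have Pb : QComm (s : K) P (y (i + 1)) := h.y_serre.top_two i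
  have defQ : Q = x (i + 2) * x (i + 1) - (r : K)⁻¹ • (x (i + 1) * x (i + 2)) := rfl
  have defP : P = y (i + 1) * y i - (r : K)⁻¹ • (y i * y (i + 1)) := rfl
  have k1 : QComm (1 : K) (x (i + 1) + g (i + 1) * y (i + 1)) (root r x i 2) :=
    (QComm.of_commute (h.x_serre.mid i)).add_left
      ((gbT.mul_left (.of_commute (h.rXy _ _ _))).congr (mul_one _))
  have k2 : QComm (1 : K) (x (i + 1) + g (i + 1) * y (i + 1)) (gprod g i 2 * root r y i 2) := by
    refine QComm.add_left
      (((gG.symm one_ne_zero).mul_right (.of_commute (h.xrY _ _ _))).congr (by simp)) ?_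
    exact (((QComm.of_commute (h.gG _ _ _).symm).mul_left
      (.of_commute (h.Gy _ _ _).symm)).mul_right ((QComm.of_commute (h.grY _ _ _)).mul_left
        (.of_commute (h.y_serre.mid i)))).congr (by simp)
  have k3 : (x (i + 1) + g (i + 1) * y (i + 1)) * (Q * g i * y i) -
      Q * g i * y i * (x (i + 1) + g (i + 1) * y (i + 1)) = (r : K) • (Q * gprod g i 1 * P) := by
    have a1 : QComm (1 : K) (x (i + 1)) (Q * g i * y i) :=
      ((bQ.mul_right (ga.symm hs)).mul_right (.of_commute (h.xy _ _))).congr (by simp)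
    have b1 (z : R) : g (i + 1) * (Q * z) = (r : K) • (Q * (g (i + 1) * z)) := by
      rw [← mul_assoc, gbQ, smul_mul_assoc, mul_assoc]
    have b2 (z : R) : y (i + 1) * (Q * z) = Q * (y (i + 1) * z) := by
      rw [← mul_assoc, h.rXy, mul_assoc]
    have b3 (i j : ℕ) (z : R) : y i * (g j * z) = g j * (y i * z) := by
      rw [← mul_assoc, ← h.gy, mul_assoc]
    have b4 (z : R) : g (i + 1) * (g i * z) = g i * (g (i + 1) * z) := by
      rw [← mul_assoc, ← h.gg, mul_assoc]
    rw [add_mul, mul_add, a1, defP, hG]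
    simp only [one_smul, mul_assoc, b1, b2, b3, b4, mul_sub, smul_sub, mul_smul_comm, smul_smul,
      mul_inv_cancel₀ hr]
    abel
  have k4 : (x (i + 1) + g (i + 1) * y (i + 1)) * (x (i + 2) * gprod g i 1 * P) -
      x (i + 2) * gprod g i 1 * P * (x (i + 1) + g (i + 1) * y (i + 1)) =
        -((r : K) • (Q * gprod g i 1 * P)) := by
    have a1 : QComm (1 : K) (g (i + 1) * y (i + 1)) (x (i + 2) * gprod g i 1 * P) := by
      refine (((gbc.mul_left (.of_commute (h.xy _ _).symm)).mul_right
        ((QComm.of_commute (h.gG _ _ _).symm).mul_left (.of_commute (h.Gy _ _ _).symm))).mul_right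
        ((QComm.of_commute (h.grY _ _ _)).mul_left (Pb.symm hs))).congr (by simp)
    have b1 : P * x (i + 1) = x (i + 1) * P := (h.xrY _ _ _).symm
    have b2 (z : R) :
        gprod g i 1 * (x (i + 1) * z) = (r : K) • (x (i + 1) * (gprod g i 1 * z)) := by
      rw [← mul_assoc, gab, smul_mul_assoc, mul_assoc]
    rw [add_mul, mul_add, a1, defQ]
    simp only [one_smul, mul_assoc, b1, b2, sub_mul, smul_sub, mul_smul_comm, smul_mul_assoc,
      smul_smul, mul_inv_cancel₀ hr]
    abel
  have hz : root r (fun i => x i + g i * y i) i 2 = root r x i 2 + gprod g i 2 * root r y i 2 +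
      (1 - (s : K) * (r : K)⁻¹) • (Q * g i * y i + x (i + 2) * gprod g i 1 * P) := by
    rw [h.root_add, Finset.sum_range_succ, Finset.sum_range_one]
    rfl
  rw [← sub_eq_zero, hz]
  have k5 := congrArg₂ (· + ·) k3 k4
  simp only [add_neg_cancel] at k5
  rw [← smul_zero (1 - (s : K) * (r : K)⁻¹), ← k5]
  simp only [mul_add _ (root r x i 2 + _), mul_add _ (root r x i 2), k1.eq_of_one,
    k2.eq_of_one, mul_smul_comm, add_mul, smul_mul_assoc, mul_add, smul_add, smul_sub]
  abel

end IsDouble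

end RootVectors

section Quotient

variable {K : Type*} [Field K] {R : Type*} [Ring R] [Algebra K R]

/-! ### The quotient bialgebra -/

/-- Extension by zero of a family indexed by `Fin N` to a sequence. -/
def extendZero {N : ℕ} (a : Fin N → R) (i : ℕ) : R := if h : i < N then a ⟨i, h⟩ else 0

lemma extendZero_of_lt {N : ℕ} (a : Fin N → R) {i : ℕ} (h : i < N) :
    extendZero a i = a ⟨i, h⟩ := dif_pos h

lemma extendZero_of_le {N : ℕ} (a : Fin N → R) {i : ℕ} (h : N ≤ i) : extendZero a i = 0 :=
  dif_neg h.not_gt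

lemma map_extendZero {S F : Type*} [Ring S] [FunLike F R S] [AddMonoidHomClass F R S] (φ : F)
    {N : ℕ} (a : Fin N → R) (i : ℕ) : φ (extendZero a i) = extendZero (fun j => φ (a j)) i := by
  unfold extendZero
  split_ifs <;> simp

lemma map_root {S : Type*} [Ring S] [Algebra K S] (φ : R →ₐ[K] S) (r : Kˣ) (x : ℕ → R) (j k : ℕ) :
    φ (root r x j k) = root r (fun i => φ (x i)) j k := by
  induction k with
  | zero => rfl
  | succ k ih => simp [root, ih]

lemma IsSerre.map {S : Type*} [Ring S] [Algebra K S] {r s : Kˣ} {x : ℕ → R} (h : IsSerre r s x)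
    (φ : R →ₐ[K] S) : IsSerre r s (fun i => φ (x i)) where
  far i j hij := by
    simpa only [map_mul] using congrArg φ (h.far i j hij)
  serre₁ i := by
    simpa only [map_add, map_sub, map_smul, map_mul, map_pow, map_zero] using
      congrArg φ (h.serre₁ i)
  serre₂ i := by
    simpa only [map_add, map_sub, map_smul, map_mul, map_pow, map_zero] using
      congrArg φ (h.serre₂ i)
  mid i := by
    simpa only [map_root, map_mul] using congrArg φ (h.mid i)

/-- Relations of a family indexed by `Fin N` pass to its extension by zero. -/
lemma isSerre_extendZero {N : ℕ} {r s : Kˣ} (a : Fin N → R)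
    (far : ∀ i j : Fin N, (i : ℕ) + 1 < j → a i * a j - a j * a i = 0)
    (serre₁ : ∀ i j : Fin N, (j : ℕ) = i + 1 → a i ^ 2 * a j - ((r : K) + s) • (a i * a j * a i)
      + ((r : K) * s) • (a j * a i ^ 2) = 0)
    (serre₂ : ∀ i j : Fin N, (j : ℕ) = i + 1 → a i * a j ^ 2 - ((r : K) + s) • (a j * a i * a j)
      + ((r : K) * s) • (a j ^ 2 * a i) = 0)
    (mid : ∀ i, extendZero a (i + 1) * root r (extendZero a) i 2 =
      root r (extendZero a) i 2 * extendZero a (i + 1)) :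
    IsSerre r s (extendZero a) where
  far i j hij := by
    by_cases hj : j < N
    · rw [extendZero_of_lt a hj, extendZero_of_lt a (show i < N by omega)]
      exact sub_eq_zero.1 (far _ _ hij)
    · simp [extendZero_of_le a (not_lt.1 hj)]
  serre₁ i := by
    by_cases hj : i + 1 < N
    · rw [extendZero_of_lt a hj, extendZero_of_lt a (show i < N by omega)]
      exact serre₁ _ _ rfl
    · simp [extendZero_of_le a (not_lt.1 hj)]
  serre₂ i := by
    by_cases hj : i + 1 < N
    · rw [extendZero_of_lt a hj, extendZero_of_lt a (show i < N by omega)]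
      exact serre₂ _ _ rfl
    · simp [extendZero_of_le a (not_lt.1 hj)]
  mid := mid

lemma root_eq_zero {r : Kˣ} {x : ℕ → R} {j k : ℕ} (h : x (j + k) = 0) : root r x j k = 0 := by
  cases k with
  | zero => exact h
  | succ k => simp [root, h]

variable (n : ℕ) (r s : Kˣ)

lemma rootE_eq (j k : ℕ) (h : j + k < n - 1) :
    rootE n r s j k h = root r (extendZero (e n r s)) j k := by
  induction k with
  | zero => simp [rootE, root, extendZero_of_lt _ (show j < n - 1 by omega)]
  | succ k ih => rw [rootE, root, extendZero_of_lt _ h, ih (by omega)]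

lemma rootF_eq (j k : ℕ) (h : j + k < n - 1) :
    rootF n r s j k h = root s⁻¹ (extendZero (f n r s)) j k := by
  induction k with
  | zero => simp [rootF, root, extendZero_of_lt _ (show j < n - 1 by omega)]
  | succ k ih =>
    rw [rootF, root, extendZero_of_lt _ h, ih (by omega), Units.val_inv_eq_inv_val, inv_inv]

/-- The relations that define the quotient `Bar` of `U_{r,s}(sl_n)`: the `m`-th powers of the root
vectors vanish, `e_{i+1}` commutes with `𝓔_{i+2,i}`, likewise for the `f_i`, and the `l`-th powers
of the torus generators are trivial. The commutators are listed because they do not follow from the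
Serre relations if `r + s = 0`. -/
inductive BarRel (m l : ℕ) : U n r s → U n r s → Prop
  | pow_e (j k : ℕ) : BarRel m l (root r (extendZero (e n r s)) j k ^ m) 0
  | pow_f (j k : ℕ) : BarRel m l (root s⁻¹ (extendZero (f n r s)) j k ^ m) 0
  | mid_e (i : ℕ) : BarRel m l
      (extendZero (e n r s) (i + 1) * root r (extendZero (e n r s)) i 2)
      (root r (extendZero (e n r s)) i 2 * extendZero (e n r s) (i + 1))
  | mid_f (i : ℕ) : BarRel m l
      (extendZero (f n r s) (i + 1) * root s⁻¹ (extendZero (f n r s)) i 2)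
      (root s⁻¹ (extendZero (f n r s)) i 2 * extendZero (f n r s) (i + 1))
  | om (i : Fin (n - 1)) : BarRel m l (om n r s i ^ l) 1
  | om' (i : Fin (n - 1)) : BarRel m l (om' n r s i ^ l) 1

/-- A quotient bialgebra of `U_{r,s}(sl_n)` through which the Hopf pairing factors. For
`m` the order of `r s⁻¹` and `m ∣ l` it is a quotient of `u_{r,s}(sl_n)`. -/
def Bar (m l : ℕ) : Type _ := RingQuot (BarRel n r s m l)

instance (m l : ℕ) : Ring (Bar n r s m l) := inferInstanceAs (Ring (RingQuot _))

instance (m l : ℕ) : Algebra K (Bar n r s m l) := inferInstanceAs (Algebra K (RingQuot _))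

/-- The quotient map `U_{r,s}(sl_n) → Bar`. -/
def toBar (m l : ℕ) : U n r s →ₐ[K] Bar n r s m l :=
  RingQuot.mkAlgHom K (BarRel n r s m l)

variable {n r s}

lemma toBar_rel {m l : ℕ} {x y : U n r s} (h : BarRel n r s m l x y) :
    toBar n r s m l x = toBar n r s m l y :=
  RingQuot.mkAlgHom_rel K h

lemma isSerre_toBar_e (m l : ℕ) :
    IsSerre r s (extendZero fun i => toBar n r s m l (e n r s i)) := by
  refine isSerre_extendZero _ (fun i j h => ?_) (fun i j h => ?_) (fun i j h => ?_) fun i => ?_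
  · simpa only [map_sub, map_mul, map_zero] using congrArg (toBar n r s m l) (e_comm i j h)
  · simpa only [map_add, map_sub, map_smul, map_mul, map_pow, map_zero] using
      congrArg (toBar n r s m l) (e_serre₁ i j h)
  · simpa only [map_add, map_sub, map_smul, map_mul, map_pow, map_zero] using
      congrArg (toBar n r s m l) (e_serre₂ i j h)
  · simpa only [map_mul, map_root, map_extendZero] using
      toBar_rel (BarRel.mid_e (n := n) (r := r) (s := s) (m := m) (l := l) i)

lemma isSerre_toBar_f (m l : ℕ) :
    IsSerre s⁻¹ r⁻¹ (extendZero fun i => toBar n r s m l (f n r s i)) := by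
  refine isSerre_extendZero _ (fun i j h => ?_) (fun i j h => ?_) (fun i j h => ?_) fun i => ?_
  · simpa only [map_sub, map_mul, map_zero] using congrArg (toBar n r s m l) (f_comm i j h)
  · simpa only [map_add, map_sub, map_smul, map_mul, map_pow, map_zero, Units.val_inv_eq_inv_val,
      add_comm (s : K)⁻¹, mul_comm (s : K)⁻¹] using congrArg (toBar n r s m l) (f_serre₁ i j h)
  · simpa only [map_add, map_sub, map_smul, map_mul, map_pow, map_zero, Units.val_inv_eq_inv_val,
      add_comm (s : K)⁻¹, mul_comm (s : K)⁻¹] using congrArg (toBar n r s m l) (f_serre₂ i j h)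
  · simpa only [map_mul, map_root, map_extendZero] using
      toBar_rel (BarRel.mid_f (n := n) (r := r) (s := s) (m := m) (l := l) i)

lemma extendZero_qcomm {N : ℕ} {a b : Fin N → R} {c : ℕ → ℕ → K}
    (h : ∀ i j : Fin N, QComm (c i j) (a i) (b j)) (i j : ℕ) :
    QComm (c i j) (extendZero a i) (extendZero b j) := by
  unfold extendZero
  split_ifs
  · exact h _ _
  all_goals simp [QComm]

lemma extendZero_commute {N : ℕ} {a b : Fin N → R} (h : ∀ i j, a i * b j = b j * a i) (i j : ℕ) :
    extendZero a i * extendZero b j = extendZero b j * extendZero a i := by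
  unfold extendZero
  split_ifs
  · exact h _ _
  all_goals simp

lemma chi_inv_inv (i j : ℕ) : chi s⁻¹ r⁻¹ i j = (chi' r s i j)⁻¹ := by
  rw [chi, chi', inv_zpow, inv_zpow, mul_inv, mul_comm]

lemma isDouble_e (m l : ℕ) :
    IsDouble (R := Bar n r s m l ⊗[K] Bar n r s m l) r s
      (extendZero fun i => toBar n r s m l (e n r s i) ⊗ₜ[K] 1)
      (extendZero fun i => toBar n r s m l (om n r s i) ⊗ₜ[K] 1)
      (extendZero fun i => 1 ⊗ₜ[K] toBar n r s m l (e n r s i)) where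
  x_serre := by
    have := (isSerre_toBar_e (n := n) (r := r) (s := s) m l).map
      (Algebra.TensorProduct.includeLeft (R := K) (S := K) (B := Bar n r s m l))
    simpa only [map_extendZero, Algebra.TensorProduct.includeLeft_apply] using this
  y_serre := by
    have := (isSerre_toBar_e (n := n) (r := r) (s := s) m l).map
      (Algebra.TensorProduct.includeRight (R := K) (A := Bar n r s m l))
    simpa only [map_extendZero, Algebra.TensorProduct.includeRight_apply] using this
  gx := extendZero_qcomm fun i j => by
    simp [QComm, ← map_mul, om_e, TensorProduct.smul_tmul']
  gg := extendZero_commute fun i j => by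
    simp [← map_mul, toral_comm (r := r) (s := s) (.om i) (.om j) trivial trivial]
  gy := extendZero_commute fun i j => by simp
  xy := extendZero_commute fun i j => by simp

lemma isDouble_f (m l : ℕ) :
    IsDouble (R := Bar n r s m l ⊗[K] Bar n r s m l) s⁻¹ r⁻¹
      (extendZero fun i => 1 ⊗ₜ[K] toBar n r s m l (f n r s i))
      (extendZero fun i => 1 ⊗ₜ[K] toBar n r s m l (om' n r s i))
      (extendZero fun i => toBar n r s m l (f n r s i) ⊗ₜ[K] 1) where
  x_serre := by
    have := (isSerre_toBar_f (n := n) (r := r) (s := s) m l).map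
      (Algebra.TensorProduct.includeRight (R := K) (A := Bar n r s m l))
    simpa only [map_extendZero, Algebra.TensorProduct.includeRight_apply] using this
  y_serre := by
    have := (isSerre_toBar_f (n := n) (r := r) (s := s) m l).map
      (Algebra.TensorProduct.includeLeft (R := K) (S := K) (B := Bar n r s m l))
    simpa only [map_extendZero, Algebra.TensorProduct.includeLeft_apply] using this
  gx := extendZero_qcomm fun i j => by
    simp [QComm, ← map_mul, om'_f, chi_inv_inv]
  gg := extendZero_commute fun i j => by
    simp [← map_mul, toral_comm (r := r) (s := s) (.om' i) (.om' j) trivial trivial]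
  gy := extendZero_commute fun i j => by simp
  xy := extendZero_commute fun i j => by simp

variable (n r s)

/-- The composite of the coproduct with the projection to `Bar ⊗ Bar`. -/
def comulToBar (m l : ℕ) : U n r s →ₐ[K] Bar n r s m l ⊗[K] Bar n r s m l :=
  (Algebra.TensorProduct.map (toBar n r s m l) (toBar n r s m l)).comp (comul n r s)

lemma comulToBar_e (m l i : ℕ) :
    comulToBar n r s m l (extendZero (e n r s) i) =
      extendZero (fun i => toBar n r s m l (e n r s i) ⊗ₜ[K] (1 : Bar n r s m l)) i +
        extendZero (fun i => toBar n r s m l (om n r s i) ⊗ₜ[K] (1 : Bar n r s m l)) i *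
          extendZero (fun i => (1 : Bar n r s m l) ⊗ₜ[K] toBar n r s m l (e n r s i)) i := by
  rw [map_extendZero]
  unfold extendZero
  split_ifs <;> simp [comulToBar, comul_gen, comulGen]

lemma comulToBar_f (m l i : ℕ) :
    comulToBar n r s m l (extendZero (f n r s) i) =
      extendZero (fun i => (1 : Bar n r s m l) ⊗ₜ[K] toBar n r s m l (f n r s i)) i +
        extendZero (fun i => (1 : Bar n r s m l) ⊗ₜ[K] toBar n r s m l (om' n r s i)) i *
          extendZero (fun i => toBar n r s m l (f n r s i) ⊗ₜ[K] (1 : Bar n r s m l)) i := by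
  rw [map_extendZero]
  unfold extendZero
  split_ifs <;> simp [comulToBar, comul_gen, comulGen]

variable {n r s}

lemma comulToBar_rel {m l : ℕ} (hm : 0 < m) (hq : IsPrimitiveRoot ((r : K) * (s : K)⁻¹) m)
    ⦃x y : U n r s⦄ (h : BarRel n r s m l x y) :
    comulToBar n r s m l x = comulToBar n r s m l y := by
  cases h with
  | pow_e j k =>
    have h0 (j k) : root r (extendZero fun i => toBar n r s m l (e n r s i)) j k ^ m = 0 := by
      simpa only [map_pow, map_root, map_extendZero, map_zero] using
        toBar_rel (BarRel.pow_e (n := n) (r := r) (s := s) (m := m) (l := l) j k)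
    simp only [map_pow, map_root, map_zero, comulToBar_e]
    refine (isDouble_e m l).root_add_pow hm hq (fun j k => ?_) (fun j k => ?_) j k
    · simpa only [map_pow, map_root, map_extendZero, map_zero,
        Algebra.TensorProduct.includeLeft_apply] using congrArg
        (Algebra.TensorProduct.includeLeft (R := K) (S := K) (B := Bar n r s m l)) (h0 j k)
    · simpa only [map_pow, map_root, map_extendZero, map_zero,
        Algebra.TensorProduct.includeRight_apply] using congrArg
        (Algebra.TensorProduct.includeRight (R := K) (A := Bar n r s m l)) (h0 j k)
  | pow_f j k =>
    have h0 (j k) : root s⁻¹ (extendZero fun i => toBar n r s m l (f n r s i)) j k ^ m = 0 := by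
      simpa only [map_pow, map_root, map_extendZero, map_zero] using
        toBar_rel (BarRel.pow_f (n := n) (r := r) (s := s) (m := m) (l := l) j k)
    have hq' : IsPrimitiveRoot (((s⁻¹ : Kˣ) : K) * ((r⁻¹ : Kˣ) : K)⁻¹) m := by
      simpa [mul_comm] using hq
    simp only [map_pow, map_root, map_zero, comulToBar_f]
    refine (isDouble_f m l).root_add_pow hm hq' (fun j k => ?_) (fun j k => ?_) j k
    · simpa only [map_pow, map_root, map_extendZero, map_zero,
        Algebra.TensorProduct.includeRight_apply] using congrArg
        (Algebra.TensorProduct.includeRight (R := K) (A := Bar n r s m l)) (h0 j k)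
    · simpa only [map_pow, map_root, map_extendZero, map_zero,
        Algebra.TensorProduct.includeLeft_apply] using congrArg
        (Algebra.TensorProduct.includeLeft (R := K) (S := K) (B := Bar n r s m l)) (h0 j k)
  | mid_e i =>
    simp only [map_mul, map_root, comulToBar_e]
    exact (isDouble_e m l).add_mid i
  | mid_f i =>
    simp only [map_mul, map_root, comulToBar_f]
    exact (isDouble_f m l).add_mid i
  | om i =>
    have := toBar_rel (BarRel.om (r := r) (s := s) (m := m) (l := l) i)
    simp only [map_pow, map_one] at this
    simp [comulToBar, comul_gen, comulGen, this, Algebra.TensorProduct.one_def]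
  | om' i =>
    have := toBar_rel (BarRel.om' (r := r) (s := s) (m := m) (l := l) i)
    simp only [map_pow, map_one] at this
    simp [comulToBar, comul_gen, comulGen, this, Algebra.TensorProduct.one_def]

/-- The coproduct descends to `Bar`. -/
lemma exists_comulBar {m l : ℕ} (hm : 0 < m) (hq : IsPrimitiveRoot ((r : K) * (s : K)⁻¹) m) :
    ∃ D : Bar n r s m l →ₐ[K] Bar n r s m l ⊗[K] Bar n r s m l, ∀ x,
      D (toBar n r s m l x) =
        Algebra.TensorProduct.map (toBar n r s m l) (toBar n r s m l) (comul n r s x) :=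
  ⟨RingQuot.liftAlgHom K ⟨comulToBar n r s m l, comulToBar_rel hm hq⟩, fun x =>
    RingQuot.liftAlgHom_mkAlgHom_apply K _ _ x⟩

lemma toBar_eq_zero {m l : ℕ} (hml : m ∣ l) (hl : 0 < l) {x : U n r s}
    (hx : x ∈ idealI n r s l) : toBar n r s m l x = 0 := by
  have : idealI n r s l ≤ TwoSidedIdeal.ker (toBar n r s m l) := by
    refine TwoSidedIdeal.span_le.2 ?_
    obtain ⟨t, rfl⟩ := hml
    have ht : t ≠ 0 := by rintro rfl; simp at hl
    rintro _ (((⟨j, k, h, rfl⟩ | ⟨j, k, h, rfl⟩) | ⟨i, rfl⟩) | ⟨i, rfl⟩) <;>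
      rw [SetLike.mem_coe, TwoSidedIdeal.mem_ker]
    · rw [rootE_eq, pow_mul, map_pow, toBar_rel (.pow_e j k), map_zero, zero_pow ht]
    · rw [rootF_eq, pow_mul, map_pow, toBar_rel (.pow_f j k), map_zero, zero_pow ht]
    · simpa [sub_eq_zero] using toBar_rel (BarRel.om (r := r) (s := s) i)
    · simpa [sub_eq_zero] using toBar_rel (BarRel.om' (r := r) (s := s) i)
  exact (TwoSidedIdeal.mem_ker _).1 (this hx)

end Quotient

section Representations

/-! ### Characters and the vector representation -/

variable {K : Type*} [Field K] {n : ℕ}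

/-- The values on generators of the character of `U_{r,s}(sl_n)` that kills all `e_i`, `f_i` and
maps both `ω_i` and `ω_i'` to `c_i`. -/
def charGen (c : Fin (n - 1) → Kˣ) : Gen n → K
  | .e _ => 0
  | .f _ => 0
  | .om i => c i
  | .omInv i => ((c i)⁻¹ : Kˣ)
  | .om' i => c i
  | .om'Inv i => ((c i)⁻¹ : Kˣ)

lemma char_rel {r s : Kˣ} (c : Fin (n - 1) → Kˣ) ⦃x y : FreeAlgebra K (Gen n)⦄ (h : Rel r s x y) :
    FreeAlgebra.lift K (charGen c) x = FreeAlgebra.lift K (charGen c) y := by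
  cases h with
  | toral_comm g h hg hh => simp [mul_comm]
  | _ => simp [charGen]

/-- The character of `U_{r,s}(sl_n)` that kills all `e_i`, `f_i` and maps both `ω_i` and `ω_i'` to
`c_i`. -/
def char (r s : Kˣ) (c : Fin (n - 1) → Kˣ) : U n r s →ₐ[K] K :=
  RingQuot.liftAlgHom K ⟨FreeAlgebra.lift K (charGen c), char_rel c⟩

lemma char_gen {r s : Kˣ} (c : Fin (n - 1) → Kˣ) (g : Gen n) :
    char r s c (gen n r s g) = charGen c g := by
  simp [char, gen]

lemma char_one (r s : Kˣ) : char (n := n) r s 1 = counit n r s := by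
  refine RingQuot.ringQuot_ext' _ _ _ (FreeAlgebra.hom_ext (funext fun g => ?_))
  have h1 := char_gen (r := r) (s := s) 1 g
  have h2 := counit_gen n r s g
  simp only [gen] at h1 h2
  simp only [Function.comp_apply, AlgHom.comp_apply, h1, h2]
  cases g <;> simp [charGen, counitGen]

/-- The value of `ω_i` on the `a`-th basis vector of the vector representation. -/
def vecWeight (r s : Kˣ) (i a : ℕ) : Kˣ := if a = i then r else if a = i + 1 then s else 1

lemma vecWeight_div (r s : Kˣ) (i j : ℕ) :
    vecWeight r s i j * (vecWeight r s i (j + 1))⁻¹ = chi r s i j := by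
  simp only [chi, vecWeight, epsAlpha]
  split_ifs <;> first | omega | simp

lemma chi'_eq_chi (r s : Kˣ) (i j : ℕ) : chi' r s i j = chi s r i j := by
  rw [chi, chi', mul_comm]

/-- The values on generators of the vector representation, twisted by the automorphism
`ω_i ↦ c_i ω_i`, `ω_i' ↦ c_i ω_i'`, `f_i ↦ c_i f_i`. -/
def vecGen (r s : Kˣ) (c : Fin (n - 1) → Kˣ) :
    Gen n → Matrix (Fin (n - 1 + 1)) (Fin (n - 1 + 1)) K
  | .e i => Matrix.single i.castSucc i.succ 1
  | .f i => Matrix.single i.succ i.castSucc (c i : K)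
  | .om i => Matrix.diagonal fun a => ((c i * vecWeight r s i a : Kˣ) : K)
  | .omInv i => Matrix.diagonal fun a => (((c i * vecWeight r s i a)⁻¹ : Kˣ) : K)
  | .om' i => Matrix.diagonal fun a => ((c i * vecWeight s r i a : Kˣ) : K)
  | .om'Inv i => Matrix.diagonal fun a => (((c i * vecWeight s r i a)⁻¹ : Kˣ) : K)

/-- `M` has no nonzero entry outside position `(p, q)`. -/
def SupportedAt {N : ℕ} (M : Matrix (Fin N) (Fin N) K) (p q : ℕ) : Prop :=
  ∀ a b, M a b ≠ 0 → (a : ℕ) = p ∧ (b : ℕ) = q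

namespace SupportedAt

variable {N : ℕ} {M M' : Matrix (Fin N) (Fin N) K} {p q p' q' : ℕ}

lemma mul (h : SupportedAt M p q) (h' : SupportedAt M' q q') : SupportedAt (M * M') p q' := by
  intro a b hab
  rw [Matrix.mul_apply] at hab
  obtain ⟨k, -, hk⟩ := Finset.exists_ne_zero_of_sum_ne_zero hab
  exact ⟨(h a k (left_ne_zero_of_mul hk)).1, (h' k b (right_ne_zero_of_mul hk)).2⟩

lemma mul_eq_zero (h : SupportedAt M p q) (h' : SupportedAt M' p' q') (hne : q ≠ p') :
    M * M' = 0 := by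
  ext a b
  rw [Matrix.mul_apply]
  refine Finset.sum_eq_zero fun k _ => ?_
  by_contra hk
  exact hne ((h a k (left_ne_zero_of_mul hk)).2.symm.trans (h' k b (right_ne_zero_of_mul hk)).1)

lemma smul (h : SupportedAt M p q) (c : K) : SupportedAt (c • M) p q :=
  fun a b hab => h a b (right_ne_zero_of_mul hab)

lemma sub (h : SupportedAt M p q) (h' : SupportedAt M' p q) : SupportedAt (M - M') p q := by
  intro a b hab
  by_cases h0 : M a b = 0
  · exact h' a b fun h1 => hab (by simp [h0, h1])
  · exact h a b h0

lemma zero : SupportedAt (0 : Matrix (Fin N) (Fin N) K) p q := fun _ _ h => (h rfl).elim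

lemma single {a b : Fin N} (c : K) : SupportedAt (Matrix.single a b c) a b := by
  intro i j hij
  rw [Matrix.single_apply] at hij
  have := (ite_ne_right_iff.1 hij).1
  simp [this.1, this.2]

lemma pow_eq_zero (h : SupportedAt M p q) (hne : q ≠ p) {m : ℕ} (hm : 2 ≤ m) : M ^ m = 0 := by
  obtain ⟨t, rfl⟩ := Nat.exists_eq_add_of_le hm
  rw [pow_add, pow_two, h.mul_eq_zero h hne, zero_mul]

/-- Root vectors built from the matrix units above the diagonal. -/
lemma root {r : Kˣ} {x : ℕ → Matrix (Fin N) (Fin N) K} (hx : ∀ i, SupportedAt (x i) i (i + 1))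
    (j k : ℕ) : SupportedAt (root r x j k) j (j + k + 1) := by
  induction k with
  | zero => exact hx j
  | succ k ih =>
    rw [TwoParam.root, (hx _).mul_eq_zero ih (by omega)]
    exact zero.sub ((ih.mul (hx _)).smul _)

/-- Root vectors built from the matrix units below the diagonal. -/
lemma root' {r : Kˣ} {x : ℕ → Matrix (Fin N) (Fin N) K} (hx : ∀ i, SupportedAt (x i) (i + 1) i)
    (j k : ℕ) : SupportedAt (TwoParam.root r x j k) (j + k + 1) j := by
  induction k with
  | zero => exact hx j
  | succ k ih =>
    rw [TwoParam.root, ih.mul_eq_zero (hx _) (by omega)]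
    exact ((hx _).mul ih).sub (zero.smul _)

end SupportedAt

lemma vecGen_e (r s : Kˣ) (c : Fin (n - 1) → Kˣ) (i : Fin (n - 1)) :
    SupportedAt (vecGen r s c (.e i)) i (i + 1) := SupportedAt.single _

lemma vecGen_f (r s : Kˣ) (c : Fin (n - 1) → Kˣ) (i : Fin (n - 1)) :
    SupportedAt (vecGen r s c (.f i)) (i + 1) i := SupportedAt.single _

lemma diagonal_mul_supportedAt {N : ℕ} {M : Matrix (Fin N) (Fin N) K} {p q : ℕ}
    (h : SupportedAt M p q) {d : ℕ → K} {c : K} (hc : d p = c * d q) :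
    Matrix.diagonal (fun a : Fin N => d a) * M =
      c • (M * Matrix.diagonal fun a : Fin N => d a) := by
  ext a b
  rw [Matrix.diagonal_mul, Matrix.smul_apply, Matrix.mul_diagonal, smul_eq_mul]
  by_cases h0 : M a b = 0
  · simp [h0]
  · rw [(h a b h0).1, (h a b h0).2, hc]
    ring

lemma vec_rel {r s : Kˣ} (hrs : r ≠ s) (c : Fin (n - 1) → Kˣ) ⦃x y : FreeAlgebra K (Gen n)⦄
    (h : Rel r s x y) :
    FreeAlgebra.lift K (vecGen r s c) x = FreeAlgebra.lift K (vecGen r s c) y := by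
  have hE := vecGen_e r s c
  have hF := vecGen_f r s c
  have hW (r s : Kˣ) (d : Kˣ) (i j : ℕ) :
      ((d * vecWeight r s i j : Kˣ) : K) = chi r s i j * (d * vecWeight r s i (j + 1) : Kˣ) := by
    rw [← vecWeight_div, ← Units.val_mul, mul_comm d, mul_comm d, mul_assoc, inv_mul_cancel_left]
  have hW' (r s : Kˣ) (d : Kˣ) (i j : ℕ) :
      ((d * vecWeight r s i (j + 1) : Kˣ) : K) =
        ((chi r s i j)⁻¹ : Kˣ) * (d * vecWeight r s i j : Kˣ) := by
    rw [hW r s d i j, ← mul_assoc, ← Units.val_mul, inv_mul_cancel, Units.val_one, one_mul]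
  cases h with
  | toral_comm g h hg hh =>
    simp only [map_mul, FreeAlgebra.lift_ι_apply]
    cases g <;> cases h <;>
      first | exact hg.elim | exact hh.elim | simp [vecGen, mul_comm]
  | om_inv i =>
    simp only [map_mul, map_one, FreeAlgebra.lift_ι_apply, vecGen, Matrix.diagonal_mul_diagonal,
      Units.mul_inv, Matrix.diagonal_one]
  | om'_inv i =>
    simp only [map_mul, map_one, FreeAlgebra.lift_ι_apply, vecGen, Matrix.diagonal_mul_diagonal,
      Units.mul_inv, Matrix.diagonal_one]
  | om_e i j =>
    simp only [map_mul, map_smul, FreeAlgebra.lift_ι_apply]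
    exact diagonal_mul_supportedAt (hE j) (d := fun a => ((c i * vecWeight r s i a : Kˣ) : K))
      (hW r s (c i) i j)
  | om_f i j =>
    simp only [map_mul, map_smul, FreeAlgebra.lift_ι_apply]
    exact diagonal_mul_supportedAt (hF j) (d := fun a => ((c i * vecWeight r s i a : Kˣ) : K))
      (hW' r s (c i) i j)
  | om'_e i j =>
    simp only [map_mul, map_smul, FreeAlgebra.lift_ι_apply, chi'_eq_chi]
    exact diagonal_mul_supportedAt (hE j) (d := fun a => ((c i * vecWeight s r i a : Kˣ) : K))
      (hW s r (c i) i j)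
  | om'_f i j =>
    simp only [map_mul, map_smul, FreeAlgebra.lift_ι_apply, chi'_eq_chi]
    exact diagonal_mul_supportedAt (hF j) (d := fun a => ((c i * vecWeight s r i a : Kˣ) : K))
      (hW' s r (c i) i j)
  | e_f_same i =>
    have hrs' : (r : K) - s ≠ 0 := sub_ne_zero.2 fun h => hrs (Units.ext h)
    simp only [map_mul, map_sub, map_smul, FreeAlgebra.lift_ι_apply, vecGen,
      Matrix.single_mul_single_same]
    ext a b
    simp only [Matrix.sub_apply, Matrix.smul_apply, Matrix.single_apply, Matrix.diagonal_apply,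
      vecWeight, Fin.ext_iff, Fin.val_castSucc, Fin.val_succ, smul_eq_mul, Units.val_mul]
    split_ifs <;> first | omega | (simp; done) | skip
    all_goals
      simp only [one_mul, mul_one, sub_zero, zero_sub]
      field_simp
      try ring
  | e_f_ne i j hij =>
    simp only [map_mul, map_sub, map_zero, FreeAlgebra.lift_ι_apply]
    have hij' : (i : ℕ) ≠ j := fun h => hij (Fin.ext h)
    rw [(hE i).mul_eq_zero (hF j) (by omega), (hF j).mul_eq_zero (hE i) (by omega), sub_zero]
  | e_comm i j hij =>
    simp only [map_mul, map_sub, map_zero, FreeAlgebra.lift_ι_apply]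
    rw [(hE i).mul_eq_zero (hE j) (by omega), (hE j).mul_eq_zero (hE i) (by omega), sub_zero]
  | f_comm i j hij =>
    simp only [map_mul, map_sub, map_zero, FreeAlgebra.lift_ι_apply]
    rw [(hF i).mul_eq_zero (hF j) (by omega), (hF j).mul_eq_zero (hF i) (by omega), sub_zero]
  | e_serre₁ i j hij =>
    simp only [map_mul, map_sub, map_add, map_smul, map_pow, map_zero, FreeAlgebra.lift_ι_apply]
    rw [(hE i).pow_eq_zero (by omega) le_rfl, mul_assoc, (hE j).mul_eq_zero (hE i) (by omega)]
    simp
  | e_serre₂ i j hij =>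
    simp only [map_mul, map_sub, map_add, map_smul, map_pow, map_zero, FreeAlgebra.lift_ι_apply]
    rw [(hE j).pow_eq_zero (by omega) le_rfl, (hE j).mul_eq_zero (hE i) (by omega)]
    simp
  | f_serre₁ i j hij =>
    simp only [map_mul, map_sub, map_add, map_smul, map_pow, map_zero, FreeAlgebra.lift_ι_apply]
    rw [(hF i).pow_eq_zero (by omega) le_rfl, (hF i).mul_eq_zero (hF j) (by omega)]
    simp
  | f_serre₂ i j hij =>
    simp only [map_mul, map_sub, map_add, map_smul, map_pow, map_zero, FreeAlgebra.lift_ι_apply]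
    rw [(hF j).pow_eq_zero (by omega) le_rfl, mul_assoc, (hF i).mul_eq_zero (hF j) (by omega)]
    simp

/-- The twisted vector representation of `U_{r,s}(sl_n)`. -/
def vec {r s : Kˣ} (hrs : r ≠ s) (c : Fin (n - 1) → Kˣ) :
    U n r s →ₐ[K] Matrix (Fin (n - 1 + 1)) (Fin (n - 1 + 1)) K :=
  RingQuot.liftAlgHom K ⟨FreeAlgebra.lift K (vecGen r s c), vec_rel hrs c⟩

lemma vec_gen {r s : Kˣ} (hrs : r ≠ s) (c : Fin (n - 1) → Kˣ) (g : Gen n) :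
    vec hrs c (gen n r s g) = vecGen r s c g := by
  simp [vec, gen]

lemma exists_comp_toBar {R : Type*} [Ring R] [Algebra K R] {r s : Kˣ} {m l : ℕ}
    (φ : U n r s →ₐ[K] R) (h : ∀ ⦃x y⦄, BarRel n r s m l x y → φ x = φ y) :
    ∃ ψ : Bar n r s m l →ₐ[K] R, ∀ x, ψ (toBar n r s m l x) = φ x :=
  ⟨RingQuot.liftAlgHom K ⟨φ, h⟩, fun x => RingQuot.liftAlgHom_mkAlgHom_apply K _ _ x⟩

/-- Characters whose values are `l`-th roots of unity factor through `Bar`. -/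
lemma exists_charBar {r s : Kˣ} {m l : ℕ} (hm : 0 < m) {c : Fin (n - 1) → Kˣ}
    (hc : ∀ i, c i ^ l = 1) :
    ∃ ψ : Bar n r s m l →ₐ[K] K, ∀ x, ψ (toBar n r s m l x) = char r s c x := by
  have hc' (i) : (c i : K) ^ l = 1 := by rw [← Units.val_pow_eq_pow_val, hc, Units.val_one]
  have hE (i) : char r s c (extendZero (e n r s) i) = 0 := by
    rw [map_extendZero]
    simp [extendZero, char_gen, charGen]
  have hF (i) : char r s c (extendZero (f n r s) i) = 0 := by
    rw [map_extendZero]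
    simp [extendZero, char_gen, charGen]
  refine exists_comp_toBar _ fun x y h => ?_
  cases h with
  | pow_e j k => rw [map_pow, map_root, root_eq_zero (hE _), zero_pow hm.ne', map_zero]
  | pow_f j k => rw [map_pow, map_root, root_eq_zero (hF _), zero_pow hm.ne', map_zero]
  | mid_e i => simp [hE]
  | mid_f i => simp [hF]
  | om i => simp [char_gen, charGen, hc']
  | om' i => simp [char_gen, charGen, hc']

/-- Vector representations twisted by `l`-th roots of unity factor through `Bar`. -/
lemma exists_vecBar {r s : Kˣ} (hrs : r ≠ s) {m l : ℕ} (hm : 2 ≤ m) (hr : r ^ l = 1)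
    (hs : s ^ l = 1) {c : Fin (n - 1) → Kˣ} (hc : ∀ i, c i ^ l = 1) :
    ∃ ψ : Bar n r s m l →ₐ[K] Matrix (Fin (n - 1 + 1)) (Fin (n - 1 + 1)) K,
      ∀ x, ψ (toBar n r s m l x) = vec hrs c x := by
  have hE (i) : SupportedAt (vec hrs c (extendZero (e n r s) i)) i (i + 1) := by
    rw [map_extendZero]
    unfold extendZero
    split_ifs with h
    · beta_reduce
      rw [vec_gen]
      exact vecGen_e r s c ⟨i, h⟩
    · exact .zero
  have hF (i) : SupportedAt (vec hrs c (extendZero (f n r s) i)) (i + 1) i := by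
    rw [map_extendZero]
    unfold extendZero
    split_ifs with h
    · beta_reduce
      rw [vec_gen]
      exact vecGen_f r s c ⟨i, h⟩
    · exact .zero
  have hw (r s : Kˣ) (hr : r ^ l = 1) (hs : s ^ l = 1) (i : Fin (n - 1)) :
      Matrix.diagonal (fun a : Fin (n - 1 + 1) => ((c i * vecWeight r s i a : Kˣ) : K)) ^ l
        = 1 := by
    rw [Matrix.diagonal_pow, ← Matrix.diagonal_one]
    congr 1
    ext a
    rw [Pi.pow_apply, ← Units.val_pow_eq_pow_val, mul_pow, hc, one_mul, vecWeight]
    split_ifs <;> simp [hr, hs]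
  refine exists_comp_toBar _ fun x y h => ?_
  cases h with
  | pow_e j k =>
    rw [map_pow, map_root, (SupportedAt.root hE j k).pow_eq_zero (by omega) hm, map_zero]
  | pow_f j k =>
    rw [map_pow, map_root, (SupportedAt.root' hF j k).pow_eq_zero (by omega) hm, map_zero]
  | mid_e i =>
    rw [map_mul, map_mul, map_root, (hE _).mul_eq_zero (SupportedAt.root hE i 2) (by omega),
      (SupportedAt.root hE i 2).mul_eq_zero (hE _) (by omega)]
  | mid_f i =>
    rw [map_mul, map_mul, map_root, (hF _).mul_eq_zero (SupportedAt.root' hF i 2) (by omega),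
      (SupportedAt.root' hF i 2).mul_eq_zero (hF _) (by omega)]
  | om i =>
    rw [map_pow, vec_gen, map_one]
    exact hw r s hr hs i
  | om' i =>
    rw [map_pow, vec_gen, map_one]
    exact hw s r hs hr i

end Representations

section Functionals

variable {K : Type*} [Field K] {n : ℕ} {r s : Kˣ}

/-! ### The functionals defined by the generators -/

/-- A twisted derivation on an algebra generated by elements `a_i` and invertible elements `g_i`
vanishes if it vanishes on the `a_i` and `g_i`. -/
lemma skew_ext {A ι : Type*} [Ring A] [Algebra K A] {a g g' : ι → A} (hg : ∀ i, g i * g' i = 1)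
    {S : Subalgebra K A} (hS : S = Algebra.adjoin K (Set.range a ∪ Set.range g ∪ Set.range g'))
    {D : S →ₗ[K] K} (ε ψ : S →ₐ[K] K) (hD : ∀ x y, D (x * y) = D x * ε y + ψ x * D y)
    (ha : ∀ i (h : a i ∈ S), D ⟨a i, h⟩ = 0) (hg0 : ∀ i (h : g i ∈ S), D ⟨g i, h⟩ = 0) (x : S) :
    D x = 0 := by
  subst hS
  have h1 : D 1 = 0 := by simpa using hD 1 1
  obtain ⟨x, hx⟩ := x
  refine Algebra.adjoin_induction (p := fun x hx => D ⟨x, hx⟩ = 0) ?_ ?_ ?_ ?_ hx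
  · rintro _ ((⟨i, rfl⟩ | ⟨i, rfl⟩) | ⟨i, rfl⟩)
    · exact ha i _
    · exact hg0 i _
    · have m1 := Algebra.subset_adjoin (R := K) (s := Set.range a ∪ Set.range g ∪ Set.range g')
        (.inl (.inr ⟨i, rfl⟩))
      have m2 := Algebra.subset_adjoin (R := K) (s := Set.range a ∪ Set.range g ∪ Set.range g')
        (.inr ⟨i, rfl⟩)
      have h2 : (⟨g i, m1⟩ : Algebra.adjoin K (Set.range a ∪ Set.range g ∪ Set.range g')) *
          ⟨g' i, m2⟩ = 1 := Subtype.ext (hg i)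
      have h3 := hD ⟨g i, m1⟩ ⟨g' i, m2⟩
      rw [h2, h1, hg0, zero_mul, zero_add, eq_comm, mul_eq_zero] at h3
      refine h3.resolve_left fun h4 => ?_
      have h5 := congrArg ψ h2
      rw [map_mul, h4, zero_mul, map_one] at h5
      exact zero_ne_one h5
  · intro c
    have : (⟨algebraMap K A c, Subalgebra.algebraMap_mem _ c⟩ :
        Algebra.adjoin K (Set.range a ∪ Set.range g ∪ Set.range g')) = c • 1 :=
      Subtype.ext (Algebra.algebraMap_eq_smul_one c)
    rw [this, map_smul, h1, smul_zero]
  · intro x y hx hy h h'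
    simpa [h, h'] using map_add D ⟨x, hx⟩ ⟨y, hy⟩
  · intro x y hx hy h h'
    simpa [h, h'] using hD ⟨x, hx⟩ ⟨y, hy⟩

lemma matrix_mul_two {N : ℕ} {M M' : Matrix (Fin N) (Fin N) K} {p q : Fin N} (hpq : p ≠ q)
    (h : ∀ k, k ≠ p → k ≠ q → M p k * M' k q = 0) :
    (M * M') p q = M p q * M' q q + M p p * M' p q := by
  rw [Matrix.mul_apply, add_comm]
  exact Finset.sum_eq_add p q hpq (fun k _ hk => h k hk.1 hk.2) (by simp) (by simp)

lemma matrix_mul_one {N : ℕ} {M M' : Matrix (Fin N) (Fin N) K} {p : Fin N}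
    (h : ∀ k, k ≠ p → M p k * M' k p = 0) : (M * M') p p = M p p * M' p p := by
  rw [Matrix.mul_apply]
  exact Finset.sum_eq_single p (fun k _ hk => h k hk) (by simp)

/-- On `U^{≥0}` the vector representation is upper triangular. -/
lemma vec_Uge (hrs : r ≠ s) (c : Fin (n - 1) → Kˣ) {x : U n r s} (hx : x ∈ Uge n r s) :
    (∀ a b, b < a → vec hrs c x a b = 0) ∧
      ∀ a, vec hrs c x a a = char r s (fun j => c j * vecWeight r s j a) x := by
  refine Algebra.adjoin_induction (p := fun x _ => (∀ a b, b < a → vec hrs c x a b = 0) ∧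
      ∀ a, vec hrs c x a a = char r s (fun j => c j * vecWeight r s j a) x) ?_ ?_ ?_ ?_ hx
  · rintro _ ((⟨i, rfl⟩ | ⟨i, rfl⟩) | ⟨i, rfl⟩) <;> simp only [vec_gen, char_gen, charGen]
    · have key (a b : Fin (n - 1 + 1)) (h : b ≤ a) : vecGen r s c (.e i) a b = 0 := by
        by_contra h0
        have := vecGen_e r s c i a b h0
        rw [Fin.le_def] at h
        omega
      exact ⟨fun a b h => key a b h.le, fun a => key a a le_rfl⟩
    · exact ⟨fun a b h => Matrix.diagonal_apply_ne _ h.ne', fun a => Matrix.diagonal_apply_eq _ a⟩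
    · exact ⟨fun a b h => Matrix.diagonal_apply_ne _ h.ne', fun a => Matrix.diagonal_apply_eq _ a⟩
  · intro k
    simp only [AlgHom.commutes]
    exact ⟨fun a b h => by simp [Matrix.algebraMap_matrix_apply, h.ne'], fun a => by
      simp [Matrix.algebraMap_matrix_apply]⟩
  · intro x y _ _ h h'
    simp only [map_add, Matrix.add_apply]
    exact ⟨fun a b hab => by rw [h.1 a b hab, h'.1 a b hab, add_zero],
      fun a => by rw [h.2, h'.2]⟩
  · intro x y _ _ h h'
    simp only [map_mul]
    refine ⟨fun a b hab => ?_, fun a => ?_⟩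
    · rw [Matrix.mul_apply]
      refine Finset.sum_eq_zero fun k _ => ?_
      rcases lt_or_ge k a with hk | hk
      · rw [h.1 a k hk, zero_mul]
      · rw [h'.1 k b (hab.trans_le hk), mul_zero]
    · rw [matrix_mul_one, h.2, h'.2]
      intro k hk
      rcases lt_or_gt_of_ne hk with hk | hk
      · rw [h.1 a k hk, zero_mul]
      · rw [h'.1 k a hk, mul_zero]

/-- On `U^{≤0}` the vector representation is lower triangular. -/
lemma vec_Ule (hrs : r ≠ s) (c : Fin (n - 1) → Kˣ) {x : U n r s} (hx : x ∈ Ule n r s) :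
    (∀ a b, a < b → vec hrs c x a b = 0) ∧
      ∀ a, vec hrs c x a a = char r s (fun j => c j * vecWeight s r j a) x := by
  refine Algebra.adjoin_induction (p := fun x _ => (∀ a b, a < b → vec hrs c x a b = 0) ∧
      ∀ a, vec hrs c x a a = char r s (fun j => c j * vecWeight s r j a) x) ?_ ?_ ?_ ?_ hx
  · rintro _ ((⟨i, rfl⟩ | ⟨i, rfl⟩) | ⟨i, rfl⟩) <;> simp only [vec_gen, char_gen, charGen]
    · have key (a b : Fin (n - 1 + 1)) (h : a ≤ b) : vecGen r s c (.f i) a b = 0 := by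
        by_contra h0
        have := vecGen_f r s c i a b h0
        rw [Fin.le_def] at h
        omega
      exact ⟨fun a b h => key a b h.le, fun a => key a a le_rfl⟩
    · exact ⟨fun a b h => Matrix.diagonal_apply_ne _ h.ne, fun a => Matrix.diagonal_apply_eq _ a⟩
    · exact ⟨fun a b h => Matrix.diagonal_apply_ne _ h.ne, fun a => Matrix.diagonal_apply_eq _ a⟩
  · intro k
    simp only [AlgHom.commutes]
    exact ⟨fun a b h => by simp [Matrix.algebraMap_matrix_apply, h.ne], fun a => by
      simp [Matrix.algebraMap_matrix_apply]⟩
  · intro x y _ _ h h'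
    simp only [map_add, Matrix.add_apply]
    exact ⟨fun a b hab => by rw [h.1 a b hab, h'.1 a b hab, add_zero],
      fun a => by rw [h.2, h'.2]⟩
  · intro x y _ _ h h'
    simp only [map_mul]
    refine ⟨fun a b hab => ?_, fun a => ?_⟩
    · rw [Matrix.mul_apply]
      refine Finset.sum_eq_zero fun k _ => ?_
      rcases lt_or_ge a k with hk | hk
      · rw [h.1 a k hk, zero_mul]
      · rw [h'.1 k b (hk.trans_lt hab), mul_zero]
    · rw [matrix_mul_one, h.2, h'.2]
      intro k hk
      rcases lt_or_gt_of_ne hk with hk | hk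
      · rw [h'.1 k a hk, mul_zero]
      · rw [h.1 a k hk, zero_mul]

/-- The functional `(f_i | -)` on `U^{≥0}`, as a matrix coefficient of a twisted vector
representation of `U`. The twist makes every `ω_j` fix the `(i+1)`-st basis vector. -/
def fFun (hrs : r ≠ s) (i : Fin (n - 1)) : U n r s →ₗ[K] K :=
  ((s : K) - r)⁻¹ • (Matrix.entryLinearMap K K i.castSucc i.succ ∘ₗ
    (vec hrs fun j => (vecWeight r s j (i + 1))⁻¹).toLinearMap)

/-- The functional `(- | e_j)` on `U^{≤0}`, as a matrix coefficient of a twisted vector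
representation of `U`. The twist makes every `ω_i'` fix the `j`-th basis vector, and maps `f_j` to
`s⁻¹` times a matrix unit. -/
def eFun (hrs : r ≠ s) (j : Fin (n - 1)) : U n r s →ₗ[K] K :=
  (s * ((s : K) - r)⁻¹) • (Matrix.entryLinearMap K K j.succ j.castSucc ∘ₗ
    (vec hrs fun k => (vecWeight s r k j)⁻¹).toLinearMap)

lemma fFun_apply (hrs : r ≠ s) (i : Fin (n - 1)) (x : U n r s) :
    fFun hrs i x = ((s : K) - r)⁻¹ *
      vec hrs (fun j => (vecWeight r s j (i + 1))⁻¹) x i.castSucc i.succ := rfl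

lemma eFun_apply (hrs : r ≠ s) (i : Fin (n - 1)) (x : U n r s) :
    eFun hrs i x = s * ((s : K) - r)⁻¹ *
      vec hrs (fun k => (vecWeight s r k i)⁻¹) x i.succ i.castSucc := rfl

lemma fFun_mul (hrs : r ≠ s) (i : Fin (n - 1)) {x y : U n r s} (hx : x ∈ Uge n r s)
    (hy : y ∈ Uge n r s) : fFun hrs i (x * y) =
      fFun hrs i x * counit n r s y +
        char r s (fun j : Fin (n - 1) => chi r s j i) x * fFun hrs i y := by
  set c : Fin (n - 1) → Kˣ := fun j => (vecWeight r s j (i + 1))⁻¹ with hc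
  have h1 := (vec_Uge hrs c hx).2 i.castSucc
  have h2 := (vec_Uge hrs c hy).2 i.succ
  have h3 : (fun j => c j * vecWeight r s j i.castSucc) = fun j : Fin (n - 1) => chi r s j i := by
    ext j
    rw [← vecWeight_div, mul_comm]
    rfl
  have h4 : (fun j => c j * vecWeight r s j i.succ) = 1 := by
    ext j
    simp [hc]
  rw [h3] at h1
  rw [h4, char_one] at h2
  rw [fFun_apply, fFun_apply, fFun_apply, map_mul, matrix_mul_two, h1, h2]
  · ring
  · simp [Fin.ext_iff]
  · intro k hk hk'
    rcases lt_or_gt_of_ne hk with h | h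
    · rw [(vec_Uge hrs c hx).1 _ _ h, zero_mul]
    · rw [(vec_Uge hrs c hy).1, mul_zero]
      have h' := Fin.val_ne_of_ne hk'
      simp only [gt_iff_lt, Fin.lt_def, Fin.val_castSucc, Fin.val_succ] at h h' ⊢
      omega

lemma eFun_mul (hrs : r ≠ s) (i : Fin (n - 1)) {x y : U n r s} (hx : x ∈ Ule n r s)
    (hy : y ∈ Ule n r s) : eFun hrs i (x * y) =
      eFun hrs i x * counit n r s y +
        char r s (fun j : Fin (n - 1) => chi r s i j) x * eFun hrs i y := by
  set c : Fin (n - 1) → Kˣ := fun k => (vecWeight s r k i)⁻¹ with hc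
  have h1 := (vec_Ule hrs c hx).2 i.succ
  have h2 := (vec_Ule hrs c hy).2 i.castSucc
  have h3 : (fun j => c j * vecWeight s r j i.succ) = fun j : Fin (n - 1) => chi r s i j := by
    ext j
    rw [← inv_inv (chi r s i j), ← chi'_eq, chi'_eq_chi, ← vecWeight_div, mul_inv, inv_inv]
    rfl
  have h4 : (fun j => c j * vecWeight s r j i.castSucc) = 1 := by
    ext j
    simp [hc]
  rw [h3] at h1
  rw [h4, char_one] at h2
  rw [eFun_apply, eFun_apply, eFun_apply, map_mul, matrix_mul_two, h1, h2]
  · ring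
  · simp [Fin.ext_iff]
  · intro k hk hk'
    rcases lt_or_gt_of_ne hk with h | h
    · rw [(vec_Ule hrs c hy).1, mul_zero]
      have h' := Fin.val_ne_of_ne hk'
      simp only [gt_iff_lt, Fin.lt_def, Fin.val_castSucc, Fin.val_succ] at h h' ⊢
      omega
    · rw [(vec_Ule hrs c hx).1 _ _ h, zero_mul]

lemma fFun_e (hrs : r ≠ s) (i j : Fin (n - 1)) :
    fFun hrs i (e n r s j) = if i = j then ((s : K) - r)⁻¹ else 0 := by
  rw [fFun_apply, vec_gen, vecGen, Matrix.single_apply]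
  simp [Fin.ext_iff, eq_comm]

lemma fFun_om (hrs : r ≠ s) (i j : Fin (n - 1)) : fFun hrs i (om n r s j) = 0 := by
  rw [fFun_apply, vec_gen, vecGen, Matrix.diagonal_apply_ne _ (by simp [Fin.ext_iff]), mul_zero]

lemma eFun_f (hrs : r ≠ s) (i j : Fin (n - 1)) :
    eFun hrs j (f n r s i) = if i = j then ((s : K) - r)⁻¹ else 0 := by
  rw [eFun_apply, vec_gen, vecGen, Matrix.single_apply]
  by_cases h : i = j
  · subst h
    simp [vecWeight]
    field_simp
  · simp [h, Fin.ext_iff, Fin.val_ne_iff]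

lemma eFun_om' (hrs : r ≠ s) (i j : Fin (n - 1)) : eFun hrs j (om' n r s i) = 0 := by
  rw [eFun_apply, vec_gen, vecGen, Matrix.diagonal_apply_ne _ (by simp [Fin.ext_iff]), mul_zero]

/-! ### Coproducts of the generators -/

lemma incl₂_comulGe (x : Uge n r s) : incl₂ (Uge n r s) (comulGe n r s x) = comul n r s x :=
  incl₂_comulRestrict _ _ _ x

lemma incl₂_comulLe (x : Ule n r s) : incl₂ (Ule n r s) (comulLe n r s x) = comul n r s x :=
  incl₂_comulRestrict _ _ _ x

lemma comulGe_e (i : Fin (n - 1)) : comulGe n r s ⟨e n r s i, e_mem n r s i⟩ =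
    ⟨e n r s i, e_mem n r s i⟩ ⊗ₜ 1 +
      ⟨om n r s i, om_mem n r s i⟩ ⊗ₜ ⟨e n r s i, e_mem n r s i⟩ := by
  apply incl₂_injective
  rw [incl₂_comulGe, comul_gen]
  simp [incl₂, comulGen]

lemma comulGe_om (i : Fin (n - 1)) : comulGe n r s ⟨om n r s i, om_mem n r s i⟩ =
    ⟨om n r s i, om_mem n r s i⟩ ⊗ₜ ⟨om n r s i, om_mem n r s i⟩ := by
  apply incl₂_injective
  rw [incl₂_comulGe, comul_gen]
  simp [incl₂, comulGen]

lemma comulGe_omInv (i : Fin (n - 1)) : comulGe n r s ⟨omInv n r s i, omInv_mem n r s i⟩ =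
    ⟨omInv n r s i, omInv_mem n r s i⟩ ⊗ₜ ⟨omInv n r s i, omInv_mem n r s i⟩ := by
  apply incl₂_injective
  rw [incl₂_comulGe, comul_gen]
  simp [incl₂, comulGen]

lemma comulLe_f (i : Fin (n - 1)) : comulLe n r s ⟨f n r s i, f_mem n r s i⟩ =
    1 ⊗ₜ ⟨f n r s i, f_mem n r s i⟩ +
      ⟨f n r s i, f_mem n r s i⟩ ⊗ₜ ⟨om' n r s i, om'_mem n r s i⟩ := by
  apply incl₂_injective
  rw [incl₂_comulLe, comul_gen]
  simp [incl₂, comulGen]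

lemma comulLe_om' (i : Fin (n - 1)) : comulLe n r s ⟨om' n r s i, om'_mem n r s i⟩ =
    ⟨om' n r s i, om'_mem n r s i⟩ ⊗ₜ ⟨om' n r s i, om'_mem n r s i⟩ := by
  apply incl₂_injective
  rw [incl₂_comulLe, comul_gen]
  simp [incl₂, comulGen]

lemma comulLe_om'Inv (i : Fin (n - 1)) : comulLe n r s ⟨om'Inv n r s i, om'Inv_mem n r s i⟩ =
    ⟨om'Inv n r s i, om'Inv_mem n r s i⟩ ⊗ₜ ⟨om'Inv n r s i, om'Inv_mem n r s i⟩ := by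
  apply incl₂_injective
  rw [incl₂_comulLe, comul_gen]
  simp [incl₂, comulGen]

end Functionals

section Pairing

variable {K : Type*} [Field K] {n : ℕ} {r s : Kˣ}

/-! ### Values and radical of a Hopf pairing -/

section Coordinates

/-- A functional on a subalgebra is a multiplicative character if it agrees with one on the
`a_i` and the invertible `g_i` that generate the subalgebra, and is multiplicative. -/
lemma character_ext {A ι : Type*} [Ring A] [Algebra K A] {a g g' : ι → A}
    (hg : ∀ i, g i * g' i = 1) {S : Subalgebra K A}
    (hS : S = Algebra.adjoin K (Set.range a ∪ Set.range g ∪ Set.range g')) {P : S →ₗ[K] K}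
    (χ : A →ₐ[K] K) (h1 : P 1 = 1) (hP : ∀ x y, P (x * y) = P x * P y)
    (ha : ∀ i (h : a i ∈ S), P ⟨a i, h⟩ = χ (a i))
    (hg0 : ∀ i (h : g i ∈ S), P ⟨g i, h⟩ = χ (g i)) (x : S) : P x = χ x := by
  have := skew_ext hg hS (D := P - χ.toLinearMap ∘ₗ S.val.toLinearMap) (χ.comp S.val)
    (AlgHom.ofLinearMap P h1 hP) (fun x y => by simp [hP]; ring)
    (fun i h => by simp [ha]) (fun i h => by simp [hg0]) x
  simpa [sub_eq_zero] using this

variable {p : Ule n r s →ₗ[K] Uge n r s →ₗ[K] K} (hp : IsHopfPairing n r s p)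
include hp

lemma pairing_mul_right_of_groupLike {g : Ule n r s} (hg : comulLe n r s g = g ⊗ₜ g)
    (x y : Uge n r s) : p g (x * y) = p g x * p g y := by
  rw [hp.mul_right, hg]
  simp [mul_comm]

lemma pairing_mul_left_of_groupLike {g : Uge n r s} (hg : comulGe n r s g = g ⊗ₜ g)
    (x y : Ule n r s) : p (x * y) g = p x g * p y g := by
  rw [hp.mul_left, hg]
  simp

lemma pairing_om'_om (i j : Fin (n - 1)) :
    p ⟨om' n r s i, om'_mem n r s i⟩ ⟨om n r s j, om_mem n r s j⟩ = chi r s j i := by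
  rw [hp.om'_om, chi]
  push_cast
  rfl

lemma pairing_om' (i : Fin (n - 1)) (x : Uge n r s) :
    p ⟨om' n r s i, om'_mem n r s i⟩ x = char r s (fun j : Fin (n - 1) => chi r s j i) x := by
  refine character_ext (S := Uge n r s) (fun i => om_inv i) rfl _ ?_
    (pairing_mul_right_of_groupLike hp (comulLe_om' i)) (fun j h => ?_) (fun j h => ?_) x
  · rw [hp.one_right, counit_gen, counitGen_toral (.om' i) trivial]
  · rw [hp.om'_e, char_gen, charGen]
  · rw [pairing_om'_om hp, char_gen, charGen]

lemma pairing_om (j : Fin (n - 1)) (y : Ule n r s) :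
    p y ⟨om n r s j, om_mem n r s j⟩ = char r s (fun i : Fin (n - 1) => chi r s j i) y := by
  refine character_ext (S := Ule n r s) (P := p.flip ⟨om n r s j, om_mem n r s j⟩)
    (fun i => om'_inv i) rfl _ ?_ (pairing_mul_left_of_groupLike hp (comulGe_om j))
    (fun i h => ?_) (fun i h => ?_) y
  · rw [LinearMap.flip_apply, hp.one_left, counit_gen, counitGen_toral (.om j) trivial]
  · rw [LinearMap.flip_apply, hp.f_om, char_gen, charGen]
  · rw [LinearMap.flip_apply, pairing_om'_om hp, char_gen, charGen]

lemma pairing_om'Inv (i : Fin (n - 1)) (x : Uge n r s) :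
    p ⟨om'Inv n r s i, om'Inv_mem n r s i⟩ x =
      char r s (fun j : Fin (n - 1) => (chi r s j i)⁻¹) x := by
  have hinv : (⟨om' n r s i, om'_mem n r s i⟩ : Ule n r s) *
      ⟨om'Inv n r s i, om'Inv_mem n r s i⟩ = 1 := Subtype.ext (om'_inv i)
  refine character_ext (S := Uge n r s) (fun i => om_inv i) rfl _ ?_
    (pairing_mul_right_of_groupLike hp (comulLe_om'Inv i)) (fun j h => ?_) (fun j h => ?_) x
  · rw [hp.one_right, counit_gen, counitGen_toral (.om'Inv i) trivial]
  · have := hp.mul_left ⟨om' n r s i, om'_mem n r s i⟩ ⟨om'Inv n r s i, om'Inv_mem n r s i⟩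
      ⟨e n r s j, h⟩
    rw [hinv, hp.one_left, counit_gen, counitGen, comulGe_e] at this
    simpa [hp.om'_e, pairing_om'_om hp, char_gen, charGen] using this
  · have := hp.mul_left ⟨om' n r s i, om'_mem n r s i⟩ ⟨om'Inv n r s i, om'Inv_mem n r s i⟩
      ⟨om n r s j, h⟩
    rw [hinv, hp.one_left, counit_gen, counitGen_toral (.om j) trivial, comulGe_om,
      TensorProduct.map_tmul, LinearMap.mul'_apply, pairing_om'_om hp] at this
    rw [char_gen, charGen, Units.val_inv_eq_inv_val]
    exact eq_inv_of_mul_eq_one_right this.symm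

lemma pairing_omInv (j : Fin (n - 1)) (y : Ule n r s) :
    p y ⟨omInv n r s j, omInv_mem n r s j⟩ =
      char r s (fun i : Fin (n - 1) => (chi r s j i)⁻¹) y := by
  have hinv : (⟨om n r s j, om_mem n r s j⟩ : Uge n r s) *
      ⟨omInv n r s j, omInv_mem n r s j⟩ = 1 := Subtype.ext (om_inv j)
  refine character_ext (S := Ule n r s) (P := p.flip ⟨omInv n r s j, omInv_mem n r s j⟩)
    (fun i => om'_inv i) rfl _ ?_ (pairing_mul_left_of_groupLike hp (comulGe_omInv j))
    (fun i h => ?_) (fun i h => ?_) y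
  · rw [LinearMap.flip_apply, hp.one_left, counit_gen, counitGen_toral (.omInv j) trivial]
  · have := hp.mul_right ⟨f n r s i, h⟩ ⟨om n r s j, om_mem n r s j⟩
      ⟨omInv n r s j, omInv_mem n r s j⟩
    rw [hinv, hp.one_right, counit_gen, counitGen, comulLe_f] at this
    simpa [hp.f_om, pairing_om'_om hp, char_gen, charGen] using this
  · have := hp.mul_right ⟨om' n r s i, h⟩ ⟨om n r s j, om_mem n r s j⟩
      ⟨omInv n r s j, omInv_mem n r s j⟩
    rw [hinv, hp.one_right, counit_gen, counitGen_toral (.om' i) trivial, comulLe_om',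
      TensorProduct.map_tmul, LinearMap.mul'_apply, LinearMap.flip_apply, LinearMap.flip_apply,
      pairing_om'_om hp] at this
    rw [LinearMap.flip_apply, char_gen, charGen, Units.val_inv_eq_inv_val]
    exact eq_inv_of_mul_eq_one_left this.symm

lemma pairing_f (hrs : r ≠ s) (i : Fin (n - 1)) (x : Uge n r s) :
    p ⟨f n r s i, f_mem n r s i⟩ x = fFun hrs i x := by
  have := skew_ext (S := Uge n r s) (fun i => om_inv i) rfl
    (D := p ⟨f n r s i, f_mem n r s i⟩ - fFun hrs i ∘ₗ (Uge n r s).val.toLinearMap)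
    ((counit n r s).comp (Uge n r s).val)
    ((char r s fun j : Fin (n - 1) => chi r s j i).comp (Uge n r s).val)
    (fun x y => ?_) (fun j h => ?_) (fun j h => ?_) x
  · simpa [sub_eq_zero] using this
  · rw [LinearMap.sub_apply, hp.mul_right, comulLe_f]
    simp only [map_add, TensorProduct.map_tmul, LinearMap.mul'_apply, LinearMap.flip_apply,
      hp.one_left, pairing_om' hp, LinearMap.sub_apply, LinearMap.comp_apply, AlgHom.comp_apply,
      AlgHom.toLinearMap_apply, Subalgebra.coe_val, Subalgebra.coe_mul, fFun_mul hrs i x.2 y.2]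
    ring
  · simp [hp.f_e, fFun_e]
  · simp [hp.f_om, fFun_om]

lemma pairing_e (hrs : r ≠ s) (j : Fin (n - 1)) (y : Ule n r s) :
    p y ⟨e n r s j, e_mem n r s j⟩ = eFun hrs j y := by
  have := skew_ext (S := Ule n r s) (fun i => om'_inv i) rfl
    (D := p.flip ⟨e n r s j, e_mem n r s j⟩ - eFun hrs j ∘ₗ (Ule n r s).val.toLinearMap)
    ((counit n r s).comp (Ule n r s).val)
    ((char r s fun i : Fin (n - 1) => chi r s j i).comp (Ule n r s).val)
    (fun x y => ?_) (fun i h => ?_) (fun i h => ?_) y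
  · simpa [sub_eq_zero] using this
  · rw [LinearMap.sub_apply, LinearMap.flip_apply, hp.mul_left, comulGe_e]
    simp only [map_add, TensorProduct.map_tmul, LinearMap.mul'_apply, LinearMap.flip_apply,
      hp.one_right, pairing_om hp, LinearMap.sub_apply, LinearMap.comp_apply, AlgHom.comp_apply,
      AlgHom.toLinearMap_apply, Subalgebra.coe_val, Subalgebra.coe_mul, eFun_mul hrs j x.2 y.2]
    ring
  · simp [hp.f_e, eFun_f]
  · simp [hp.om'_e, eFun_om']

end Coordinates

/-- A Hopf pairing is determined by its values on generators on the left, and these are the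
explicit functionals of `pairing_f`, `pairing_om'` and `pairing_om'Inv`. -/
lemma hopfPairing_unique (hrs : r ≠ s) {p p' : Ule n r s →ₗ[K] Uge n r s →ₗ[K] K}
    (hp : IsHopfPairing n r s p) (hp' : IsHopfPairing n r s p') : p = p' := by
  ext ⟨y, hy⟩ x
  revert x
  refine Algebra.adjoin_induction (p := fun y hy => ∀ x, p ⟨y, hy⟩ x = p' ⟨y, hy⟩ x)
    ?_ ?_ ?_ ?_ hy
  · rintro _ ((⟨i, rfl⟩ | ⟨i, rfl⟩) | ⟨i, rfl⟩) x
    · rw [pairing_f hp hrs, pairing_f hp' hrs]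
    · rw [pairing_om' hp, pairing_om' hp']
    · rw [pairing_om'Inv hp, pairing_om'Inv hp']
  · intro c x
    have : (⟨algebraMap K (U n r s) c, Subalgebra.algebraMap_mem _ c⟩ : Ule n r s) = c • 1 :=
      Subtype.ext (Algebra.algebraMap_eq_smul_one c)
    change p ⟨_, Subalgebra.algebraMap_mem (Ule n r s) c⟩ x =
      p' ⟨_, Subalgebra.algebraMap_mem (Ule n r s) c⟩ x
    rw [this, map_smul, map_smul, LinearMap.smul_apply, LinearMap.smul_apply, hp.one_left,
      hp'.one_left]
  · intro y y' hy hy' h h' x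
    have e1 := congrArg (fun φ => φ x) (map_add p ⟨y, hy⟩ ⟨y', hy'⟩)
    have e2 := congrArg (fun φ => φ x) (map_add p' ⟨y, hy⟩ ⟨y', hy'⟩)
    simp only [LinearMap.add_apply, h, h'] at e1 e2
    exact e1.trans e2.symm
  · intro y y' hy hy' h h' x
    have e1 := hp.mul_left ⟨y, hy⟩ ⟨y', hy'⟩ x
    rw [LinearMap.ext h, LinearMap.ext h', ← hp'.mul_left] at e1
    exact e1

section Radical

variable {m l : ℕ} (hrs : r ≠ s) (hm : 2 ≤ m) (hq : IsPrimitiveRoot ((r : K) * (s : K)⁻¹) m)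
  (hr : r ^ l = 1) (hs : s ^ l = 1)
include hr hs

lemma chi_pow (i j : ℕ) : chi r s i j ^ l = 1 := by
  rw [chi, mul_pow, ← zpow_natCast, ← zpow_natCast, zpow_comm, zpow_natCast, hr, one_zpow, one_mul,
    zpow_comm, zpow_natCast, hs, one_zpow]

lemma vecWeight_pow (i j : ℕ) : (vecWeight r s i j)⁻¹ ^ l = 1 := by
  rw [vecWeight]
  split_ifs <;> simp [hr, hs]

include hm hrs

lemma exists_fFunBar (i : Fin (n - 1)) :
    ∃ ψ : Bar n r s m l →ₗ[K] K, ∀ x, ψ (toBar n r s m l x) = fFun hrs i x := by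
  obtain ⟨φ, hφ⟩ := exists_vecBar (n := n) hrs hm hr hs
    (c := fun j => (vecWeight r s j (i + 1))⁻¹) fun j => vecWeight_pow hr hs _ _
  exact ⟨((s : K) - r)⁻¹ • (Matrix.entryLinearMap K K i.castSucc i.succ ∘ₗ φ.toLinearMap),
    fun x => by rw [fFun_apply, ← hφ]; rfl⟩

lemma exists_eFunBar (j : Fin (n - 1)) :
    ∃ ψ : Bar n r s m l →ₗ[K] K, ∀ x, ψ (toBar n r s m l x) = eFun hrs j x := by
  obtain ⟨φ, hφ⟩ := exists_vecBar (n := n) hrs hm hr hs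
    (c := fun k => (vecWeight s r k j)⁻¹) fun j => vecWeight_pow hs hr _ _
  exact ⟨(s * ((s : K) - r)⁻¹) • (Matrix.entryLinearMap K K j.succ j.castSucc ∘ₗ φ.toLinearMap),
    fun x => by rw [eFun_apply, ← hφ]; rfl⟩

variable {p : Ule n r s →ₗ[K] Uge n r s →ₗ[K] K} (hp : IsHopfPairing n r s p)
include hp hq

/-- The functionals `(y | -)` factor through `Bar`: they form a convolution algebra, since the
coproduct descends to `Bar`, and the generators of this algebra are matrix coefficients of
representations of `Bar`. -/
lemma exists_pairing_left (y : Ule n r s) :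
    ∃ ψ : Bar n r s m l →ₗ[K] K, ∀ x : Uge n r s, p y x = ψ (toBar n r s m l x) := by
  obtain ⟨D, hD⟩ := exists_comulBar (n := n) (l := l) (by omega) hq
  obtain ⟨y, hy⟩ := y
  refine Algebra.adjoin_induction (p := fun y hy => ∃ ψ : Bar n r s m l →ₗ[K] K,
    ∀ x : Uge n r s, p ⟨y, hy⟩ x = ψ (toBar n r s m l x)) ?_ ?_ ?_ ?_ hy
  · rintro _ ((⟨i, rfl⟩ | ⟨i, rfl⟩) | ⟨i, rfl⟩)
    · obtain ⟨ψ, hψ⟩ := exists_fFunBar hrs hm hr hs i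
      exact ⟨ψ, fun x => by rw [pairing_f hp hrs, hψ]⟩
    · obtain ⟨ψ, hψ⟩ := exists_charBar (n := n) (r := r) (s := s) (m := m) (l := l) (by omega)
        fun j => chi_pow hr hs j i
      exact ⟨ψ.toLinearMap, fun x => by rw [pairing_om' hp, AlgHom.toLinearMap_apply, hψ]⟩
    · obtain ⟨ψ, hψ⟩ := exists_charBar (n := n) (r := r) (s := s) (m := m) (l := l) (by omega)
        (c := fun j => (chi r s j i)⁻¹) fun j => by rw [inv_pow, chi_pow hr hs, inv_one]
      exact ⟨ψ.toLinearMap, fun x => by rw [pairing_om'Inv hp, AlgHom.toLinearMap_apply, hψ]⟩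
  · intro c
    obtain ⟨ψ, hψ⟩ := exists_charBar (n := n) (r := r) (s := s) (m := m) (l := l) (by omega)
      (c := 1) fun j => one_pow _
    refine ⟨c • ψ.toLinearMap, fun x => ?_⟩
    have : (⟨algebraMap K (U n r s) c, Subalgebra.algebraMap_mem _ c⟩ : Ule n r s) = c • 1 :=
      Subtype.ext (Algebra.algebraMap_eq_smul_one c)
    change p ⟨_, Subalgebra.algebraMap_mem (Ule n r s) c⟩ x = _
    rw [this, map_smul, LinearMap.smul_apply, hp.one_left, LinearMap.smul_apply,
      AlgHom.toLinearMap_apply, hψ, char_one]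
  · rintro y y' hy hy' ⟨ψ, hψ⟩ ⟨ψ', hψ'⟩
    refine ⟨ψ + ψ', fun x => ?_⟩
    rw [LinearMap.add_apply, ← hψ, ← hψ', ← LinearMap.add_apply, ← map_add]
    rfl
  · rintro y y' hy hy' ⟨ψ, hψ⟩ ⟨ψ', hψ'⟩
    refine ⟨LinearMap.mul' K K ∘ₗ TensorProduct.map ψ ψ' ∘ₗ D.toLinearMap, fun x => ?_⟩
    have e1 := hp.mul_left ⟨y, hy⟩ ⟨y', hy'⟩ x
    refine e1.trans ?_
    simp only [LinearMap.comp_apply, AlgHom.toLinearMap_apply, hD, ← incl₂_comulGe]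
    generalize comulGe n r s x = t
    induction t with
    | zero => simp
    | tmul a b => simp [incl₂, hψ, hψ']
    | add a b ha hb => simp only [map_add, ha, hb]

/-- The functionals `(- | x)` factor through `Bar`, by the mirror image of `exists_pairing_left`. -/
lemma exists_pairing_right (x : Uge n r s) :
    ∃ ψ : Bar n r s m l →ₗ[K] K, ∀ y : Ule n r s, p y x = ψ (toBar n r s m l y) := by
  obtain ⟨D, hD⟩ := exists_comulBar (n := n) (l := l) (by omega) hq
  obtain ⟨x, hx⟩ := x
  refine Algebra.adjoin_induction (p := fun x hx => ∃ ψ : Bar n r s m l →ₗ[K] K,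
    ∀ y : Ule n r s, p y ⟨x, hx⟩ = ψ (toBar n r s m l y)) ?_ ?_ ?_ ?_ hx
  · rintro _ ((⟨j, rfl⟩ | ⟨j, rfl⟩) | ⟨j, rfl⟩)
    · obtain ⟨ψ, hψ⟩ := exists_eFunBar hrs hm hr hs j
      exact ⟨ψ, fun x => by rw [pairing_e hp hrs, hψ]⟩
    · obtain ⟨ψ, hψ⟩ := exists_charBar (n := n) (r := r) (s := s) (m := m) (l := l) (by omega)
        fun i => chi_pow hr hs j i
      exact ⟨ψ.toLinearMap, fun x => by rw [pairing_om hp, AlgHom.toLinearMap_apply, hψ]⟩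
    · obtain ⟨ψ, hψ⟩ := exists_charBar (n := n) (r := r) (s := s) (m := m) (l := l) (by omega)
        (c := fun i => (chi r s j i)⁻¹) fun i => by rw [inv_pow, chi_pow hr hs, inv_one]
      exact ⟨ψ.toLinearMap, fun x => by rw [pairing_omInv hp, AlgHom.toLinearMap_apply, hψ]⟩
  · intro c
    obtain ⟨ψ, hψ⟩ := exists_charBar (n := n) (r := r) (s := s) (m := m) (l := l) (by omega)
      (c := 1) fun j => one_pow _
    refine ⟨c • ψ.toLinearMap, fun y => ?_⟩
    have : (⟨algebraMap K (U n r s) c, Subalgebra.algebraMap_mem _ c⟩ : Uge n r s) = c • 1 :=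
      Subtype.ext (Algebra.algebraMap_eq_smul_one c)
    change p y ⟨_, Subalgebra.algebraMap_mem (Uge n r s) c⟩ = _
    rw [this, map_smul, hp.one_right, LinearMap.smul_apply,
      AlgHom.toLinearMap_apply, hψ, char_one]
  · rintro x x' hx hx' ⟨ψ, hψ⟩ ⟨ψ', hψ'⟩
    refine ⟨ψ + ψ', fun y => ?_⟩
    rw [LinearMap.add_apply, ← hψ, ← hψ', ← map_add]
    rfl
  · rintro x x' hx hx' ⟨ψ, hψ⟩ ⟨ψ', hψ'⟩
    refine ⟨LinearMap.mul' K K ∘ₗ TensorProduct.map ψ' ψ ∘ₗ D.toLinearMap, fun y => ?_⟩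
    have e1 := hp.mul_right y ⟨x, hx⟩ ⟨x', hx'⟩
    refine e1.trans ?_
    simp only [LinearMap.comp_apply, AlgHom.toLinearMap_apply, hD, ← incl₂_comulLe]
    generalize comulLe n r s y = t
    induction t with
    | zero => simp
    | tmul a b => simp [incl₂, hψ, hψ']
    | add a b ha hb => simp only [map_add, ha, hb]

end Radical

/-! ### Descent to the small quantum group -/

/-- A bilinear map factors uniquely through surjections whose kernels it annihilates. -/
lemma existsUnique_bilinear_factor {V W V' W' : Type*} [AddCommGroup V] [Module K V]
    [AddCommGroup W] [Module K W] [AddCommGroup V'] [Module K V'] [AddCommGroup W'] [Module K W']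
    {φ : V →ₗ[K] V'} {ψ : W →ₗ[K] W'} (hφ : Function.Surjective φ) (hψ : Function.Surjective ψ)
    (p : V →ₗ[K] W →ₗ[K] K) (h1 : ∀ v, φ v = 0 → ∀ w, p v w = 0)
    (h2 : ∀ w, ψ w = 0 → ∀ v, p v w = 0) :
    ∃! q : V' →ₗ[K] W' →ₗ[K] K, ∀ v w, q (φ v) (ψ w) = p v w := by
  obtain ⟨σ, hσ⟩ := φ.exists_rightInverse_of_surjective (LinearMap.range_eq_top.2 hφ)
  obtain ⟨τ, hτ⟩ := ψ.exists_rightInverse_of_surjective (LinearMap.range_eq_top.2 hψ)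
  refine ⟨p.compl₁₂ σ τ, fun v w => ?_, fun q hq => ?_⟩
  · have e1 := h1 (σ (φ v) - v)
      (by rw [map_sub, sub_eq_zero]; exact LinearMap.congr_fun hσ (φ v)) (τ (ψ w))
    have e2 := h2 (τ (ψ w) - w)
      (by rw [map_sub, sub_eq_zero]; exact LinearMap.congr_fun hτ (ψ w)) v
    rw [map_sub, LinearMap.sub_apply, sub_eq_zero] at e1
    rw [map_sub, sub_eq_zero] at e2
    rw [LinearMap.compl₁₂_apply, e1, e2]
  · ext v w
    obtain ⟨v, rfl⟩ := hφ v
    obtain ⟨w, rfl⟩ := hψ w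
    have e1 : φ (σ (φ v)) = φ v := LinearMap.congr_fun hσ (φ v)
    have e2 : ψ (τ (ψ w)) = ψ w := LinearMap.congr_fun hτ (ψ w)
    rw [LinearMap.compl₁₂_apply, ← hq, e1, e2]

lemma toSmall_eq_zero {l : ℕ} {x : U n r s} (h : toSmall n r s l x = 0) :
    x ∈ idealI n r s l := by
  rw [TwoSidedIdeal.mem_iff]
  exact (RingCon.eq _).1 h

end Pairing

section Existence

variable {K : Type*} [Field K] {n : ℕ} {r s : Kˣ}

/-! ### Existence of the Hopf pairing -/

section Bialgebra

variable (n r s)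

/-- The bialgebra structure of `U^{≥0}`. -/
instance : Bialgebra K (Uge n r s) := by
  refine Bialgebra.ofAlgHom (comulGe n r s) ((counit n r s).comp (Uge n r s).val) ?_ ?_ ?_ <;>
  · refine AlgHom.ext_of_eq_adjoin (S := Uge n r s) rfl fun x hx => ?_
    obtain ((⟨i, rfl⟩ | ⟨i, rfl⟩) | ⟨i, rfl⟩) := hx
    · simp [comulGe_e, comulGe_om, counit_gen, counitGen, TensorProduct.add_tmul,
        TensorProduct.tmul_add, add_assoc, Algebra.TensorProduct.one_def]
    · simp [comulGe_om, counit_gen, counitGen]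
    · simp [comulGe_omInv, counit_gen, counitGen]

end Bialgebra

variable (n) in
/-- The generators of `U^{≤0}`. -/
inductive LeGen : Type
  | f (i : Fin (n - 1))
  | om' (i : Fin (n - 1))
  | om'Inv (i : Fin (n - 1))

namespace LeGen

variable (r s) in
/-- The generators of `U^{≤0}`, as elements of `U^{≤0}`. -/
def toUle : LeGen n → Ule n r s
  | .f i => ⟨TwoParam.f n r s i, f_mem n r s i⟩
  | .om' i => ⟨TwoParam.om' n r s i, om'_mem n r s i⟩
  | .om'Inv i => ⟨TwoParam.om'Inv n r s i, om'Inv_mem n r s i⟩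

/-- The coproducts of the generators of `U^{≤0}`, in the free algebra. -/
def comulFree : LeGen n → FreeAlgebra K (LeGen n) ⊗[K] FreeAlgebra K (LeGen n)
  | .f i => 1 ⊗ₜ FreeAlgebra.ι K (.f i) + FreeAlgebra.ι K (.f i) ⊗ₜ FreeAlgebra.ι K (.om' i)
  | .om' i => FreeAlgebra.ι K (.om' i) ⊗ₜ FreeAlgebra.ι K (.om' i)
  | .om'Inv i => FreeAlgebra.ι K (.om'Inv i) ⊗ₜ FreeAlgebra.ι K (.om'Inv i)

/-- The functionals on `U^{≥0}` defined by the generators of `U^{≤0}`. -/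
def functional (hrs : r ≠ s) : LeGen n → U n r s →ₗ[K] K
  | .f i => fFun hrs i
  | .om' i => (char r s fun j : Fin (n - 1) => chi r s j i).toLinearMap
  | .om'Inv i => (char r s fun j : Fin (n - 1) => (chi r s j i)⁻¹).toLinearMap

end LeGen

variable (n r s) in
/-- The free algebra on the generators of `U^{≤0}`, mapped onto `U^{≤0}`. -/
def leProj : FreeAlgebra K (LeGen n) →ₐ[K] Ule n r s := FreeAlgebra.lift K (LeGen.toUle r s)

lemma leProj_ι (g : LeGen n) : leProj n r s (FreeAlgebra.ι K g) = g.toUle r s := by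
  simp [leProj]

lemma leProj_surjective : Function.Surjective (leProj (K := K) n r s) := by
  have : Ule n r s ≤ ((Ule n r s).val.comp (leProj n r s)).range := by
    refine Algebra.adjoin_le ?_
    rintro _ ((⟨i, rfl⟩ | ⟨i, rfl⟩) | ⟨i, rfl⟩)
    · exact ⟨FreeAlgebra.ι K (.f i), congrArg Subtype.val (leProj_ι _)⟩
    · exact ⟨FreeAlgebra.ι K (.om' i), congrArg Subtype.val (leProj_ι _)⟩
    · exact ⟨FreeAlgebra.ι K (.om'Inv i), congrArg Subtype.val (leProj_ι _)⟩
  intro y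
  obtain ⟨z, hz⟩ := this y.2
  exact ⟨z, Subtype.ext hz⟩

variable (K n) in
/-- The coproduct of the free algebra on the generators of `U^{≤0}`. -/
def comulFree :
    FreeAlgebra K (LeGen n) →ₐ[K] FreeAlgebra K (LeGen n) ⊗[K] FreeAlgebra K (LeGen n) :=
  FreeAlgebra.lift K LeGen.comulFree

lemma comulFree_ι (g : LeGen n) : comulFree K n (FreeAlgebra.ι K g) = g.comulFree := by
  simp [comulFree]

lemma map_leProj_comulFree (y : FreeAlgebra K (LeGen n)) :
    TensorProduct.map (leProj n r s).toLinearMap (leProj n r s).toLinearMap (comulFree K n y) =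
      comulLe n r s (leProj n r s y) := by
  refine DFunLike.congr_fun (f := (Algebra.TensorProduct.map (leProj n r s) (leProj n r s)).comp
    (comulFree K n)) (g := (comulLe n r s).comp (leProj n r s)) ?_ y
  refine FreeAlgebra.hom_ext (funext fun g => ?_)
  simp only [Function.comp_apply, AlgHom.comp_apply, comulFree_ι, leProj_ι]
  cases g <;> simp [LeGen.comulFree, LeGen.toUle, leProj_ι, comulLe_f, comulLe_om', comulLe_om'Inv]

/-- The map from the free algebra on the generators of `U^{≤0}` to the convolution algebra of
functionals on `U^{≥0}`. -/
def freePairing (hrs : r ≠ s) : FreeAlgebra K (LeGen n) →ₐ[K] WithConv (Uge n r s →ₗ[K] K) :=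
  FreeAlgebra.lift K fun g => WithConv.toConv (g.functional hrs ∘ₗ (Uge n r s).val.toLinearMap)

lemma freePairing_ι (hrs : r ≠ s) (g : LeGen n) (x : Uge n r s) :
    freePairing hrs (FreeAlgebra.ι K g) x = g.functional hrs x := by
  simp [freePairing]

lemma freePairing_one (hrs : r ≠ s) (x : Uge n r s) :
    freePairing hrs (1 : FreeAlgebra K (LeGen n)) x = counit n r s x := by
  rw [map_one, LinearMap.convOne_apply]
  rfl

lemma freePairing_algebraMap (hrs : r ≠ s) (c : K) (x : Uge n r s) :
    freePairing hrs (algebraMap K (FreeAlgebra K (LeGen n)) c) x = c * counit n r s x := by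
  rw [Algebra.algebraMap_eq_smul_one, map_smul, ← freePairing_one hrs]
  rfl

lemma freePairing_mul (hrs : r ≠ s) (y z : FreeAlgebra K (LeGen n)) (x : Uge n r s) :
    freePairing hrs (y * z) x = LinearMap.mul' K K (TensorProduct.map (freePairing hrs y).ofConv
      (freePairing hrs z).ofConv (comulGe n r s x)) := by
  rw [map_mul, LinearMap.convMul_apply]
  rfl

lemma freePairing_add (hrs : r ≠ s) (y z : FreeAlgebra K (LeGen n)) (x : Uge n r s) :
    freePairing hrs (y + z) x = freePairing hrs y x + freePairing hrs z x := by
  rw [map_add]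
  rfl

/-- `u ⊗ v ↦ (a ⊗ b ↦ (v | a) (u | b))`. -/
def freePairing₂ (hrs : r ≠ s) : FreeAlgebra K (LeGen n) ⊗[K] FreeAlgebra K (LeGen n) →ₗ[K]
    WithConv (Uge n r s ⊗[K] Uge n r s →ₗ[K] K) :=
  TensorProduct.lift (LinearMap.mk₂ K (fun u v => WithConv.toConv (LinearMap.mul' K K ∘ₗ
      TensorProduct.map (freePairing hrs v).ofConv (freePairing hrs u).ofConv))
    (fun u u' v => by
      rw [map_add, WithConv.ofConv_add, TensorProduct.map_add_right, LinearMap.comp_add]; rfl)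
    (fun c u v => by
      rw [map_smul, WithConv.ofConv_smul, TensorProduct.map_smul_right, LinearMap.comp_smul]; rfl)
    (fun u v v' => by
      rw [map_add, WithConv.ofConv_add, TensorProduct.map_add_left, LinearMap.comp_add]; rfl)
    (fun c u v => by
      rw [map_smul, WithConv.ofConv_smul, TensorProduct.map_smul_left, LinearMap.comp_smul]; rfl))

lemma freePairing₂_tmul (hrs : r ≠ s) (u v : FreeAlgebra K (LeGen n)) :
    freePairing₂ hrs (u ⊗ₜ v) = WithConv.toConv (LinearMap.mul' K K ∘ₗ
      TensorProduct.map (freePairing hrs v).ofConv (freePairing hrs u).ofConv) := rfl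

lemma freePairing₂_mul (hrs : r ≠ s) (a b : FreeAlgebra K (LeGen n) ⊗[K] FreeAlgebra K (LeGen n)) :
    freePairing₂ hrs (a * b) = freePairing₂ hrs a * freePairing₂ hrs b := by
  induction a with
  | zero => simp
  | add a a' h h' => rw [add_mul, map_add, map_add, add_mul, h, h']
  | tmul u v =>
    induction b with
    | zero => simp
    | add a a' h h' => rw [mul_add, map_add, map_add, mul_add, h, h']
    | tmul u' v' =>
      rw [Algebra.TensorProduct.tmul_mul_tmul, freePairing₂_tmul, freePairing₂_tmul,
        freePairing₂_tmul, map_mul, map_mul]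
      refine (congrArg (fun T => WithConv.toConv (LinearMap.mul' K K ∘ₗ WithConv.ofConv T))
        TensorProduct.map_convMul_map.symm).trans ?_
      have := LinearMap.algHom_comp_convMul_distrib (R := K)
        (Algebra.TensorProduct.lmul' K (S := K))
        (WithConv.toConv (TensorProduct.map (freePairing hrs v).ofConv (freePairing hrs u).ofConv))
        (WithConv.toConv
          (TensorProduct.map (freePairing hrs v').ofConv (freePairing hrs u').ofConv))
      exact congrArg WithConv.toConv this

/-- Multiplicativity in the second variable. It holds on generators, and both sides are
multiplicative for the convolution on `U^{≥0} ⊗ U^{≥0}` because the multiplication of `U^{≥0}` is a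
coalgebra map. -/
lemma freePairing_comp_mul (hrs : r ≠ s) (y : FreeAlgebra K (LeGen n)) :
    WithConv.toConv ((freePairing hrs y).ofConv ∘ₗ LinearMap.mul' K (Uge n r s)) =
      freePairing₂ hrs (comulFree K n y) := by
  induction y using FreeAlgebra.induction with
  | grade0 c =>
    apply WithConv.ofConv_injective
    ext a b
    rw [AlgHom.commutes (comulFree K n), Algebra.algebraMap_eq_smul_one
      (A := FreeAlgebra K (LeGen n) ⊗[K] FreeAlgebra K (LeGen n)), map_smul (freePairing₂ hrs),
      Algebra.TensorProduct.one_def, freePairing₂_tmul]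
    change freePairing hrs _ (a * b) = c * (freePairing hrs 1 a * freePairing hrs 1 b)
    rw [freePairing_algebraMap, freePairing_one, freePairing_one]
    simp
  | grade1 g =>
    apply WithConv.ofConv_injective
    ext a b
    rw [comulFree_ι]
    change freePairing hrs _ (a * b) = _
    rw [freePairing_ι]
    cases g with
    | f i =>
      rw [LeGen.comulFree, map_add, freePairing₂_tmul, freePairing₂_tmul]
      change _ = freePairing hrs (FreeAlgebra.ι K (.f i)) a * freePairing hrs 1 b +
        freePairing hrs (FreeAlgebra.ι K (.om' i)) a * freePairing hrs (FreeAlgebra.ι K (.f i)) b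
      rw [freePairing_ι, freePairing_ι, freePairing_ι, freePairing_one]
      exact fFun_mul hrs i a.2 b.2
    | om' i =>
      rw [LeGen.comulFree, freePairing₂_tmul]
      change _ = freePairing hrs (FreeAlgebra.ι K (.om' i)) a *
        freePairing hrs (FreeAlgebra.ι K (.om' i)) b
      rw [freePairing_ι, freePairing_ι]
      exact map_mul (char r s _) _ _
    | om'Inv i =>
      rw [LeGen.comulFree, freePairing₂_tmul]
      change _ = freePairing hrs (FreeAlgebra.ι K (.om'Inv i)) a *
        freePairing hrs (FreeAlgebra.ι K (.om'Inv i)) b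
      rw [freePairing_ι, freePairing_ι]
      exact map_mul (char r s _) _ _
  | mul y z hy hz =>
    rw [map_mul (comulFree K n), freePairing₂_mul, ← hy, ← hz, map_mul]
    exact congrArg WithConv.toConv (LinearMap.convMul_comp_coalgHom_distrib (R := K)
      (freePairing hrs y) (freePairing hrs z) (Bialgebra.mulCoalgHom K (Uge n r s)))
  | add y z hy hz =>
    rw [map_add (comulFree K n), map_add (freePairing₂ hrs), ← hy, ← hz, map_add]
    rfl

lemma freePairing_apply_mul (hrs : r ≠ s) (y : FreeAlgebra K (LeGen n)) (a b : Uge n r s) :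
    freePairing hrs y (a * b) = freePairing₂ hrs (comulFree K n y) (a ⊗ₜ b) :=
  DFunLike.congr_fun (congrArg WithConv.ofConv (freePairing_comp_mul hrs y)) (a ⊗ₜ b)

lemma freePairing_of_groupLike (hrs : r ≠ s) {g : Uge n r s} (hg : comulGe n r s g = g ⊗ₜ g)
    (hg1 : counit n r s g = 1) (χ : U n r s →ₐ[K] K)
    (h : ∀ t : LeGen n, t.functional hrs g = χ (t.toUle r s)) (y : FreeAlgebra K (LeGen n)) :
    freePairing hrs y g = χ (leProj n r s y) := by
  induction y using FreeAlgebra.induction with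
  | grade0 c => rw [freePairing_algebraMap, hg1, AlgHom.commutes]; simp
  | grade1 t => rw [freePairing_ι, leProj_ι, h]
  | mul y z hy hz =>
    rw [freePairing_mul, hg, map_mul, Subalgebra.coe_mul, map_mul, ← hy, ← hz]
    rfl
  | add y z hy hz => rw [freePairing_add, hy, hz, map_add, Subalgebra.coe_add, map_add]

lemma freePairing_one_right (hrs : r ≠ s) (y : FreeAlgebra K (LeGen n)) :
    freePairing hrs y 1 = counit n r s (leProj n r s y) := by
  refine freePairing_of_groupLike hrs (map_one _) (map_one _) _ (fun t => ?_) y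
  cases t with
  | f i =>
    have := fFun_mul hrs i (one_mem (Uge n r s)) (one_mem (Uge n r s))
    simp only [mul_one, map_one, one_mul, left_eq_add] at this
    simp [LeGen.functional, LeGen.toUle, this, counit_gen, counitGen]
  | om' i => simp [LeGen.functional, LeGen.toUle, counit_gen, counitGen]
  | om'Inv i => simp [LeGen.functional, LeGen.toUle, counit_gen, counitGen]

lemma freePairing_om (hrs : r ≠ s) (j : Fin (n - 1)) (y : FreeAlgebra K (LeGen n)) :
    freePairing hrs y ⟨om n r s j, om_mem n r s j⟩ =
      char r s (fun i : Fin (n - 1) => chi r s j i) (leProj n r s y) := by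
  refine freePairing_of_groupLike hrs (comulGe_om j) ?_ _ (fun t => ?_) y
  · simp [counit_gen, counitGen]
  · cases t <;> simp [LeGen.functional, LeGen.toUle, fFun_om, char_gen, charGen]

lemma fFun_omInv (hrs : r ≠ s) (i j : Fin (n - 1)) : fFun hrs i (omInv n r s j) = 0 := by
  have h1 := fFun_mul hrs i (one_mem (Uge n r s)) (one_mem (Uge n r s))
  simp only [mul_one, map_one, one_mul, left_eq_add] at h1
  have h2 := fFun_mul hrs i (om_mem n r s j) (omInv_mem n r s j)
  rw [om_inv, h1, fFun_om, zero_mul, zero_add, char_gen, charGen] at h2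
  exact (mul_eq_zero.1 h2.symm).resolve_left (Units.ne_zero _)

lemma freePairing_omInv (hrs : r ≠ s) (j : Fin (n - 1)) (y : FreeAlgebra K (LeGen n)) :
    freePairing hrs y ⟨omInv n r s j, omInv_mem n r s j⟩ =
      char r s (fun i : Fin (n - 1) => (chi r s j i)⁻¹) (leProj n r s y) := by
  refine freePairing_of_groupLike hrs (comulGe_omInv j) ?_ _ (fun t => ?_) y
  · simp [counit_gen, counitGen]
  · cases t <;> simp [LeGen.functional, LeGen.toUle, fFun_omInv, char_gen, charGen]

lemma freePairing_e (hrs : r ≠ s) (j : Fin (n - 1)) (y : FreeAlgebra K (LeGen n)) :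
    freePairing hrs y ⟨e n r s j, e_mem n r s j⟩ = eFun hrs j (leProj n r s y) := by
  have h1 : eFun hrs j (1 : U n r s) = 0 := by
    have := eFun_mul hrs j (one_mem (Ule n r s)) (one_mem (Ule n r s))
    simpa only [mul_one, map_one, one_mul, left_eq_add] using this
  induction y using FreeAlgebra.induction with
  | grade0 c =>
    rw [freePairing_algebraMap, AlgHom.commutes, Subalgebra.coe_algebraMap,
      Algebra.algebraMap_eq_smul_one, map_smul, h1]
    simp [counit_gen, counitGen]
  | grade1 t =>
    rw [freePairing_ι, leProj_ι]
    cases t with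
    | f i => simp [LeGen.functional, LeGen.toUle, fFun_e, eFun_f]
    | om' i => simp [LeGen.functional, LeGen.toUle, eFun_om', char_gen, charGen]
    | om'Inv i =>
      have h2 := eFun_mul hrs j (om'_mem n r s i) (om'Inv_mem n r s i)
      rw [om'_inv, h1, eFun_om', zero_mul, zero_add, char_gen, charGen] at h2
      have h3 := (mul_eq_zero.1 h2.symm).resolve_left (Units.ne_zero _)
      simp [LeGen.functional, LeGen.toUle, h3, char_gen, charGen]
  | mul y z hy hz =>
    rw [freePairing_mul, comulGe_e, map_mul, Subalgebra.coe_mul,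
      eFun_mul hrs j (Subtype.property _) (Subtype.property _), ← hy, ← hz,
      ← freePairing_one_right hrs, ← freePairing_om hrs, map_add, map_add]
    rfl
  | add y z hy hz => rw [freePairing_add, hy, hz, map_add, Subalgebra.coe_add, map_add]

/-- Evaluation at an element of `U^{≥0}` only depends on the image in `U^{≤0}`. This is what makes
the defining relations of `U^{≤0}` hold in the convolution algebra without checking them. -/
lemma exists_freePairing_right (hrs : r ≠ s) (x : Uge n r s) :
    ∃ ψ : Ule n r s →ₗ[K] K, ∀ y, freePairing hrs y x = ψ (leProj n r s y) := by
  obtain ⟨x, hx⟩ := x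
  refine Algebra.adjoin_induction (p := fun x hx => ∃ ψ : Ule n r s →ₗ[K] K,
    ∀ y, freePairing hrs y ⟨x, hx⟩ = ψ (leProj n r s y)) ?_ ?_ ?_ ?_ hx
  · rintro _ ((⟨j, rfl⟩ | ⟨j, rfl⟩) | ⟨j, rfl⟩)
    · exact ⟨eFun hrs j ∘ₗ (Ule n r s).val.toLinearMap, freePairing_e hrs j⟩
    · exact ⟨((char r s _).comp (Ule n r s).val).toLinearMap, freePairing_om hrs j⟩
    · exact ⟨((char r s _).comp (Ule n r s).val).toLinearMap, freePairing_omInv hrs j⟩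
  · intro c
    refine ⟨c • ((counit n r s).comp (Ule n r s).val).toLinearMap, fun y => ?_⟩
    have : (⟨algebraMap K (U n r s) c, Subalgebra.algebraMap_mem _ c⟩ : Uge n r s) = c • 1 :=
      Subtype.ext (Algebra.algebraMap_eq_smul_one c)
    change freePairing hrs y ⟨_, Subalgebra.algebraMap_mem (Uge n r s) c⟩ = _
    rw [this]
    exact ((freePairing hrs y).ofConv.map_smul c 1).trans
      (congrArg (c • ·) (freePairing_one_right hrs y))
  · rintro x x' hx hx' ⟨ψ, hψ⟩ ⟨ψ', hψ'⟩
    refine ⟨ψ + ψ', fun y => ?_⟩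
    rw [LinearMap.add_apply, ← hψ, ← hψ']
    exact (freePairing hrs y).ofConv.map_add ⟨x, hx⟩ ⟨x', hx'⟩
  · rintro x x' hx hx' ⟨ψ, hψ⟩ ⟨ψ', hψ'⟩
    refine ⟨LinearMap.mul' K K ∘ₗ TensorProduct.map ψ' ψ ∘ₗ (comulLe n r s).toLinearMap,
      fun y => ?_⟩
    refine (freePairing_apply_mul hrs y ⟨x, hx⟩ ⟨x', hx'⟩).trans ?_
    simp only [LinearMap.comp_apply, AlgHom.toLinearMap_apply, ← map_leProj_comulFree]
    generalize comulFree K n y = t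
    induction t with
    | zero => simp
    | tmul a b =>
      rw [freePairing₂_tmul]
      change freePairing hrs b ⟨x, hx⟩ * freePairing hrs a ⟨x', hx'⟩ = _
      rw [hψ, hψ', mul_comm]
      rfl
    | add a b ha hb =>
      simp only [map_add, ← ha, ← hb]
      rfl

lemma exists_hopfPairing (hrs : r ≠ s) :
    ∃ p : Ule n r s →ₗ[K] Uge n r s →ₗ[K] K, IsHopfPairing n r s p := by
  obtain ⟨p, hp⟩ : ∃ p : Ule n r s →ₗ[K] Uge n r s →ₗ[K] K,
      ∀ y x, p (leProj n r s y) x = freePairing hrs y x := by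
    choose σ hσ using leProj_surjective (K := K) (n := n) (r := r) (s := s)
    choose ψ hψ using exists_freePairing_right (n := n) hrs
    have h (y) (x) : freePairing hrs (σ y) x = ψ x y := by rw [hψ, hσ]
    refine ⟨LinearMap.mk₂ K (fun y x => freePairing hrs (σ y) x) (fun y y' x => ?_)
      (fun c y x => ?_) (fun y x x' => (freePairing hrs (σ y)).ofConv.map_add x x')
      (fun c y x => (freePairing hrs (σ y)).ofConv.map_smul c x), fun y x => ?_⟩
    · simp only [h, map_add]
    · simp only [h, map_smul]
    · rw [LinearMap.mk₂_apply, h, hψ]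
  have hp' (y) : p (leProj n r s y) = (freePairing hrs y).ofConv := LinearMap.ext (hp y)
  have hgen (g : LeGen n) (x) : p (g.toUle r s) x = g.functional hrs x := by
    rw [← leProj_ι, hp, freePairing_ι]
  refine ⟨p, ?_, ?_, ?_, ?_, ?_, ?_, ?_, ?_⟩
  · exact fun i j => (hgen (.f i) _).trans (fFun_e hrs i j)
  · intro i j
    refine (hgen (.om' i) _).trans ((char_gen _ (.om j)).trans ?_)
    rw [charGen, chi]
    push_cast
    rfl
  · exact fun i j => (hgen (.f i) _).trans (fFun_om hrs i j)
  · exact fun i j => (hgen (.om' i) _).trans (char_gen _ (.e j))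
  · intro b
    rw [← map_one (leProj n r s), hp, freePairing_one]
  · intro b
    obtain ⟨y, rfl⟩ := leProj_surjective b
    rw [hp, freePairing_one_right]
  · intro b x x'
    obtain ⟨y, rfl⟩ := leProj_surjective b
    rw [hp, freePairing_apply_mul, ← map_leProj_comulFree]
    generalize comulFree K n y = t
    induction t with
    | zero => simp
    | tmul a b =>
      rw [freePairing₂_tmul]
      change freePairing hrs b x * freePairing hrs a x' =
        p (leProj n r s a) x' * p (leProj n r s b) x
      rw [hp, hp, mul_comm]
    | add a b ha hb =>
      simp only [map_add, ← ha, ← hb]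
      rfl
  · intro b b' x
    obtain ⟨y, rfl⟩ := leProj_surjective b
    obtain ⟨z, rfl⟩ := leProj_surjective b'
    rw [← map_mul, hp, freePairing_mul, hp', hp']

end Existence

section Order

variable {K : Type*} [Field K] {n : ℕ} {r s : Kˣ}

/-! ### Roots of unity -/

/-- The order of `r s⁻¹` satisfies the requirements on the exponent `m` of `Bar`. -/
lemma exists_isPrimitiveRoot_div (hrs : r ≠ s) {l : ℕ} (hl : 0 < l) (hr : r ^ l = 1)
    (hs : s ^ l = 1) : ∃ m, 2 ≤ m ∧ m ∣ l ∧ IsPrimitiveRoot ((r : K) * (s : K)⁻¹) m := by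
  have h1 : (r * s⁻¹) ^ l = 1 := by rw [mul_pow, inv_pow, hr, hs, inv_one, mul_one]
  have h2 : orderOf (r * s⁻¹) ∣ l := orderOf_dvd_of_pow_eq_one h1
  have h3 : orderOf (r * s⁻¹) ≠ 1 := fun h => hrs (mul_inv_eq_one.1 (orderOf_eq_one_iff.1 h))
  have h4 := Nat.pos_of_dvd_of_pos h2 hl
  refine ⟨_, by omega, h2, ?_⟩
  simpa using IsPrimitiveRoot.coe_units_iff.2 (IsPrimitiveRoot.orderOf (r * s⁻¹))

end Order

end TwoParam

end

theorem proposition3p2 {K : Type*} [Field K] [CharZero K] (n : ℕ) (hn : 2 ≤ n) (r s : Kˣ)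
    (hrs : r ≠ s) (d d' l : ℕ) (hd : 0 < d) (hd' : 0 < d') (hr : IsPrimitiveRoot r d)
    (hs : IsPrimitiveRoot s d') (hl : l = Nat.lcm d d') :
    (∃! p : TwoParam.Ule n r s →ₗ[K] TwoParam.Uge n r s →ₗ[K] K,
        TwoParam.IsHopfPairing n r s p) ∧
      ∀ p : TwoParam.Ule n r s →ₗ[K] TwoParam.Uge n r s →ₗ[K] K,
        TwoParam.IsHopfPairing n r s p →
          (∀ x : TwoParam.Uge n r s, (x : TwoParam.U n r s) ∈ TwoParam.idealI n r s l →
            ∀ y : TwoParam.Ule n r s, p y x = 0) ∧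
          (∀ y : TwoParam.Ule n r s, (y : TwoParam.U n r s) ∈ TwoParam.idealI n r s l →
            ∀ x : TwoParam.Uge n r s, p y x = 0) ∧
          ∃! q : TwoParam.smallLe n r s l →ₗ[K] TwoParam.smallGe n r s l →ₗ[K] K,
            ∀ (y : TwoParam.Ule n r s) (x : TwoParam.Uge n r s),
              q (TwoParam.toSmallLe n r s l y) (TwoParam.toSmallGe n r s l x) = p y x := by

  have hl0 : 0 < l := hl ▸ Nat.lcm_pos hd hd'
  have hrl : r ^ l = 1 := (hr.pow_eq_one_iff_dvd l).2 (hl ▸ Nat.dvd_lcm_left d d')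
  have hsl : s ^ l = 1 := (hs.pow_eq_one_iff_dvd l).2 (hl ▸ Nat.dvd_lcm_right d d')
  obtain ⟨m, hm, hml, hq⟩ := TwoParam.exists_isPrimitiveRoot_div hrs hl0 hrl hsl
  obtain ⟨p₀, hp₀⟩ := TwoParam.exists_hopfPairing (n := n) hrs
  refine ⟨⟨p₀, hp₀, fun p hp => TwoParam.hopfPairing_unique hrs hp hp₀⟩, fun p hp => ?_⟩
  have h1 (x : TwoParam.Uge n r s) (hx : (x : TwoParam.U n r s) ∈ TwoParam.idealI n r s l)
      (y : TwoParam.Ule n r s) : p y x = 0 := by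
    obtain ⟨ψ, hψ⟩ := TwoParam.exists_pairing_left hrs hm hq hrl hsl hp y
    rw [hψ, TwoParam.toBar_eq_zero hml hl0 hx, map_zero]
  have h2 (y : TwoParam.Ule n r s) (hy : (y : TwoParam.U n r s) ∈ TwoParam.idealI n r s l)
      (x : TwoParam.Uge n r s) : p y x = 0 := by
    obtain ⟨ψ, hψ⟩ := TwoParam.exists_pairing_right hrs hm hq hrl hsl hp x
    rw [hψ, TwoParam.toBar_eq_zero hml hl0 hy, map_zero]
  refine ⟨h1, h2, TwoParam.existsUnique_bilinear_factor
    (φ := (TwoParam.toSmallLe n r s l).toLinearMap) (ψ := (TwoParam.toSmallGe n r s l).toLinearMap)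
    ?_ ?_ p (fun y hy x => h2 y (TwoParam.toSmall_eq_zero (congrArg Subtype.val hy)) x)
    (fun x hx y => h1 x (TwoParam.toSmall_eq_zero (congrArg Subtype.val hx)) y)⟩
  · rintro ⟨_, y, hy, rfl⟩
    exact ⟨⟨y, hy⟩, rfl⟩
  · rintro ⟨_, x, hx, rfl⟩
    exact ⟨⟨x, hx⟩, rfl⟩
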